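/- Let $M$ be a topological space and let $V\to M$ be an oriented real vector bundle of even rank $2n$ ($n\ge 0$; in rank $0$ the orientation is the canonical one) with a continuous positive definite inner product. Let $\pi:\mathcal{F}r\to M$ be the principal $SO(2n)$-bundle of positively oriented orthonormal frames of $V$, viewed as isometries $\mathbb{R}^{2n}\to V_x$, and let $Cl(V)=\mathcal{F}r\times_{SO(2n)}Cl(\mathbb{R}^{2n})$ be the bundle of Clifford algebras of the fibres. Complex vector bundles are locally trivial of finite, locally constant rank. Let $\mathcal{E}^V(M)$ be the category of complex $Cl(V)$-modules: complex vector bundles $E\to M$ with a continuous map $Cl(V)\times_M E\to E$ that makes each $E_x$ a complex $Cl(V_x)$-module; morphisms are the complex vector bundle maps over $\mathrm{id}_M$ that commute with the Clifford actions. Let $\Gamma_{W_3(V)}$ be the lifting bundle gerbe of $\mathcal{F}r$ and the central extension $1\to U(1)\to Spin^c(2n)\to SO(2n)\to 1$, where $Spin^c(2n)=Spin(2n)\times_{\{\pm1\}}U(1)$: the topological groupoid with object space $\mathcal{F}r$ whose arrows with source $q$ and target $p$ ($p,q$ frames of the same $V_x$) are the elements of $Spin^c(2n)$ lying over $p^{-1}q\in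 SO(2n)$, with the multiplication of $Spin^c(2n)$. Let $\mathcal{E}(M,\Gamma_{W_3(V)})$ be the category of $\Gamma_{W_3(V)}$-modules: complex vector bundles $W\to\mathcal{F}r$ with a continuous action $\Gamma_{W_3(V)}\times_{\mathcal{F}r}W\to W$ by linear isomorphisms from the fibre over the source to the fibre over the target of each arrow, compatible with multiplication, and for which $U(1)$ acts by scalar multiplication; morphisms are the complex vector bundle maps over $\mathrm{id}_{\mathcal{F}r}$ that commute with the actions. Both categories are additive under the Whitney sum. Let $S_{2n}$ be an irreducible complex representation of $Cl(\mathbb{R}^{2n})$ (it is unique up to isomorphism). Let $\underline{S_{2n}}^*=\mathcal{F}r\times S_{2n}^*$, with the right action of $Cl(\pi^*V)$ which over a frame $p$ is the transpose of the action on $S_{2n}$ composed with $Cl(p^{-1}):Cl(V_x)\to Cl(\mathbb{R}^{2n})$, and with the action of $Spin^c(2n)$ on $S_{2n}^*$ by $[a,z]\cdot\sigma=z\,(\sigma\circ a^{-1})$ for $a\in Spin(2n)$, $z\in U(1)$. Then there is a functor $$\Psi:\mathcal{E}^V(M)\longrightarrow\mathcal{E}(M,\Gamma_{W_3(V)}),\qquad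 E\longmapsto \underline{S_{2n}}^*\otimes_{Cl(\pi^*V)}\pi^*E$$ (the tensor product being fibrewise over the complexified Clifford algebras, a vector bundle over $\mathcal{F}r$ with the topology induced from $\underline{S_{2n}}^*\otimes\pi^*E$; the arrows of $\Gamma_{W_3(V)}$ act through $\underline{S_{2n}}^*$, and $\Psi(f)=\mathrm{id}\otimes\pi^*f$), and $\Psi$ is an equivalence of categories. In particular $[E]\mapsto[\Psi(E)]$ induces an isomorphism of Grothendieck groups $$K(\mathcal{E}^V(M))\;\cong\;K_{bg}(M,\Gamma_{W_3(V)}).$$ -/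

import Mathlib

open Bundle CategoryTheory
open scoped TensorProduct

universe u v w

noncomputable section

namespace CliffordGerbe

/-! ### Complex vector bundles -/

/-- A complex vector bundle over `X`: a family of complex vector spaces with a topology on the
total space for which the family is locally isomorphic to a trivial bundle `U × ℂᵏ`.  The rank
`k` is locally constant, it may differ from chart to chart.  The first argument of `TotalSpace`
is a dummy and is taken to be `Unit`. -/
structure ComplexBundle (X : Type u) [TopologicalSpace X] : Type (max u (w + 1)) where
  Fib : X → Type w
  [addCommGroup : ∀ x, AddCommGroup (Fib x)]
  [module : ∀ x, Module ℂ (Fib x)]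
  [topology : TopologicalSpace (TotalSpace Unit Fib)]
  locally_trivial : ∀ x : X, ∃ (k : ℕ)
    (e : Trivialization (Fin k → ℂ) (TotalSpace.proj : TotalSpace Unit Fib → X)),
    x ∈ e.baseSet ∧ ∀ y ∈ e.baseSet, IsLinearMap ℂ fun v : Fib y => (e ⟨y, v⟩).2

namespace ComplexBundle

attribute [instance] addCommGroup module topology

variable {X : Type u} [TopologicalSpace X]

/-- The total space of a complex vector bundle. -/
abbrev Total (E : ComplexBundle.{u, w} X) : Type (max u w) := TotalSpace Unit E.Fib

/-- The map of total spaces induced by a family of linear maps between the fibres. -/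
def totalMap {E F : ComplexBundle.{u, w} X} (f : ∀ x, E.Fib x →ₗ[ℂ] F.Fib x) :
    E.Total → F.Total := fun p => ⟨p.proj, f p.proj p.2⟩

theorem continuous_proj (E : ComplexBundle.{u, w} X) :
    Continuous (TotalSpace.proj : E.Total → X) := by
  rw [continuous_iff_continuousAt]
  intro p
  obtain ⟨k, e, hx, -⟩ := E.locally_trivial p.proj
  exact e.continuousAt_proj (e.mem_source.2 hx)

/-- Linear combinations of continuous bundle maps are continuous. -/
theorem continuous_totalMap_of {E F : ComplexBundle.{u, w} X}
    (f g h : ∀ x, E.Fib x →ₗ[ℂ] F.Fib x) (hf : Continuous (totalMap f))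
    (hg : Continuous (totalMap g)) (a b : ℂ) (hh : ∀ x v, h x v = a • f x v + b • g x v) :
    Continuous (totalMap h) := by
  rw [continuous_iff_continuousAt]
  intro p
  obtain ⟨k, e, hx, hlin⟩ := F.locally_trivial p.proj
  have src : ∀ q : F.Total, q.proj = p.proj → q ∈ e.source := fun q hq => by
    rw [e.mem_source, hq]; exact hx
  have cf := ((e.tendsto_nhds_iff (src (totalMap f p) rfl)).1 hf.continuousAt).2
  have cg := ((e.tendsto_nhds_iff (src (totalMap g p) rfl)).1 hg.continuousAt).2
  have key : ∀ q : E.Total, q.proj ∈ e.baseSet →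
      (e (totalMap h q)).2 = a • (e (totalMap f q)).2 + b • (e (totalMap g q)).2 := by
    intro q hq
    have l := hlin q.proj hq
    simp only [totalMap, hh]
    rw [l.map_add, l.map_smul, l.map_smul]
  refine (e.tendsto_nhds_iff (src (totalMap h p) rfl)).2 ⟨E.continuous_proj.continuousAt, ?_⟩
  rw [key p hx]
  refine Filter.Tendsto.congr' ?_ ((cf.const_smul a).add (cg.const_smul b))
  filter_upwards [E.continuous_proj.continuousAt.preimage_mem_nhds
    (e.open_baseSet.mem_nhds hx)] with q hq
  exact (key q hq).symm

theorem continuous_totalMap_zero (E F : ComplexBundle.{u, w} X) :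
    Continuous (totalMap (E := E) (F := F) 0) := by
  rw [continuous_iff_continuousAt]
  intro p
  obtain ⟨k, e, hx, hlin⟩ := F.locally_trivial p.proj
  have key : ∀ q : E.Total, q.proj ∈ e.baseSet → (e (totalMap (F := F) 0 q)).2 = 0 :=
    fun q hq => (hlin q.proj hq).map_zero
  refine (e.tendsto_nhds_iff (e.mem_source.2 hx)).2 ⟨E.continuous_proj.continuousAt, ?_⟩
  rw [key p hx]
  refine Filter.Tendsto.congr' ?_ tendsto_const_nhds
  filter_upwards [E.continuous_proj.continuousAt.preimage_mem_nhds
    (e.open_baseSet.mem_nhds hx)] with q hq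
  exact (key q hq).symm

/-- The additive group of morphisms of vector bundles over the identity of `X`: families of
linear maps which are continuous on total spaces. -/
def homs (E F : ComplexBundle.{u, w} X) : AddSubgroup (∀ x, E.Fib x →ₗ[ℂ] F.Fib x) where
  carrier := {f | Continuous (totalMap f)}
  zero_mem' := continuous_totalMap_zero E F
  add_mem' {f g} hf hg := continuous_totalMap_of f g (f + g) hf hg 1 1 fun x v => by simp
  neg_mem' {f} hf := continuous_totalMap_of f f (-f) hf hf (-1) 0 fun x v => by simp

end ComplexBundle

/-! ### Clifford algebras, spinors, `Spin` and `Spinᶜ` -/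

/-- The positive definite quadratic form `v ↦ ⟪v, v⟫` of a Euclidean space. -/
def euclForm (W : Type*) [NormedAddCommGroup W] [InnerProductSpace ℝ W] :
    QuadraticForm ℝ W := LinearMap.BilinMap.toQuadraticMap (innerₗ W)

/-- The map of Clifford algebras induced by an isometry. -/
def cliffordMap {W W' : Type*} [NormedAddCommGroup W] [InnerProductSpace ℝ W]
    [NormedAddCommGroup W'] [InnerProductSpace ℝ W'] (A : W ≃ₗᵢ[ℝ] W') :
    CliffordAlgebra (euclForm W) →ₐ[ℝ] CliffordAlgebra (euclForm W') :=
  CliffordAlgebra.map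
    { A.toLinearEquiv.toLinearMap with
      map_app' := fun v => by
        simp only [euclForm, LinearMap.BilinMap.toQuadraticMap_apply]
        exact A.inner_map_map v v }

/-- The standard Euclidean space `ℝ²ⁿ`. -/
abbrev Model (n : ℕ) := EuclideanSpace ℝ (Fin (2 * n))

/-- The Clifford algebra of `ℝ²ⁿ` with its standard positive definite quadratic form. -/
abbrev ModelCl (n : ℕ) := CliffordAlgebra (euclForm (Model n))

/-- The usual topology of the finite-dimensional real vector space `Cl(ℝ²ⁿ)`. -/
instance (n : ℕ) : TopologicalSpace (ModelCl n) := moduleTopology ℝ (ModelCl n)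

/-- An irreducible complex representation `S` of `Cl(ℝ²ⁿ)` (unique up to isomorphism). -/
structure SpinorRep (n : ℕ) : Type (w + 1) where
  S : Type w
  [addCommGroup : AddCommGroup S]
  [module : Module ℂ S]
  ρ : ModelCl n →ₐ[ℝ] Module.End ℂ S
  nontrivial : Nontrivial S
  irreducible : ∀ W : Submodule ℂ S, (∀ c, ∀ s ∈ W, ρ c s ∈ W) → W = ⊥ ∨ W = ⊤

attribute [instance] SpinorRep.addCommGroup SpinorRep.module

theorem SpinorRep.nonempty_of_algebra {n : ℕ} (A : Type w) [Ring A] [Nontrivial A]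
    [Algebra ℂ A] (j : ModelCl n →+* A) (hr : ∀ r : ℝ, j (algebraMap ℝ _ r) = algebraMap ℂ A r)
    (hj : Submodule.span ℂ (Set.range j) = ⊤) : Nonempty (SpinorRep.{w} n) := by
  obtain ⟨I, hI⟩ := Ideal.exists_maximal A
  let ρ : ModelCl n →ₐ[ℝ] Module.End ℂ (A ⧸ I) :=
    { (Algebra.lsmul ℂ ℂ (A ⧸ I)).toRingHom.comp j with
      commutes' := fun r => LinearMap.ext fun s => by
        change j (algebraMap ℝ _ r) • s = (r : ℂ) • s
        rw [hr, algebraMap_smul] }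
  refine ⟨{ S := A ⧸ I, ρ := ρ, nontrivial := Submodule.Quotient.nontrivial_iff.2 hI.ne_top,
            irreducible := fun W hW => ?_ }⟩
  have hmem : ∀ (a : A) (s : A ⧸ I), s ∈ W → a • s ∈ W := by
    intro a s hs
    have ha : a ∈ Submodule.span ℂ (Set.range j) := hj ▸ Submodule.mem_top
    induction ha using Submodule.span_induction with
    | mem x hx => obtain ⟨c, rfl⟩ := hx; exact hW c s hs
    | zero => rw [zero_smul]; exact W.zero_mem
    | add x y _ _ hx hy => rw [add_smul]; exact W.add_mem hx hy
    | smul z x _ hx => rw [smul_assoc]; exact W.smul_mem z hx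
  let W' : Submodule A (A ⧸ I) :=
    { carrier := W, zero_mem' := W.zero_mem, add_mem' := W.add_mem
      smul_mem' := fun a s => hmem a s }
  have : IsSimpleModule A (A ⧸ I) := isSimpleModule_iff_isCoatom.2 hI.out
  rcases eq_bot_or_eq_top W' with h | h
  · exact Or.inl (Submodule.ext fun s => SetLike.ext_iff.1 h s)
  · exact Or.inr (Submodule.ext fun s => SetLike.ext_iff.1 h s)

/-- Irreducible complex representations of `Cl(ℝ²ⁿ)` exist. -/
instance (n : ℕ) : Nonempty (SpinorRep.{w} n) := by
  have hn : Nontrivial (ℂ ⊗[ℝ] ModelCl n) :=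
    (Algebra.TensorProduct.includeRight_injective (R := ℝ) (A := ℂ) (B := ModelCl n)
      (algebraMap ℝ ℂ).injective).nontrivial
  refine SpinorRep.nonempty_of_algebra (ULift.{w} (ℂ ⊗[ℝ] ModelCl n))
    ((ULift.algEquiv (R := ℝ) (A := ℂ ⊗[ℝ] ModelCl n)).symm.toAlgHom.comp
      Algebra.TensorProduct.includeRight).toRingHom (fun r => ?_) (eq_top_iff.2 ?_)
  · refine ULift.ext _ _ ?_
    change (1 : ℂ) ⊗ₜ[ℝ] algebraMap ℝ (ModelCl n) r = (r : ℂ) ⊗ₜ[ℝ] (1 : ModelCl n)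
    rw [Algebra.algebraMap_eq_smul_one, TensorProduct.tmul_smul, TensorProduct.smul_tmul']
    simp
  rintro ⟨t⟩ -
  induction t with
  | zero => exact Submodule.zero_mem _
  | add t t' h h' => exact Submodule.add_mem _ h h'
  | tmul z c =>
    have h := Submodule.smul_mem _ z (Submodule.subset_span (R := ℂ) (Set.mem_range_self
      (f := ((ULift.algEquiv.{0, 0, w} (R := ℝ) (A := ℂ ⊗[ℝ] ModelCl n)).symm.toAlgHom.comp
        Algebra.TensorProduct.includeRight).toRingHom) c))
    convert h using 1
    refine ULift.ext _ _ ?_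
    change _ = z • ((1 : ℂ) ⊗ₜ[ℝ] c)
    rw [TensorProduct.smul_tmul', smul_eq_mul, mul_one]

/-- The group `Spin(2n)`. -/
abbrev Spin (n : ℕ) := spinGroup (euclForm (Model n))

/-- The subgroup `ℤ/2 = {(1, 1), (-1, -1)}` of `Spin(2n) × U(1)`. -/
def signSubgroup (n : ℕ) : Subgroup (Spin n × Circle) where
  carrier := {p | ((p.1 : ModelCl n) = 1 ∧ (p.2 : ℂ) = 1) ∨
    ((p.1 : ModelCl n) = -1 ∧ (p.2 : ℂ) = -1)}
  one_mem' := Or.inl ⟨rfl, rfl⟩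
  mul_mem' {p q} hp hq := by
    simp only [Set.mem_ofPred_eq, Prod.fst_mul, Prod.snd_mul, Submonoid.coe_mul, Circle.coe_mul]
    rcases hp with ⟨h₁, h₂⟩ | ⟨h₁, h₂⟩ <;> rcases hq with ⟨k₁, k₂⟩ | ⟨k₁, k₂⟩ <;>
      simp [h₁, h₂, k₁, k₂]
  inv_mem' {p} hp := by
    rcases hp with ⟨h₁, h₂⟩ | ⟨h₁, h₂⟩
    · left
      simp [← spinGroup.star_eq_inv, h₁, h₂]
    · right
      simp [← spinGroup.star_eq_inv, h₁, h₂, inv_neg]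

instance (n : ℕ) : (signSubgroup n).Normal where
  conj_mem p hp g := by
    have : g * p * g⁻¹ = p := by
      rw [mul_inv_eq_iff_eq_mul]
      refine Prod.ext (Subtype.ext ?_) (mul_comm _ _)
      rcases hp with ⟨h₁, -⟩ | ⟨h₁, -⟩ <;> simp [h₁]
    rwa [this]

/-- `Spinᶜ(2n) = Spin(2n) ×_{ℤ/2} U(1)`, with the quotient topology. -/
abbrev SpinC (n : ℕ) := (Spin n × Circle) ⧸ signSubgroup n

/-- The class `[a, z]` in `Spinᶜ(2n)`. -/
def SpinC.mk {n : ℕ} (a : Spin n) (z : Circle) : SpinC n := QuotientGroup.mk (a, z)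

/-- `c ∈ Spinᶜ(2n)` lies over the isometry `A` of `ℝ²ⁿ` under the covering
`[a, z] ↦ (v ↦ a v a⁻¹)` of `SO(2n)` by `Spinᶜ(2n)`. -/
def SpinC.Covers {n : ℕ} (c : SpinC n) (A : Model n ≃ₗᵢ[ℝ] Model n) : Prop :=
  ∃ (a : Spin n) (z : Circle), c = SpinC.mk a z ∧
    ∀ v, (a : ModelCl n) * CliffordAlgebra.ι _ v * ((a⁻¹ : Spin n) : ModelCl n) =
      CliffordAlgebra.ι _ (A v)

theorem SpinC.Covers.mul {n : ℕ} {c d : SpinC n} {A B : Model n ≃ₗᵢ[ℝ] Model n}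
    (hc : c.Covers A) (hd : d.Covers B) : (c * d).Covers (B.trans A) := by
  obtain ⟨a, z, rfl, ha⟩ := hc
  obtain ⟨b, y, rfl, hb⟩ := hd
  refine ⟨a * b, z * y, rfl, fun v => ?_⟩
  rw [mul_inv_rev, LinearIsometryEquiv.trans_apply, ← ha, ← hb]
  simp only [Submonoid.coe_mul, mul_assoc]

theorem SpinC.Covers.phase_mul {n : ℕ} {c : SpinC n} {A : Model n ≃ₗᵢ[ℝ] Model n}
    (hc : c.Covers A) (y : Circle) : (SpinC.mk 1 y * c).Covers A := by
  obtain ⟨a, z, rfl, ha⟩ := hc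
  exact ⟨1 * a, y * z, rfl, by simpa using ha⟩

section Bundles

variable {M : Type u} [TopologicalSpace M] {n : ℕ} (V : M → Type v)
  [∀ x, NormedAddCommGroup (V x)] [∀ x, InnerProductSpace ℝ (V x)]
  [TopologicalSpace (TotalSpace (Model n) V)]

/-- The standard orientation of `ℝ²ⁿ`. -/
def stdOrientation (n : ℕ) : Orientation ℝ (Model n) (Fin (2 * n)) :=
  (EuclideanSpace.basisFun (Fin (2 * n)) ℝ).toBasis.orientation

/-- A family of orientations of the fibres is an orientation of the vector bundle `V` if there
are orientation preserving local trivializations around every point. -/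
def IsBundleOrientation [FiberBundle (Model n) V] [VectorBundle ℝ (Model n) V]
    (o : ∀ x, Orientation ℝ (V x) (Fin (2 * n))) : Prop :=
  ∀ x, ∃ (e : Trivialization (Model n) (TotalSpace.proj : TotalSpace (Model n) V → M))
    (_ : e.IsLinear ℝ), x ∈ e.baseSet ∧ ∀ (y : M) (hy : y ∈ e.baseSet),
      Orientation.map (Fin (2 * n)) (e.linearEquivAt ℝ y hy) (o y) = stdOrientation n

variable (o : ∀ x, Orientation ℝ (V x) (Fin (2 * n)))

/-- The positively oriented orthonormal frames of `V x`, as isometries `ℝ²ⁿ ≃ V x`. -/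
def FrameAt (x : M) : Type v :=
  {f : Model n ≃ₗᵢ[ℝ] V x //
    Orientation.map (Fin (2 * n)) f.toLinearEquiv (stdOrientation n) = o x}

/-- The bundle of positively oriented orthonormal frames of `V`. -/
structure FrameBundle : Type (max u v) where
  base : M
  frame : FrameAt V o base

/-- The topology of the frame bundle, as a subspace of the `2n`-fold fibre product of `V`. -/
instance : TopologicalSpace (FrameBundle V o) :=
  TopologicalSpace.induced
    (fun y => (y.base, fun i : Fin (2 * n) =>
      (⟨y.base, y.frame.1 (EuclideanSpace.single i 1)⟩ : TotalSpace (Model n) V)))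
    inferInstance

/-! ### Clifford modules -/

/-- The fibre `Cl(V_x)` of the Clifford bundle. -/
abbrev ClFib (x : M) : Type v := CliffordAlgebra (euclForm (V x))

/-- The total space of the Clifford bundle `Cl(V) = Fr ×_{SO(2n)} Cl(ℝ²ⁿ)`. -/
structure ClTotal (o : ∀ x, Orientation ℝ (V x) (Fin (2 * n))) : Type (max u v) where
  base : M
  val : ClFib V base

/-- The canonical map `Fr × Cl(ℝ²ⁿ) → Cl(V)`, which identifies `Cl(V)` with the quotient of
`Fr × Cl(ℝ²ⁿ)` by the action of `SO(2n)`. -/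
def clQuot (p : FrameBundle V o × ModelCl n) : ClTotal V o :=
  ⟨p.1.base, cliffordMap p.1.frame.1 p.2⟩

/-- The quotient topology on `Cl(V)`. -/
instance : TopologicalSpace (ClTotal V o) :=
  TopologicalSpace.coinduced (clQuot V o) inferInstance

/-- A complex `Cl(V)`-module: a complex vector bundle with a continuous fibrewise action
`Cl(V) ×_M E → E` which makes each `E_x` a complex `Cl(V_x)`-module. -/
structure CliffordModule : Type (max u v (w + 1)) extends ComplexBundle.{u, w} M where
  cl : ∀ x, ClFib V x →ₐ[ℝ] Module.End ℂ (Fib x)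
  continuous_cl : Continuous fun p : TotalSpace Unit
    ((ClTotal.base : ClTotal V o → M) *ᵖ toComplexBundle.Fib) =>
      (⟨p.1.base, cl p.1.base p.1.val p.2⟩ : toComplexBundle.Total)

/-- Morphisms of complex `Cl(V)`-modules. -/
def CliffordModule.homs (E F : CliffordModule.{u, v, w} V o) :
    AddSubgroup (∀ x, E.Fib x →ₗ[ℂ] F.Fib x) where
  carrier := {f | f ∈ ComplexBundle.homs E.toComplexBundle F.toComplexBundle ∧
    ∀ x c e, f x (E.cl x c e) = F.cl x c (f x e)}
  zero_mem' := ⟨zero_mem _, by simp⟩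
  add_mem' hf hg := ⟨add_mem hf.1 hg.1, fun x c e => by simp [hf.2, hg.2]⟩
  neg_mem' hf := ⟨neg_mem hf.1, fun x c e => by simp [hf.2]⟩

/-- The category of complex `Cl(V)`-modules. -/
instance : Category (CliffordModule.{u, v, w} V o) where
  Hom E F := CliffordModule.homs V o E F
  id E := ⟨fun _ => LinearMap.id, continuous_id, fun _ _ _ => rfl⟩
  comp f g := ⟨fun x => g.1 x ∘ₗ f.1 x, g.2.1.comp f.2.1, fun x c e => by
    simp [f.2.2, g.2.2]⟩

instance : Preadditive (CliffordModule.{u, v, w} V o) where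
  homGroup E F := inferInstanceAs (AddCommGroup (CliffordModule.homs V o E F))
  add_comp _ _ _ f f' g := Subtype.ext (funext fun x => LinearMap.ext fun e =>
    map_add (g.1 x) (f.1 x e) (f'.1 x e))
  comp_add _ _ _ _ _ _ := Subtype.ext (funext fun _ => LinearMap.ext fun _ => rfl)

/-! ### The lifting bundle gerbe and its modules -/

variable {V o} in
/-- The fibre of the lifting bundle gerbe over the pair `(p, q)` of frames: the elements of
`Spinᶜ(2n)` over the element `A = p⁻¹ q` of `SO(2n)`, for which `q = p ∘ A`. -/
def GerbeFib {x : M} (p q : FrameAt V o x) : Type :=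
  {c : SpinC n // c.Covers (q.1.trans p.1.symm)}

variable {V o} in
/-- The bundle gerbe multiplication. -/
def GerbeFib.mul {x : M} {p q r : FrameAt V o x} (g : GerbeFib p q) (h : GerbeFib q r) :
    GerbeFib p r :=
  ⟨g.1 * h.1, by
    have := g.2.mul h.2
    rwa [show (r.1.trans q.1.symm).trans (q.1.trans p.1.symm) = r.1.trans p.1.symm from
      LinearIsometryEquiv.ext fun v => by simp] at this⟩

variable {V o} in
/-- The action of `U(1)` on the fibres of the bundle gerbe. -/
def GerbeFib.phase {x : M} {p q : FrameAt V o x} (z : Circle) (g : GerbeFib p q) :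
    GerbeFib p q :=
  ⟨SpinC.mk 1 z * g.1, g.2.phase_mul z⟩

/-- The lifting bundle gerbe of the frame bundle and the central extension
`1 → U(1) → Spinᶜ(2n) → SO(2n) → 1`: a `U(1)`-bundle over `Fr ×_M Fr`, which is the space of
arrows of a groupoid with the space of objects `Fr`. -/
structure LiftingGerbe : Type (max u v) where
  base : M
  left : FrameAt V o base
  right : FrameAt V o base
  arrow : GerbeFib left right

namespace LiftingGerbe

variable {V o}

/-- The target of an arrow. -/
def tgt (γ : LiftingGerbe V o) : FrameBundle V o := ⟨γ.base, γ.left⟩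

/-- The source of an arrow. -/
def src (γ : LiftingGerbe V o) : FrameBundle V o := ⟨γ.base, γ.right⟩

/-- The lifting bundle gerbe is a subspace of `Fr × Fr × Spinᶜ(2n)`. -/
instance : TopologicalSpace (LiftingGerbe V o) :=
  TopologicalSpace.induced (fun γ => (γ.tgt, γ.src, γ.arrow.1)) inferInstance

end LiftingGerbe

/-- A module over the lifting bundle gerbe: a complex vector bundle over the frame bundle with
a continuous action `Γ ×_{Fr} W → W`, which maps the fibre over the source of an arrow
isomorphically to the fibre over its target, is compatible with the bundle gerbe multiplication,
and for which `U(1)` acts by scalars. -/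
structure GerbeModule : Type (max u v (w + 1)) extends
    ComplexBundle.{max u v, w} (FrameBundle V o) where
  act : ∀ γ : LiftingGerbe V o, Fib γ.src ≃ₗ[ℂ] Fib γ.tgt
  continuous_act : Continuous fun p : TotalSpace Unit
    ((LiftingGerbe.src : LiftingGerbe V o → FrameBundle V o) *ᵖ toComplexBundle.Fib) =>
      (⟨p.1.tgt, act p.1 p.2⟩ : toComplexBundle.Total)
  act_mul : ∀ (x : M) (p q r : FrameAt V o x) (g : GerbeFib p q) (h : GerbeFib q r)
    (e : Fib ⟨x, r⟩), act ⟨x, p, q, g⟩ (act ⟨x, q, r, h⟩ e) = act ⟨x, p, r, g.mul h⟩ e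
  act_phase : ∀ (x : M) (p q : FrameAt V o x) (g : GerbeFib p q) (z : Circle)
    (e : Fib ⟨x, q⟩), act ⟨x, p, q, g.phase z⟩ e = (z : ℂ) • act ⟨x, p, q, g⟩ e

/-- Morphisms of bundle gerbe modules. -/
def GerbeModule.homs (W W' : GerbeModule.{u, v, w} V o) :
    AddSubgroup (∀ y, W.Fib y →ₗ[ℂ] W'.Fib y) where
  carrier := {f | f ∈ ComplexBundle.homs W.toComplexBundle W'.toComplexBundle ∧
    ∀ γ e, f γ.tgt (W.act γ e) = W'.act γ (f γ.src e)}
  zero_mem' := ⟨zero_mem _, by simp⟩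
  add_mem' hf hg := ⟨add_mem hf.1 hg.1, fun γ e => by simp [hf.2, hg.2]⟩
  neg_mem' hf := ⟨neg_mem hf.1, fun γ e => by simp [hf.2]⟩

/-- The category of modules over the lifting bundle gerbe. -/
instance : Category (GerbeModule.{u, v, w} V o) where
  Hom W W' := GerbeModule.homs V o W W'
  id W := ⟨fun _ => LinearMap.id, continuous_id, fun _ _ => rfl⟩
  comp f g := ⟨fun x => g.1 x ∘ₗ f.1 x, g.2.1.comp f.2.1, fun γ e => by
    simp [f.2.2, g.2.2]⟩

instance : Preadditive (GerbeModule.{u, v, w} V o) where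
  homGroup W W' := inferInstanceAs (AddCommGroup (GerbeModule.homs V o W W'))
  add_comp _ _ _ f f' g := Subtype.ext (funext fun x => LinearMap.ext fun e =>
    map_add (g.1 x) (f.1 x e) (f'.1 x e))
  comp_add _ _ _ _ _ _ := Subtype.ext (funext fun _ => LinearMap.ext fun _ => rfl)

/-! ### The functor `E ↦ S* ⊗_{Cl} π^*E` -/

variable {V o}

/-- The right action of `c ∈ Cl(V_x)` on the fibre `S*` over the frame `p` of the trivial bundle
with fibre `S*`: the transpose of the action on `S` of the image of `c` under
`Cl(p⁻¹) : Cl(V_x) → Cl(ℝ²ⁿ)`. -/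
def dualMul (S : SpinorRep.{w} n) {x : M} (p : FrameAt V o x) (c : ClFib V x)
    (σ : Module.Dual ℂ S.S) : Module.Dual ℂ S.S :=
  σ ∘ₗ S.ρ (cliffordMap p.1.symm c)

/-- The action of `[a, z] ∈ Spinᶜ(2n)` on `S*`: the contragredient of the spin representation
on `Spin(2n)`, and scalar multiplication on `U(1)`. -/
def dualSpin (S : SpinorRep.{w} n) (a : Spin n) (z : Circle)
    (σ : Module.Dual ℂ S.S) : Module.Dual ℂ S.S :=
  (z : ℂ) • (σ ∘ₗ S.ρ ((a⁻¹ : Spin n) : ModelCl n))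

/-- The subspace of `S* ⊗ E_x` spanned by the elements `σ c ⊗ e - σ ⊗ c e`. -/
def balanced (S : SpinorRep.{w} n) (E : CliffordModule.{u, v, w} V o) (y : FrameBundle V o) :
    Submodule ℂ (Module.Dual ℂ S.S ⊗[ℂ] E.Fib y.base) :=
  Submodule.span ℂ {t | ∃ (σ : Module.Dual ℂ S.S) (c : ClFib V y.base) (e : E.Fib y.base),
    t = dualMul S y.frame c σ ⊗ₜ[ℂ] e - σ ⊗ₜ[ℂ] E.cl y.base c e}

/-- The fibre `S* ⊗_{Cl(V_x)} E_x` over the frame `y` of `V_x` (a tensor product over the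
complexified Clifford algebra). -/
abbrev SpinorTensor (S : SpinorRep.{w} n) (E : CliffordModule.{u, v, w} V o)
    (y : FrameBundle V o) : Type w :=
  (Module.Dual ℂ S.S ⊗[ℂ] E.Fib y.base) ⧸ balanced S E y

/-- The class of `σ ⊗ e` in `S* ⊗_{Cl(V_x)} E_x`. -/
def SpinorTensor.mk (S : SpinorRep.{w} n) (E : CliffordModule.{u, v, w} V o)
    (y : FrameBundle V o) (σ : Module.Dual ℂ S.S) (e : E.Fib y.base) : SpinorTensor S E y :=
  (balanced S E y).mkQ (σ ⊗ₜ[ℂ] e)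

/-- `Ψ` is the functor `E ↦ S* ⊗_{Cl(π^*V)} π^*E`: the fibres of `Ψ E` are the tensor products
`S* ⊗_{Cl(V_x)} E_x`, in such a way that `Ψ f` is `id ⊗ f`, an arrow of the bundle gerbe acts
through the action of `Spinᶜ(2n)` on `S*`, and `e ↦ σ ⊗ e` is a continuous map of total spaces
from `π^*E` to `Ψ E` for every `σ ∈ S*`, which determines the topology of the vector bundle
`Ψ E`. -/
def IsSpinorTensorFunctor (S : SpinorRep.{w} n)
    (Ψ : CliffordModule.{u, v, w} V o ⥤ GerbeModule.{u, v, w} V o) : Prop :=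
  ∃ θ : ∀ (E : CliffordModule.{u, v, w} V o) (y : FrameBundle V o),
      SpinorTensor S E y ≃ₗ[ℂ] (Ψ.obj E).Fib y,
    (∀ (E F : CliffordModule.{u, v, w} V o) (f : E ⟶ F) (y : FrameBundle V o)
      (σ : Module.Dual ℂ S.S) (e : E.Fib y.base),
      (Ψ.map f).1 y (θ E y (.mk S E y σ e)) = θ F y (.mk S F y σ (f.1 y.base e))) ∧
    (∀ (E : CliffordModule.{u, v, w} V o) (γ : LiftingGerbe V o) (a : Spin n) (z : Circle),
      γ.arrow.1 = SpinC.mk a z → ∀ (σ : Module.Dual ℂ S.S) (e : E.Fib γ.base),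
      (Ψ.obj E).act γ (θ E γ.src (.mk S E γ.src σ e)) =
        θ E γ.tgt (.mk S E γ.tgt (dualSpin S a z σ) e)) ∧
    (∀ (E : CliffordModule.{u, v, w} V o) (σ : Module.Dual ℂ S.S),
      Continuous fun p : TotalSpace Unit
        ((FrameBundle.base : FrameBundle V o → M) *ᵖ E.Fib) =>
        (⟨p.1, θ E p.1 (.mk S E p.1 σ p.2)⟩ : (Ψ.obj E).Total))

end Bundles

/-! ### Grothendieck groups -/

/-- The Grothendieck group of an additive category: generated by the objects, with a relation
`[Y ⊕ Z] = [Y] + [Z]` for every (choice of a) direct sum of every two objects. -/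
def K0 (C : Type*) [Category C] [Preadditive C] : Type _ :=
  FreeAbelianGroup C ⧸ AddSubgroup.closure
    {t : FreeAbelianGroup C | ∃ (Y Z : C) (b : Limits.BinaryBicone Y Z), Nonempty b.IsBilimit ∧
      t = FreeAbelianGroup.of b.pt - (FreeAbelianGroup.of Y + FreeAbelianGroup.of Z)}

instance (C : Type*) [Category C] [Preadditive C] : AddCommGroup (K0 C) :=
  inferInstanceAs (AddCommGroup (FreeAbelianGroup C ⧸ AddSubgroup.closure _))

/-- The class `[X]` of an object in the Grothendieck group. -/
def K0.of {C : Type*} [Category C] [Preadditive C] (X : C) : K0 C :=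
  QuotientAddGroup.mk (FreeAbelianGroup.of X)

end CliffordGerbe

end

/-! The theorem is Morita theory in the fibres, made continuous. In even dimension the complexified
Clifford algebra is all of `End S` (`SpinorRep.complexRep_injective`,
`SpinorRep.complexRep_surjective`). A frame of `V_x` therefore makes a `Cl(V_x)`-module `E_x` an
`End S`-module, so that `E_x ≅ S ⊗ (S* ⊗_{Cl} E_x)`. The actions coming from two frames are
conjugate by a spin lift of the element of `SO(2n)` between them (`CliffordModule.op_change`). The
lift is unique only up to sign, and the gerbe keeps track of this ambiguity.

To give `S* ⊗_{Cl} E` a bundle topology without working on a quotient, fix `vec ∈ S` and `covec ∈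
S*` with `covec vec = 1`. Then `σ ⊗ e ↦ (vec ⊗ σ) e` identifies the tensor product with the image of
the rank one idempotent `vec ⊗ covec` acting on `E_x` (`CliffordModule.tensorEquiv`). Images of
continuous families of idempotents are vector bundles, since nearby idempotents are conjugate
(`ComplexBundle.imageBundle`). An arrow `[a, z]` acts on the image by `z ρ(a⁻¹)`, taken in the
target frame (`CliffordModule.op_spinInv_op`).

The functor is fully faithful because `1 = ∑ (b_j ⊗ covec)(vec ⊗ b^j)` recovers `E_x` from its
spinor part (`CliffordModule.sum_op_proj`). A map of spinor parts extends uniquely to an `End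
S`-linear map, and for a gerbe morphism the extension does not depend on the frame
(`CliffordModule.extendMap_frame`), so it descends to `M`.

For essential surjectivity, a gerbe module `W` yields `Hom(S*, W_p) ≅ S ⊗ W_p`. A change of frame
uses the same spin lift on `S` and on `W`, so its sign cancels (`GerbeModule.twistBy_eq`) and the
frame changes form an honest cocycle (`GerbeModule.twist_twist`). The descended bundle is a Clifford
module, and evaluation at `covec` maps its spinor part isomorphically to `W`
(`GerbeModule.spreadEval_bijective`).

Continuity rests on two local existence statements: continuous oriented orthonormal frames
(`exists_local_frame`, by Gram–Schmidt) and continuous spin lifts of families in `SO(2n)`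
(`Spin.exists_continuousAt_lift`). The isomorphism of Grothendieck groups follows because the
functor is additive. -/

noncomputable section

namespace CliffordGerbe

/-! ### Algebras generated by anticommuting involutions -/

/-- A family of pairwise anticommuting square roots of `1`. -/
structure IsCliffordFamily {R : Type*} [Ring R] {m : ℕ} (g : Fin m → R) : Prop where
  sq : ∀ i, g i * g i = 1
  anti : ∀ i j, i ≠ j → g i * g j = -(g j * g i)

namespace IsCliffordFamily

variable {R : Type*} [Ring R] {m : ℕ} {g : Fin m → R}

theorem map {R' F : Type*} [Ring R'] [FunLike F R R'] [RingHomClass F R R']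
    (hg : IsCliffordFamily g) (f : F) : IsCliffordFamily fun i => f (g i) where
  sq i := by rw [← map_mul, hg.sq, map_one]
  anti i j h := by rw [← map_mul, hg.anti i j h, map_neg, map_mul]

/-- Every letter different from `i` contributes a sign and every letter equal to `i` none, so the
natural exponent is length minus count. The sum has the same parity and stays in `ℕ`. -/
theorem mul_word (hg : IsCliffordFamily g) (i : Fin m) (l : List (Fin m)) :
    g i * (l.map g).prod = (-1) ^ (l.length + l.count i) * ((l.map g).prod * g i) := by
  induction l with
  | nil => simp
  | cons j l ih =>
    rw [List.map_cons, List.prod_cons, List.length_cons]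
    by_cases h : j = i
    · subst h
      rw [List.count_cons_self, ← add_assoc, add_right_comm _ 1, add_assoc _ 1 1, pow_add,
        mul_assoc, mul_assoc, ih]
      have hc : ∀ k : ℕ, g j * (-1) ^ k = (-1) ^ k * g j := fun k =>
        ((Commute.neg_one_right (g j)).pow_right k).eq
      rw [← mul_assoc (g j) ((-1) ^ _), hc]
      simp [mul_assoc]
    · rw [List.count_cons_of_ne h, ← mul_assoc, hg.anti i j (Ne.symm h), neg_mul, mul_assoc, ih,
        add_right_comm, pow_succ]
      have hc : ∀ k : ℕ, g j * (-1) ^ k = (-1) ^ k * g j := fun k =>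
        ((Commute.neg_one_right (g j)).pow_right k).eq
      rw [← mul_assoc (g j) ((-1) ^ _), hc]
      simp [mul_assoc]

/-- Words are simultaneous eigenvectors, with eigenvalues `±1`, of the conjugations by the
generators. Averaging over these conjugations therefore selects words. -/
theorem conj_word (hg : IsCliffordFamily g) (i : Fin m) (l : List (Fin m)) :
    g i * (l.map g).prod * g i = (-1) ^ (l.length + l.count i) * (l.map g).prod := by
  rw [hg.mul_word, mul_assoc, mul_assoc, hg.sq, mul_one]

/-- A repeated letter of a word can be cancelled up to sign. -/
theorem word_cancel (hg : IsCliffordFamily g) (i : Fin m) (l l' : List (Fin m)) :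
    ∃ k : ℕ, ((i :: (l ++ i :: l')).map g).prod = (-1) ^ k * ((l ++ l').map g).prod := by
  refine ⟨l.length + l.count i, ?_⟩
  have := hg.conj_word i l
  simp only [List.map_cons, List.map_append, List.prod_cons, List.prod_append] at this ⊢
  rw [← mul_assoc, ← mul_assoc, this, mul_assoc]

/-- By parity the first letter occurs again, and `word_cancel` removes both occurrences. The bound
`N` carries the induction because the shortened word is not a structural part of `l`. -/
theorem word_eq_of_even_count (hg : IsCliffordFamily g) :
    ∀ (N : ℕ) (l : List (Fin m)), l.length ≤ N → (∀ i, Even (l.count i)) →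
      ∃ k : ℕ, (l.map g).prod = (-1) ^ k
  | _, [], _, _ => ⟨0, by simp⟩
  | 0, j :: l, h, _ => by simp at h
  | N + 1, j :: l, h, hl => by
    have hj := hl j
    rw [List.count_cons_self] at hj
    have hmem : j ∈ l := by
      rw [← List.count_pos_iff]
      rcases Nat.eq_zero_or_pos (l.count j) with h0 | h0
      · rw [h0] at hj; simp at hj
      · exact h0
    obtain ⟨s, t, rfl⟩ := List.append_of_mem hmem
    obtain ⟨k, hk⟩ := hg.word_cancel j s t
    simp only [List.length_cons, List.length_append] at h
    obtain ⟨k', hk'⟩ := word_eq_of_even_count hg N (s ++ t)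
      (by rw [List.length_append]; omega) fun i => by
        have := hl i
        simp only [List.count_cons, List.count_append] at this ⊢
        split_ifs at this
        · rw [Nat.even_iff] at this ⊢; omega
        · simpa using this
    exact ⟨k + k', by rw [hk, hk', pow_add]⟩

/-- Repeated letters cancel in pairs up to sign. Once no letter is repeated, at most `m` letters
remain. -/
theorem word_eq_nodup (hg : IsCliffordFamily g) :
    ∀ (N : ℕ) (l : List (Fin m)), l.length ≤ N →
      ∃ (k : ℕ) (l' : List (Fin m)), l'.length ≤ m ∧
        (l.map g).prod = (-1) ^ k * (l'.map g).prod
  | 0, l, h => ⟨0, l, by omega, by simp⟩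
  | N + 1, l, h => by
    by_cases hl : l.Nodup
    · exact ⟨0, l, by simpa using hl.length_le_card, by simp⟩
    · rw [← List.exists_duplicate_iff_not_nodup] at hl
      obtain ⟨j, hj⟩ := hl
      rw [List.duplicate_iff_sublist] at hj
      obtain ⟨r, s, t, rfl⟩ : ∃ r s t, l = r ++ j :: (s ++ j :: t) := by
        obtain ⟨r, l', rfl⟩ := List.append_of_mem (hj.subset (List.mem_cons_self))
        by_cases hr : j ∈ r
        · obtain ⟨a, b, rfl⟩ := List.append_of_mem hr
          exact ⟨a, b, l', by simp⟩
        · have h2 : 2 ≤ (r ++ j :: l').count j := by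
            simpa using hj.count_le j
          have : j ∈ l' := by
            rw [List.count_append, List.count_cons_self, List.count_eq_zero_of_not_mem hr] at h2
            exact List.count_pos_iff.1 (by omega)
          obtain ⟨s, t, rfl⟩ := List.append_of_mem this
          exact ⟨r, s, t, rfl⟩
      obtain ⟨k, hk⟩ := hg.word_cancel j s t
      obtain ⟨k', l', hl', e⟩ := word_eq_nodup hg N (r ++ (s ++ t)) (by
        simp only [List.length_append, List.length_cons] at h ⊢; omega)
      refine ⟨k + k', l', hl', ?_⟩
      rw [pow_add, mul_assoc, ← e, List.map_append, List.prod_append, hk,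
        List.map_append (l₁ := r), List.prod_append (l₁ := r.map g), ← mul_assoc, ← mul_assoc,
        ((Commute.neg_one_right (r.map g).prod).pow_right k).eq]

variable {k : Type*} [Field k] [Algebra k R]

theorem span_words (hgen : Algebra.adjoin k (Set.range g) = ⊤) :
    Submodule.span k (Set.range fun l : List (Fin m) => (l.map g).prod) = ⊤ := by
  rw [← Algebra.top_toSubmodule, ← hgen, Algebra.adjoin_eq_span]
  congr 1
  ext x
  constructor
  · rintro ⟨l, rfl⟩
    exact Submonoid.list_prod_mem _ fun x hx => by
      obtain ⟨i, -, rfl⟩ := List.mem_map.1 hx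
      exact Submonoid.subset_closure ⟨i, rfl⟩
  · intro hx
    induction hx using Submonoid.closure_induction with
    | mem x hx => obtain ⟨i, rfl⟩ := hx; exact ⟨[i], by simp⟩
    | one => exact ⟨[], by simp⟩
    | mul x y _ _ hx hy =>
      obtain ⟨l, rfl⟩ := hx
      obtain ⟨l', rfl⟩ := hy
      exact ⟨l ++ l', by simp⟩

/-- Words span, and up to sign only the finitely many words of length at most `m` are needed. -/
theorem finite_of_adjoin (hg : IsCliffordFamily g)
    (hgen : Algebra.adjoin k (Set.range g) = ⊤) : Module.Finite k R := by
  have hfin : (Set.range fun l : {l : List (Fin m) // l.length ≤ m} =>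
      (l.1.map g).prod).Finite :=
    have : Finite {l : List (Fin m) // l.length ≤ m} := List.finite_length_le (Fin m) m
    Set.finite_range _
  refine ⟨⟨hfin.toFinset, ?_⟩⟩
  rw [Set.Finite.coe_toFinset, eq_top_iff, ← span_words hgen, Submodule.span_le]
  rintro _ ⟨l, rfl⟩
  obtain ⟨n, l', hl', e⟩ := hg.word_eq_nodup _ l le_rfl
  have : (l.map g).prod = ((-1 : k) ^ n) • (l'.map g).prod := by
    rw [e, Algebra.smul_def]; simp
  simp only [this]
  exact Submodule.smul_mem _ _ (Submodule.subset_span ⟨⟨l', hl'⟩, rfl⟩)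

/-- The words which are fixed by conjugation with every generator in `L`. -/
theorem mem_span_fixed_words (hg : IsCliffordFamily g) (h2 : (2 : k) ≠ 0)
    (hgen : Algebra.adjoin k (Set.range g) = ⊤) (L : Finset (Fin m)) :
    ∀ a : R, (∀ i ∈ L, g i * a * g i = a) →
      a ∈ Submodule.span k {x | ∃ l : List (Fin m), (∀ i ∈ L, Even (l.length + l.count i)) ∧
        x = (l.map g).prod} := by
  classical
  induction L using Finset.induction_on with
  | empty =>
    intro a _
    have : a ∈ (⊤ : Submodule k R) := trivial
    rw [← span_words hgen] at this
    refine Submodule.span_mono ?_ this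
    rintro _ ⟨l, rfl⟩
    exact ⟨l, by simp, rfl⟩
  | insert i L _ ih =>
    intro a ha
    have hL := ih a fun j hj => ha j (Finset.mem_insert_of_mem hj)
    -- `Q` is conjugation by the involution `g i`, so `(1 + Q)/2` keeps the words fixed by it and
    -- kills those whose sign changes. It fixes `a` by assumption.
    let Q : R →ₗ[k] R := LinearMap.mulLeft k (g i) ∘ₗ LinearMap.mulRight k (g i)
    have hQ : ∀ x, Q x = g i * x * g i := fun x => by simp [Q, mul_assoc]
    have key : ∀ x ∈ Submodule.span k {x | ∃ l : List (Fin m),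
        (∀ i ∈ L, Even (l.length + l.count i)) ∧ x = (l.map g).prod},
        x + Q x ∈ Submodule.span k {x | ∃ l : List (Fin m),
          (∀ j ∈ insert i L, Even (l.length + l.count j)) ∧ x = (l.map g).prod} := by
      intro x hx
      induction hx using Submodule.span_induction with
      | mem x hx =>
        obtain ⟨l, hl, rfl⟩ := hx
        rw [hQ, hg.conj_word]
        rcases Nat.even_or_odd (l.length + l.count i) with h | h
        · have hm := Submodule.subset_span (R := k) (s := {x | ∃ l : List (Fin m),
              (∀ j ∈ insert i L, Even (l.length + l.count j)) ∧ x = (l.map g).prod})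
              ⟨l, fun j hj => ?_, rfl⟩
          · rw [h.neg_one_pow, one_mul]; exact add_mem hm hm
          · rcases Finset.mem_insert.1 hj with rfl | hj
            · exact h
            · exact hl j hj
        · rw [h.neg_one_pow]; simp
      | zero => simp
      | add x y _ _ hx hy =>
        rw [map_add, add_add_add_comm]; exact add_mem hx hy
      | smul c x _ hx => rw [map_smul, ← smul_add]; exact Submodule.smul_mem _ c hx
    have := Submodule.smul_mem _ (2 : k)⁻¹ (key a hL)
    rwa [hQ, ha i (Finset.mem_insert_self _ _), ← two_smul k a, smul_smul, inv_mul_cancel₀ h2,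
      one_smul] at this

/-- The centre of an algebra generated by an even number of anticommuting involutions consists
of the scalars. -/
theorem exists_algebraMap_of_central (hg : IsCliffordFamily g) (h2 : (2 : k) ≠ 0) (hm : Even m)
    (hgen : Algebra.adjoin k (Set.range g) = ⊤) (a : R) (ha : ∀ i, g i * a = a * g i) :
    ∃ c : k, a = algebraMap k R c := by
  have h := hg.mem_span_fixed_words h2 hgen Finset.univ a fun i _ => by
    rw [ha, mul_assoc, hg.sq, mul_one]
  suffices hle : Submodule.span k {x | ∃ l : List (Fin m),
      (∀ i ∈ Finset.univ, Even (l.length + l.count i)) ∧ x = (l.map g).prod} ≤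
      Submodule.span k {1} by
    obtain ⟨c, hc⟩ := Submodule.mem_span_singleton.1 (hle h)
    exact ⟨c, by rw [← hc, Algebra.algebraMap_eq_smul_one]⟩
  rw [Submodule.span_le]
  rintro _ ⟨l, hl, rfl⟩
  -- Summing the even numbers `length + count i` over all `i` gives `m * length + length`. As `m` is
  -- even, the length is even, and hence so is every count.
  have hlen : Even l.length := by
    have h1 : Even (∑ i : Fin m, (l.length + l.count i)) := Finset.even_sum _ fun i hi => hl i hi
    rw [Finset.sum_add_distrib, Finset.sum_const, Finset.card_univ, Fintype.card_fin,
      smul_eq_mul, ← Multiset.coe_card] at h1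
    have h3 : ∑ i : Fin m, l.count i = l.length := by
      have := Multiset.sum_count_eq_card (s := Finset.univ) (m := (l : Multiset (Fin m))) (by simp)
      simpa using this
    rw [h3, Multiset.coe_card, Nat.even_add] at h1
    exact h1.1 (hm.mul_right _)
  obtain ⟨n, hn⟩ := hg.word_eq_of_even_count _ l le_rfl fun i =>
    (Nat.even_add.1 (hl i (Finset.mem_univ i))).1 hlen
  rw [hn]
  refine Submodule.mem_span_singleton.2 ⟨(-1) ^ n, ?_⟩
  rw [← Algebra.algebraMap_eq_smul_one]; simp

/-- A subspace which is stable under multiplication with the generators from both sides is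
contained in every left stable subspace which contains its central elements. -/
theorem le_of_central_le (hg : IsCliffordFamily g) (h2 : (2 : k) ≠ 0) (hm : Even m)
    (D N : Submodule k R) (hD : ∀ i, ∀ a ∈ D, g i * a ∈ D) (hD' : ∀ i, ∀ a ∈ D, a * g i ∈ D)
    (hN : ∀ i, ∀ a ∈ N, g i * a ∈ N) (hDN : ∀ a ∈ D, (∀ i, g i * a = a * g i) → a ∈ N) :
    D ≤ N := by
  classical
  have hword : ∀ (B : Submodule k R), (∀ i, ∀ a ∈ B, g i * a ∈ B) → ∀ (l : List (Fin m)),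
      ∀ a ∈ B, (l.map g).prod * a ∈ B := by
    intro B hB l a ha
    induction l with
    | nil => simpa using ha
    | cons j l ih => rw [List.map_cons, List.prod_cons, mul_assoc]; exact hB j _ ih
  have hrev : ∀ l : List (Fin m), (l.reverse.map g).prod * (l.map g).prod = 1 := by
    intro l
    induction l with
    | nil => simp
    | cons j l ih =>
      simp only [List.reverse_cons, List.map_append, List.prod_append, List.map_cons,
        List.prod_cons, List.map_nil, List.prod_nil, mul_one]
      rw [mul_assoc, ← mul_assoc (g j), hg.sq, one_mul, ih]
  -- `L` is the set of generators with which `a` is allowed not to commute; for `L = ∅` the element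
  -- is central.
  suffices H : ∀ L : Finset (Fin m), ∀ a ∈ D, (∀ i ∉ L, g i * a * g i = a) → a ∈ N from
    fun a ha => H Finset.univ a ha (by simp)
  intro L
  induction L using Finset.induction_on with
  | empty =>
    intro a ha h
    refine hDN a ha fun i => ?_
    conv_rhs => rw [← h i (by simp)]
    rw [mul_assoc, hg.sq, mul_one]
  | insert i L hi ih =>
    intro a ha h
    -- The word in all generators except `g i` has odd length `m - 1`. It commutes with every `g j`
    -- for `j ≠ i` and anticommutes with `g i`, so multiplication by it turns the `-1` eigenspace of
    -- conjugation by `g i` into the `+1` eigenspace and leaves the other conjugations unaffected.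
    let l : List (Fin m) := (List.finRange m).filter (· ≠ i)
    have hnd : l.Nodup := (List.nodup_finRange m).filter _
    have hcount : ∀ j, l.count j = if j = i then 0 else 1 := by
      intro j
      split_ifs with hj
      · exact List.count_eq_zero_of_not_mem (by simp [l, hj])
      · exact List.count_eq_one_of_mem hnd (by simp [l, hj])
    have hlen : l.length + 1 = m := by
      have h3 : ∑ j : Fin m, l.count j = l.length := by
        have := Multiset.sum_count_eq_card (s := Finset.univ) (m := (l : Multiset (Fin m)))
          (by simp)
        simpa using this
      rw [← h3]
      simp only [hcount]
      rw [Finset.sum_ite, Finset.sum_const_zero, zero_add, Finset.sum_const, smul_eq_mul, mul_one,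
        Finset.filter_ne', Finset.card_erase_of_mem (Finset.mem_univ i), Finset.card_univ,
        Fintype.card_fin]
      have := i.2
      omega
    have hodd : Odd l.length := by
      rw [← hlen] at hm
      rcases Nat.even_or_odd l.length with h' | h'
      · exact absurd hm (by rw [Nat.even_add_one]; simpa using h')
      · exact h'
    have hcj : ∀ j, j ≠ i → ∀ x, g j * ((l.map g).prod * x) * g j =
        (l.map g).prod * (g j * x * g j) := by
      intro j hj x
      have := hg.mul_word j l
      rw [hcount, if_neg hj, hodd.add_one.neg_one_pow, one_mul] at this
      rw [← mul_assoc (g j), this]; simp only [mul_assoc]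
    have hci : ∀ x, g i * ((l.map g).prod * x) * g i = -((l.map g).prod * (g i * x * g i)) := by
      intro x
      have := hg.mul_word i l
      rw [hcount, if_pos rfl, add_zero, hodd.neg_one_pow] at this
      rw [← mul_assoc (g i), this]; simp only [mul_assoc, neg_mul, one_mul]
    have hga : g i * a * g i ∈ D := hD' i _ (hD i _ ha)
    have hswap : ∀ j, j ≠ i → ∀ x, g j * (g i * x * g i) * g j = g i * (g j * x * g j) * g i := by
      intro j hj x
      calc _ = (g j * g i) * x * (g i * g j) := by simp only [mul_assoc]
        _ = (g i * g j) * x * (g j * g i) := by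
          rw [hg.anti i j (Ne.symm hj), neg_mul, neg_mul, mul_neg]
        _ = _ := by simp only [mul_assoc]
    have hsq : ∀ x, g i * (g i * x * g i) * g i = x := by
      intro x
      rw [← mul_assoc, ← mul_assoc, hg.sq, one_mul, mul_assoc, hg.sq, mul_one]
    -- Up to the factor `1/2`, `a` splits into a part fixed by conjugation with `g i` and a part
    -- negated by it. The induction hypothesis applies to the first part directly and to the second
    -- after multiplication by the word `l`.
    have h1 : a + g i * a * g i ∈ N := by
      refine ih _ (add_mem ha hga) fun j hj => ?_
      rw [mul_add, add_mul]
      by_cases hji : j = i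
      · subst hji; rw [hsq, add_comm]
      · rw [hswap j hji, h j (by simp [hj, hji])]
    have h3 : (l.map g).prod * (a - g i * a * g i) ∈ N := by
      refine ih _ (hword D hD l _ (sub_mem ha hga)) fun j hj => ?_
      by_cases hji : j = i
      · subst hji; rw [hci, mul_sub, sub_mul, hsq, ← mul_neg, neg_sub]
      · rw [hcj j hji, mul_sub, sub_mul, hswap j hji, h j (by simp [hj, hji])]
    -- The reversed word is a left inverse of the word, so left stability of `N` recovers the second
    -- part.
    have h4 := hword N hN l.reverse _ h3
    rw [← mul_assoc, hrev, one_mul] at h4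
    have h5 := Submodule.smul_mem _ (2 : k)⁻¹ (add_mem h1 h4)
    rwa [add_add_sub_cancel, ← two_smul k a, smul_smul, inv_mul_cancel₀ h2, one_smul] at h5

end IsCliffordFamily

/-! ### The Clifford algebra of `ℝ²ⁿ` and its irreducible representation -/

section Algebra

variable {n : ℕ}

/-- The standard generators of `Cl(ℝ²ⁿ)`. -/
def clGen (n : ℕ) (i : Fin (2 * n)) : ModelCl n :=
  CliffordAlgebra.ι _ (EuclideanSpace.single i (1 : ℝ))

theorem ι_mul_ι_add_swap' {W : Type*} [NormedAddCommGroup W] [InnerProductSpace ℝ W] (v w : W) :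
    CliffordAlgebra.ι (euclForm W) v * CliffordAlgebra.ι _ w +
      CliffordAlgebra.ι _ w * CliffordAlgebra.ι _ v = algebraMap ℝ _ (2 * inner ℝ v w) := by
  rw [CliffordAlgebra.ι_mul_ι_add_swap]
  congr 1
  simp only [euclForm, QuadraticMap.polar, LinearMap.BilinMap.toQuadraticMap_apply,
    innerₗ_apply_apply, inner_add_add_self, real_inner_comm]
  rw [real_inner_comm]
  ring

theorem ι_mul_self {W : Type*} [NormedAddCommGroup W] [InnerProductSpace ℝ W] (v : W) :
    CliffordAlgebra.ι (euclForm W) v * CliffordAlgebra.ι _ v =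
      algebraMap ℝ _ (inner ℝ v v) :=
  CliffordAlgebra.ι_sq_scalar _ v

theorem isCliffordFamily_ι {W : Type*} [NormedAddCommGroup W] [InnerProductSpace ℝ W] {m : ℕ}
    (b : Fin m → W) (hb : Orthonormal ℝ b) :
    IsCliffordFamily fun i => CliffordAlgebra.ι (euclForm W) (b i) where
  sq i := by
    rw [ι_mul_self, real_inner_self_eq_norm_sq, hb.1 i]; simp
  anti i j h := by
    rw [eq_neg_iff_add_eq_zero, ι_mul_ι_add_swap', hb.2 h]; simp

theorem orthonormal_single (n : ℕ) :
    Orthonormal ℝ fun i : Fin (2 * n) => (EuclideanSpace.single i (1 : ℝ) : Model n) :=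
  EuclideanSpace.orthonormal_single

theorem isCliffordFamily_clGen (n : ℕ) : IsCliffordFamily (clGen n) :=
  isCliffordFamily_ι _ (orthonormal_single n)

theorem sum_single (v : Model n) : v = ∑ i, v i • EuclideanSpace.single i (1 : ℝ) := by
  conv_lhs => rw [← (EuclideanSpace.basisFun (Fin (2 * n)) ℝ).sum_repr v]
  simp

theorem adjoin_clGen (n : ℕ) : Algebra.adjoin ℝ (Set.range (clGen n)) = ⊤ := by
  rw [eq_top_iff, ← CliffordAlgebra.adjoin_range_ι, Algebra.adjoin_le_iff]
  rintro _ ⟨v, rfl⟩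
  rw [sum_single v, map_sum]
  refine Subalgebra.sum_mem _ fun i _ => ?_
  rw [map_smul]
  exact Subalgebra.smul_mem _ (Algebra.subset_adjoin (Set.mem_range_self i)) _

instance (n : ℕ) : Module.Finite ℝ (ModelCl n) :=
  (isCliffordFamily_clGen n).finite_of_adjoin (adjoin_clGen n)

instance (n : ℕ) : IsModuleTopology ℝ (ModelCl n) := ⟨rfl⟩

instance (n : ℕ) : IsTopologicalRing (ModelCl n) := IsModuleTopology.isTopologicalRing ℝ _

instance (n : ℕ) : ContinuousSMul ℝ (ModelCl n) := IsModuleTopology.toContinuousSMul ℝ _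

/-- The complexified Clifford algebra. -/
abbrev ComplexCl (n : ℕ) := ℂ ⊗[ℝ] ModelCl n

/-- The generators of the complexified Clifford algebra. -/
def complexClGen (n : ℕ) (i : Fin (2 * n)) : ComplexCl n := 1 ⊗ₜ clGen n i

theorem isCliffordFamily_complexClGen (n : ℕ) : IsCliffordFamily (complexClGen n) :=
  (isCliffordFamily_clGen n).map
    (Algebra.TensorProduct.includeRight : ModelCl n →ₐ[ℝ] ComplexCl n)

theorem adjoin_complexClGen (n : ℕ) : Algebra.adjoin ℂ (Set.range (complexClGen n)) = ⊤ := by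
  have h : ∀ c : ModelCl n, (1 : ℂ) ⊗ₜ[ℝ] c ∈ Algebra.adjoin ℂ (Set.range (complexClGen n)) := by
    intro c
    have hc : c ∈ Algebra.adjoin ℝ (Set.range (clGen n)) := by rw [adjoin_clGen]; trivial
    induction hc using Algebra.adjoin_induction with
    | mem x hx => obtain ⟨i, rfl⟩ := hx; exact Algebra.subset_adjoin ⟨i, rfl⟩
    | algebraMap r =>
      have : (1 : ℂ) ⊗ₜ[ℝ] algebraMap ℝ (ModelCl n) r = algebraMap ℂ _ (r : ℂ) := by
        rw [Algebra.algebraMap_eq_smul_one, TensorProduct.tmul_smul, TensorProduct.smul_tmul',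
          Algebra.TensorProduct.algebraMap_apply]
        simp
      rw [this]; exact Subalgebra.algebraMap_mem _ _
    | add x y _ _ hx hy => rw [TensorProduct.tmul_add]; exact add_mem hx hy
    | mul x y _ _ hx hy =>
      have := mul_mem hx hy
      rwa [Algebra.TensorProduct.tmul_mul_tmul, one_mul] at this
  rw [eq_top_iff]
  rintro t -
  induction t using TensorProduct.induction_on with
  | zero => exact zero_mem _
  | add x y hx hy => exact add_mem hx hy
  | tmul z c =>
    have := Subalgebra.smul_mem _ (h c) z
    rwa [TensorProduct.smul_tmul', smul_eq_mul, mul_one] at this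

/-- The complex linear extension of a complex representation of `Cl(ℝ²ⁿ)`. -/
def complexRep {E : Type*} [AddCommGroup E] [Module ℂ E]
    (r : ModelCl n →ₐ[ℝ] Module.End ℂ E) : ComplexCl n →ₐ[ℂ] Module.End ℂ E :=
  Algebra.TensorProduct.lift (Algebra.ofId ℂ _) r fun z c => by
    exact Algebra.commutes z (r c)

theorem complexRep_tmul {E : Type*} [AddCommGroup E] [Module ℂ E]
    (r : ModelCl n →ₐ[ℝ] Module.End ℂ E) (z : ℂ) (c : ModelCl n) :
    complexRep r (z ⊗ₜ c) = z • r c :=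
  (Algebra.TensorProduct.lift_tmul ..).trans (Algebra.smul_def z (r c)).symm

namespace SpinorRep

variable (S : SpinorRep.{w} n)

instance : Nontrivial S.S := S.nontrivial

/-- By irreducibility `S` is the orbit of any nonzero vector under the complexified Clifford
algebra, which is finite-dimensional. -/
instance : FiniteDimensional ℂ S.S := by
  obtain ⟨s, hs⟩ := exists_ne (0 : S.S)
  let f : ComplexCl n →ₗ[ℂ] S.S := (LinearMap.applyₗ s) ∘ₗ (complexRep S.ρ).toLinearMap
  have hf : ∀ a, f a = complexRep S.ρ a s := fun a => rfl
  have h1 : ∀ c, f (1 ⊗ₜ c) = S.ρ c s := fun c => by rw [hf, complexRep_tmul, one_smul]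
  rcases S.irreducible (LinearMap.range f) (by
    rintro c _ ⟨a, rfl⟩
    refine ⟨(1 ⊗ₜ c) * a, ?_⟩
    rw [hf, map_mul, complexRep_tmul, one_smul]; rfl) with h | h
  · exfalso
    have : s ∈ LinearMap.range f := ⟨1 ⊗ₜ 1, by rw [h1, map_one]; rfl⟩
    rw [h] at this
    exact hs (by simpa using this)
  · exact Module.Finite.of_surjective f (LinearMap.range_eq_top.1 h)

/-- Schur's lemma. -/
theorem exists_eq_smul_of_commute (T : Module.End ℂ S.S) (hT : ∀ c, S.ρ c * T = T * S.ρ c) :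
    ∃ z : ℂ, T = algebraMap ℂ _ z := by
  obtain ⟨z, hz⟩ := Module.End.exists_eigenvalue T
  refine ⟨z, ?_⟩
  rcases S.irreducible (T.eigenspace z) (by
    intro c s hs
    rw [Module.End.mem_eigenspace_iff] at hs ⊢
    have := LinearMap.congr_fun (hT c) s
    simp only [Module.End.mul_apply] at this
    rw [← this, hs, map_smul]) with h | h
  · exact absurd h hz
  · ext s
    have : s ∈ T.eigenspace z := by rw [h]; trivial
    rw [Module.End.mem_eigenspace_iff] at this
    rw [this, Module.algebraMap_end_apply]

theorem commute_of_gen (T : Module.End ℂ S.S)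
    (hT : ∀ i, S.ρ (clGen n i) * T = T * S.ρ (clGen n i)) (c : ModelCl n) :
    S.ρ c * T = T * S.ρ c := by
  have hc : c ∈ Algebra.adjoin ℝ (Set.range (clGen n)) := by rw [adjoin_clGen]; trivial
  induction hc using Algebra.adjoin_induction with
  | mem x hx => obtain ⟨i, rfl⟩ := hx; exact hT i
  | algebraMap r => rw [AlgHom.commutes]; exact Algebra.commutes r T
  | add x y _ _ hx hy => rw [map_add, add_mul, mul_add, hx, hy]
  | mul x y _ _ hx hy => rw [map_mul, mul_assoc, hy, ← mul_assoc, hx, mul_assoc]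

/-- By Schur's lemma the endomorphisms commuting with the generators are scalars, which lie in the
range. `le_of_central_le` with `D = ⊤` then puts all of `End S` into the range. -/
theorem complexRep_surjective : Function.Surjective (complexRep S.ρ) := by
  refine (LinearMap.range_eq_top (f := (complexRep S.ρ).toLinearMap)).1 (eq_top_iff.2 ?_)
  refine ((isCliffordFamily_clGen n).map S.ρ).le_of_central_le (k := ℂ) two_ne_zero
    (even_two_mul n) _ _ (fun _ _ _ => trivial) (fun _ _ _ => trivial) ?_ ?_
  · rintro i _ ⟨a, rfl⟩
    refine ⟨(1 ⊗ₜ clGen n i) * a, ?_⟩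
    simp [complexRep_tmul]
  · intro T _ hT
    obtain ⟨z, hz⟩ := S.exists_eq_smul_of_commute T (S.commute_of_gen T hT)
    exact ⟨algebraMap ℂ _ z, by rw [hz]; exact (complexRep S.ρ).commutes z⟩

/-- The kernel is two-sided, so by `le_of_central_le` it suffices to treat its central elements.
These are scalars, and a scalar acting as zero on `S ≠ 0` vanishes. -/
theorem complexRep_injective : Function.Injective (complexRep S.ρ) := by
  refine (LinearMap.ker_eq_bot (f := (complexRep S.ρ).toLinearMap)).1 (eq_bot_iff.2 ?_)
  refine (isCliffordFamily_complexClGen n).le_of_central_le (k := ℂ) two_ne_zero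
    (even_two_mul n) _ _ ?_ ?_ (by simp) ?_
  · intro i a ha
    simp only [LinearMap.mem_ker, AlgHom.toLinearMap_apply] at ha ⊢
    rw [map_mul, ha, mul_zero]
  · intro i a ha
    simp only [LinearMap.mem_ker, AlgHom.toLinearMap_apply] at ha ⊢
    rw [map_mul, ha, zero_mul]
  · intro a ha hc
    obtain ⟨z, rfl⟩ := (isCliffordFamily_complexClGen n).exists_algebraMap_of_central (k := ℂ)
      two_ne_zero (even_two_mul n) (adjoin_complexClGen n) a hc
    simp only [LinearMap.mem_ker, AlgHom.toLinearMap_apply, AlgHom.commutes] at ha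
    have : z = 0 := by
      by_contra h
      obtain ⟨s, hs⟩ := exists_ne (0 : S.S)
      have := LinearMap.congr_fun ha s
      rw [Module.algebraMap_end_apply] at this
      exact (smul_ne_zero h hs) this
    rw [this, map_zero]; exact zero_mem _

/-- The isomorphism of the complexified Clifford algebra with the endomorphisms of `S`. -/
def endEquiv : ComplexCl n ≃ₐ[ℂ] Module.End ℂ S.S :=
  AlgEquiv.ofBijective (complexRep S.ρ) ⟨S.complexRep_injective, S.complexRep_surjective⟩

/-- The action of `End S` on a complex representation of `Cl(ℝ²ⁿ)`. -/
def lift {E : Type*} [AddCommGroup E] [Module ℂ E]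
    (r : ModelCl n →ₐ[ℝ] Module.End ℂ E) : Module.End ℂ S.S →ₐ[ℂ] Module.End ℂ E :=
  (complexRep r).comp S.endEquiv.symm.toAlgHom

theorem endEquiv_symm_ρ (c : ModelCl n) : S.endEquiv.symm (S.ρ c) = 1 ⊗ₜ c := by
  rw [AlgEquiv.symm_apply_eq]
  exact ((complexRep_tmul S.ρ 1 c).trans (one_smul ℂ (S.ρ c))).symm

theorem lift_ρ {E : Type*} [AddCommGroup E] [Module ℂ E]
    (r : ModelCl n →ₐ[ℝ] Module.End ℂ E) (c : ModelCl n) : S.lift r (S.ρ c) = r c := by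
  change complexRep r (S.endEquiv.symm (S.ρ c)) = r c
  rw [endEquiv_symm_ρ, complexRep_tmul, one_smul]

theorem span_range_ρ : Submodule.span ℂ (Set.range S.ρ) = ⊤ := by
  rw [eq_top_iff]
  rintro T -
  obtain ⟨t, rfl⟩ := S.complexRep_surjective T
  induction t using TensorProduct.induction_on with
  | zero => rw [map_zero]; exact zero_mem _
  | add x y hx hy => rw [map_add]; exact add_mem hx hy
  | tmul z c => rw [complexRep_tmul]; exact Submodule.smul_mem _ _ (Submodule.subset_span ⟨c, rfl⟩)

-- Since `ρ` has spanning image, complex linear identities in `T ∈ End S` need checking only for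
-- Clifford elements. This is how Clifford linearity becomes `End S`-linearity.
@[elab_as_elim]
theorem end_induction {P : Module.End ℂ S.S → Prop} (hρ : ∀ c, P (S.ρ c)) (h0 : P 0)
    (hadd : ∀ T T', P T → P T' → P (T + T')) (hsmul : ∀ (z : ℂ) T, P T → P (z • T))
    (T : Module.End ℂ S.S) : P T := by
  have hT : T ∈ Submodule.span ℂ (Set.range S.ρ) := by rw [span_range_ρ]; trivial
  induction hT using Submodule.span_induction with
  | mem x hx => obtain ⟨c, rfl⟩ := hx; exact hρ c
  | zero => exact h0
  | add x y _ _ hx hy => exact hadd x y hx hy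
  | smul z x _ hx => exact hsmul z x hx

/-- The rank one endomorphism `s ⊗ σ` of `S`. -/
def rankOne (s : S.S) (σ : Module.Dual ℂ S.S) : Module.End ℂ S.S :=
  LinearMap.toSpanSingleton ℂ _ s ∘ₗ σ

theorem rankOne_apply (s : S.S) (σ : Module.Dual ℂ S.S) (t : S.S) :
    S.rankOne s σ t = σ t • s := rfl

theorem rankOne_mul (s t : S.S) (σ τ : Module.Dual ℂ S.S) :
    S.rankOne s σ * S.rankOne t τ = σ t • S.rankOne s τ := by
  ext x
  simp [rankOne_apply, smul_smul, mul_comm]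

theorem mul_rankOne (T : Module.End ℂ S.S) (s : S.S) (σ : Module.Dual ℂ S.S) :
    T * S.rankOne s σ = S.rankOne (T s) σ := by
  ext x; simp [rankOne_apply]

theorem rankOne_mul_end (T : Module.End ℂ S.S) (s : S.S) (σ : Module.Dual ℂ S.S) :
    S.rankOne s σ * T = S.rankOne s (σ ∘ₗ T) := by
  ext x; simp [rankOne_apply]

/-- A basis of `S`. -/
def basis : Module.Basis (Fin (Module.finrank ℂ S.S)) ℂ S.S := Module.finBasis ℂ S.S

theorem sum_rankOne_basis : ∑ i, S.rankOne (S.basis i) (S.basis.coord i) = 1 := by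
  ext x
  simp [rankOne_apply, LinearMap.sum_apply]

theorem exists_pairing : ∃ p : S.S × Module.Dual ℂ S.S, p.2 p.1 = 1 := by
  obtain ⟨s, hs⟩ := exists_ne (0 : S.S)
  obtain ⟨σ, hσ⟩ := Module.Projective.exists_dual_eq_one ℂ hs
  exact ⟨(s, σ), hσ⟩

end SpinorRep

/-- The centre of `Cl(ℝ²ⁿ)` consists of the scalars. -/
theorem ModelCl.exists_algebraMap_of_central (a : ModelCl n)
    (ha : ∀ v, CliffordAlgebra.ι _ v * a = a * CliffordAlgebra.ι _ v) :
    ∃ c : ℝ, a = algebraMap ℝ _ c :=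
  (isCliffordFamily_clGen n).exists_algebraMap_of_central (k := ℝ) two_ne_zero
    (even_two_mul n) (adjoin_clGen n) a fun _ => ha _

end Algebra

/-! ### Functoriality of Clifford algebras -/

section CliffordMap

variable {W W' W'' : Type*} [NormedAddCommGroup W] [InnerProductSpace ℝ W]
  [NormedAddCommGroup W'] [InnerProductSpace ℝ W'] [NormedAddCommGroup W'']
  [InnerProductSpace ℝ W'']

theorem cliffordMap_ι (A : W ≃ₗᵢ[ℝ] W') (v : W) :
    cliffordMap A (CliffordAlgebra.ι _ v) = CliffordAlgebra.ι _ (A v) :=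
  CliffordAlgebra.map_apply_ι _ _

theorem cliffordMap_cliffordMap (A : W ≃ₗᵢ[ℝ] W') (B : W' ≃ₗᵢ[ℝ] W'')
    (c : CliffordAlgebra (euclForm W)) :
    cliffordMap B (cliffordMap A c) = cliffordMap (A.trans B) c := by
  have : (cliffordMap B).comp (cliffordMap A) = cliffordMap (A.trans B) :=
    CliffordAlgebra.hom_ext (LinearMap.ext fun v => by simp [cliffordMap_ι])
  exact DFunLike.congr_fun this c

theorem cliffordMap_refl (c : CliffordAlgebra (euclForm W)) :
    cliffordMap (LinearIsometryEquiv.refl ℝ W) c = c := by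
  have : cliffordMap (LinearIsometryEquiv.refl ℝ W) = AlgHom.id ℝ _ :=
    CliffordAlgebra.hom_ext (LinearMap.ext fun v => by simp [cliffordMap_ι])
  exact DFunLike.congr_fun this c

theorem cliffordMap_symm_apply (A : W ≃ₗᵢ[ℝ] W') (c : CliffordAlgebra (euclForm W)) :
    cliffordMap A.symm (cliffordMap A c) = c := by
  rw [cliffordMap_cliffordMap, LinearIsometryEquiv.self_trans_symm, cliffordMap_refl]

theorem cliffordMap_apply_symm (A : W ≃ₗᵢ[ℝ] W') (c : CliffordAlgebra (euclForm W')) :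
    cliffordMap A (cliffordMap A.symm c) = c := by
  rw [cliffordMap_cliffordMap, LinearIsometryEquiv.symm_trans_self, cliffordMap_refl]

end CliffordMap

/-! ### The covering of `SO(2n)` by `Spin(2n)` -/

section Spin

variable {n : ℕ}

theorem Spin.coe_inv (a : Spin n) : ((a⁻¹ : Spin n) : ModelCl n) = star (a : ModelCl n) := by
  rw [← spinGroup.star_eq_inv]; rfl

/-- `a ∈ Spin(2n)` lies over the isometry `A`. -/
def SpinLifts (a : Spin n) (A : Model n ≃ₗᵢ[ℝ] Model n) : Prop :=
  ∀ v, (a : ModelCl n) * CliffordAlgebra.ι _ v * ((a⁻¹ : Spin n) : ModelCl n) =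
      CliffordAlgebra.ι _ (A v)

theorem Spin.inv_mul_coe (a : Spin n) : ((a⁻¹ : Spin n) : ModelCl n) * (a : ModelCl n) = 1 := by
  rw [← Submonoid.coe_mul, inv_mul_cancel]; rfl

theorem Spin.mul_inv_coe (a : Spin n) : (a : ModelCl n) * ((a⁻¹ : Spin n) : ModelCl n) = 1 := by
  rw [← Submonoid.coe_mul, mul_inv_cancel]; rfl

/-- Conjugation by `a` is multiplicative and agrees with `Cl(A)` on vectors, which generate the
algebra. -/
theorem SpinLifts.conj {a : Spin n} {A : Model n ≃ₗᵢ[ℝ] Model n} (h : SpinLifts a A)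
    (c : ModelCl n) :
    (a : ModelCl n) * c * ((a⁻¹ : Spin n) : ModelCl n) = cliffordMap A c := by
  have hc : c ∈ Algebra.adjoin ℝ (Set.range (CliffordAlgebra.ι (euclForm (Model n)))) := by
    rw [CliffordAlgebra.adjoin_range_ι]; trivial
  induction hc using Algebra.adjoin_induction with
  | mem x hx => obtain ⟨v, rfl⟩ := hx; rw [h v, cliffordMap_ι]
  | algebraMap r =>
    rw [AlgHom.commutes, ← Algebra.commutes, mul_assoc, Spin.mul_inv_coe, mul_one]
  | add x y _ _ hx hy => rw [map_add, mul_add, add_mul, hx, hy]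
  | mul x y _ _ hx hy =>
    rw [map_mul, ← hx, ← hy]
    simp only [mul_assoc]
    rw [← mul_assoc ((a⁻¹ : Spin n) : ModelCl n) (a : ModelCl n), Spin.inv_mul_coe, one_mul]

theorem SpinLifts.mul_ι {a : Spin n} {A : Model n ≃ₗᵢ[ℝ] Model n} (h : SpinLifts a A)
    (v : Model n) :
    (a : ModelCl n) * CliffordAlgebra.ι _ v = CliffordAlgebra.ι _ (A v) * (a : ModelCl n) := by
  rw [← h v, mul_assoc, Spin.inv_mul_coe, mul_one]

theorem SpinLifts.inv_mul_ι {a : Spin n} {A : Model n ≃ₗᵢ[ℝ] Model n} (h : SpinLifts a A)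
    (v : Model n) : ((a⁻¹ : Spin n) : ModelCl n) * CliffordAlgebra.ι _ (A v) =
      CliffordAlgebra.ι _ v * ((a⁻¹ : Spin n) : ModelCl n) := by
  rw [← h v, ← mul_assoc, ← mul_assoc, Spin.inv_mul_coe, one_mul]

theorem SpinLifts.mul {a b : Spin n} {A B : Model n ≃ₗᵢ[ℝ] Model n} (ha : SpinLifts a A)
    (hb : SpinLifts b B) : SpinLifts (a * b) (B.trans A) := fun v => by
  rw [mul_inv_rev, LinearIsometryEquiv.trans_apply, ← ha, ← hb]
  simp only [Submonoid.coe_mul, mul_assoc]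

theorem SpinLifts.one : SpinLifts (1 : Spin n) (LinearIsometryEquiv.refl ℝ _) := fun v => by simp

/-- Intertwiners of two isometries differ by a scalar. -/
theorem SpinLifts.exists_smul {b : Spin n} {A : Model n ≃ₗᵢ[ℝ] Model n} (hb : SpinLifts b A)
    (x : ModelCl n) (hx : ∀ v, x * CliffordAlgebra.ι _ v = CliffordAlgebra.ι _ (A v) * x) :
    ∃ r : ℝ, x = r • (b : ModelCl n) := by
  -- Both `b` and `x` intertwine through `A`, so `b⁻¹ x` commutes with all vectors.
  obtain ⟨r, hr⟩ := ModelCl.exists_algebraMap_of_central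
    (((b⁻¹ : Spin n) : ModelCl n) * x) fun v => by
      rw [← mul_assoc, ← hb.inv_mul_ι, mul_assoc, ← hx, mul_assoc]
  refine ⟨r, ?_⟩
  rw [Algebra.smul_def, Algebra.commutes, ← hr, ← mul_assoc, Spin.mul_inv_coe, one_mul]

theorem smul_one_inj {r : ℝ} (h : algebraMap ℝ (ModelCl n) r = 1) : r = 1 :=
  (algebraMap ℝ (ModelCl n)).injective (by rw [h, map_one])

/-- Two lifts of an isometry to `Spin(2n)` agree up to sign. -/
theorem SpinLifts.eq_or_eq_neg {a b : Spin n} {A : Model n ≃ₗᵢ[ℝ] Model n} (ha : SpinLifts a A)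
    (hb : SpinLifts b A) : a = b ∨ (a : ModelCl n) = -(b : ModelCl n) := by
  obtain ⟨r, hr⟩ := hb.exists_smul a ha.mul_ι
  -- Inverses in the spin group are given by `star`, so `a = r b` gives `1 = a⁻¹ a = r² b⁻¹ b = r²`.
  have h1 : algebraMap ℝ (ModelCl n) (r * r) = 1 := by
    have := Spin.inv_mul_coe a
    rw [Spin.coe_inv, hr, CliffordAlgebra.star_smul, smul_mul_smul_comm, ← Spin.coe_inv,
      Spin.inv_mul_coe] at this
    rw [Algebra.algebraMap_eq_smul_one, this]
  rcases mul_self_eq_one_iff.1 (smul_one_inj h1) with rfl | rfl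
  · left; exact Subtype.ext (by rw [hr, one_smul])
  · right; rw [hr, neg_smul, one_smul]

theorem SpinC.mk_eq_of_neg {a b : Spin n} (h : (a : ModelCl n) = -(b : ModelCl n)) (z : Circle) :
    SpinC.mk a z = SpinC.mk b (-1 * z) := by
  refine QuotientGroup.eq.2 (Or.inr ⟨?_, ?_⟩)
  · change ((a⁻¹ : Spin n) : ModelCl n) * (b : ModelCl n) = -1
    rw [← neg_eq_iff_eq_neg.2 h, mul_neg, Spin.inv_mul_coe]
  · simp

/-! ### Reflections and the surjectivity of the spin covering. -/

/-- The reflection in the hyperplane orthogonal to `u`. -/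
def hyperplaneReflection (u : Model n) : Model n ≃ₗᵢ[ℝ] Model n := (ℝ ∙ u)ᗮ.reflection

theorem hyperplaneReflection_apply (u v : Model n) :
    hyperplaneReflection u v = v - (2 * (inner ℝ u v / ‖u‖ ^ 2)) • u := by
  rw [hyperplaneReflection, Submodule.reflection_orthogonal_apply,
    Submodule.reflection_singleton_apply, ← Nat.cast_smul_eq_nsmul ℝ, smul_smul]
  simp

/-- A hyperplane reflection depends only on the line of its vector, and the one attached to `0` is
the identity and can be dropped. Unit vectors are needed because they are the ones that square to
`1` in the Clifford algebra. -/
theorem exists_unit_list (l : List (Model n)) : ∃ l' : List (Model n), (∀ v ∈ l', ‖v‖ = 1) ∧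
    (l.map hyperplaneReflection).prod = (l'.map hyperplaneReflection).prod := by
  induction l with
  | nil => exact ⟨[], by simp, rfl⟩
  | cons v l ih =>
    obtain ⟨l', hl', e⟩ := ih
    by_cases hv : v = 0
    · refine ⟨l', hl', ?_⟩
      rw [List.map_cons, List.prod_cons, e]
      convert one_mul _
      refine LinearIsometryEquiv.ext fun w => ?_
      rw [hyperplaneReflection_apply, hv, smul_zero, sub_zero]; rfl
    · refine ⟨(‖v‖⁻¹ • v) :: l', ?_, ?_⟩
      · intro w hw
        rcases List.mem_cons.1 hw with rfl | hw
        · exact norm_smul_inv_norm hv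
        · exact hl' w hw
      · rw [List.map_cons, List.prod_cons, e, List.map_cons, List.prod_cons]
        congr 1
        refine LinearIsometryEquiv.ext fun w => ?_
        have h1 : ‖(‖v‖⁻¹ • v)‖ = 1 := norm_smul_inv_norm hv
        rw [hyperplaneReflection_apply, hyperplaneReflection_apply, h1, smul_smul,
          real_inner_smul_left]
        congr 2
        field_simp

theorem ι_mul_ι_reflection {u : Model n} (hu : ‖u‖ = 1) (v : Model n) :
    CliffordAlgebra.ι (euclForm _) u * CliffordAlgebra.ι _ v =
      -(CliffordAlgebra.ι _ (hyperplaneReflection u v) * CliffordAlgebra.ι _ u) := by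
  rw [hyperplaneReflection_apply, hu, map_sub, map_smul, sub_mul, neg_sub, eq_sub_iff_add_eq,
    ι_mul_ι_add_swap', smul_mul_assoc, ι_mul_self, real_inner_self_eq_norm_sq, hu,
    Algebra.algebraMap_eq_smul_one, Algebra.algebraMap_eq_smul_one]
  simp

theorem ι_unit {u : Model n} (hu : ‖u‖ = 1) :
    CliffordAlgebra.ι (euclForm _) u * CliffordAlgebra.ι _ u = 1 := by
  rw [ι_mul_self, real_inner_self_eq_norm_sq, hu]; simp

/-- The product of unit vectors lifts the product of the reflections, up to sign. -/
theorem exists_unit_word (l : List (Model n)) (hl : ∀ v ∈ l, ‖v‖ = 1) :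
    ∃ x : (ModelCl n)ˣ, x ∈ lipschitzGroup (euclForm (Model n)) ∧
      (x : ModelCl n) ∈ CliffordAlgebra.evenOdd (euclForm (Model n)) (l.length : ZMod 2) ∧
      star (x : ModelCl n) * x = (-1) ^ l.length ∧
      (x : ModelCl n) * star (x : ModelCl n) = (-1) ^ l.length ∧
      LinearEquiv.det ((l.map hyperplaneReflection).prod).toLinearEquiv =
        (-1) ^ l.length ∧
      ∀ v, (x : ModelCl n) * CliffordAlgebra.ι (euclForm (Model n)) v = (-1) ^ l.length *
        (CliffordAlgebra.ι (euclForm (Model n)) ((l.map hyperplaneReflection).prod v) *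
          (x : ModelCl n)) := by
  induction l with
  | nil =>
    refine ⟨1, one_mem _, ?_, by simp, by simp, ?_, by simp⟩
    · simpa using SetLike.one_mem_graded (CliffordAlgebra.evenOdd (euclForm (Model n)))
    · simp only [List.map_nil, List.prod_nil, List.length_nil, pow_zero]
      exact map_one (LinearEquiv.det (R := ℝ) (M := Model n))
  | cons u l ih =>
    obtain ⟨x, hx, he, hs, hs', hd, hc⟩ := ih fun v hv => hl v (List.mem_cons_of_mem _ hv)
    have hu : ‖u‖ = 1 := hl u List.mem_cons_self
    let y : (ModelCl n)ˣ := ⟨CliffordAlgebra.ι _ u, CliffordAlgebra.ι _ u, ι_unit hu, ι_unit hu⟩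
    have hcomm : ∀ (k : ℕ) (z : ModelCl n), z * (-1) ^ k = (-1) ^ k * z := fun k z =>
      ((Commute.neg_one_right z).pow_right k).eq
    refine ⟨y * x, mul_mem (Subgroup.subset_closure ⟨u, rfl⟩) hx, ?_, ?_, ?_, ?_, ?_⟩
    · rw [List.length_cons, Nat.cast_succ, add_comm]
      exact SetLike.mul_mem_graded (CliffordAlgebra.ι_mem_evenOdd_one _ u) he
    -- `star` sends a vector to its negative, so each unit vector in the word contributes a factor
    -- `-1`.
    · change star (CliffordAlgebra.ι (euclForm (Model n)) u * (x : ModelCl n)) *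
        (CliffordAlgebra.ι _ u * (x : ModelCl n)) = _
      rw [star_mul, CliffordAlgebra.star_ι, mul_assoc, ← mul_assoc (-_), neg_mul, ι_unit hu,
        neg_one_mul, mul_neg, hs, List.length_cons, pow_succ, mul_neg_one]
    · change CliffordAlgebra.ι (euclForm (Model n)) u * (x : ModelCl n) *
        star (CliffordAlgebra.ι (euclForm (Model n)) u * (x : ModelCl n)) = _
      rw [star_mul, CliffordAlgebra.star_ι, mul_assoc, ← mul_assoc (x : ModelCl n), hs', ← hcomm,
        ← mul_assoc, mul_neg, ι_unit hu, List.length_cons, pow_succ, mul_neg_one, neg_mul, one_mul]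
    · have h1 : LinearEquiv.det (hyperplaneReflection u).toLinearEquiv = -1 := by
        refine (Submodule.linearEquiv_det_reflection _).trans ?_
        rw [Submodule.orthogonal_orthogonal,
          finrank_span_singleton (by rintro rfl; simp at hu), pow_one]
      rw [List.map_cons, List.prod_cons, List.length_cons, pow_succ, ← hd]
      refine (map_mul (LinearEquiv.det (R := ℝ) (M := Model n)) _ _).trans ?_
      rw [h1, mul_comm]
    · intro v
      change CliffordAlgebra.ι (euclForm (Model n)) u * (x : ModelCl n) * _ =
        _ * (CliffordAlgebra.ι (euclForm (Model n)) _ *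
          (CliffordAlgebra.ι (euclForm (Model n)) u * (x : ModelCl n)))
      rw [mul_assoc, hc, ← mul_assoc, hcomm, mul_assoc, ← mul_assoc (CliffordAlgebra.ι _ u),
        ι_mul_ι_reflection hu, List.length_cons, pow_succ, List.map_cons, List.prod_cons]
      simp [mul_assoc]

/-- `Spin(2n)` maps onto `SO(2n)`. -/
theorem Spin.exists_lifts (A : Model n ≃ₗᵢ[ℝ] Model n) (hA : 0 < LinearMap.det
    (A.toLinearEquiv : Model n →ₗ[ℝ] Model n)) : ∃ a : Spin n, SpinLifts a A := by
  obtain ⟨l, -, hl⟩ := A.reflections_generate_dim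
  obtain ⟨l', hl', e⟩ := exists_unit_list l
  obtain ⟨x, hx, he, hs, hs', hd, hc⟩ := exists_unit_word l' hl'
  have hl2 : (l.map hyperplaneReflection).prod = A := hl.symm
  rw [← e, hl2] at hd hc
  -- The determinant is `(-1)` to the number of reflections. Positivity makes this number even, so
  -- all signs disappear and the word is even and unitary.
  have heven : Even l'.length := by
    rcases Nat.even_or_odd l'.length with h | h
    · exact h
    · rw [h.neg_one_pow] at hd
      have := congrArg Units.val hd
      rw [LinearEquiv.coe_det] at this
      rw [this] at hA
      norm_num at hA
  rw [heven.neg_one_pow] at hs hs' hc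
  have hz : ((l'.length : ℕ) : ZMod 2) = 0 := (ZMod.natCast_eq_zero_iff_even).2 heven
  rw [hz] at he
  refine ⟨⟨x, ⟨⟨x, hx, rfl⟩, ?_⟩, he⟩, fun v => ?_⟩
  · exact Unitary.mem_iff.2 ⟨hs, hs'⟩
  · rw [Spin.coe_inv]
    change (x : ModelCl n) * _ * star (x : ModelCl n) = _
    rw [hc, mul_assoc, mul_assoc, hs', one_mul, mul_one]

/-- The product of the unit vectors `e` and `-e` is `-1`. A positive dimension is necessary: for `n
= 0` the Lipschitz group is trivial. -/
theorem neg_one_mem_spinGroup (h : 0 < n) : (-1 : ModelCl n) ∈ spinGroup (euclForm (Model n)) := by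
  let e : Model n := EuclideanSpace.single ⟨0, by omega⟩ 1
  have he : ‖e‖ = 1 := by simp [e]
  have h1 := ι_unit he
  have h2 : CliffordAlgebra.ι (euclForm _) e * CliffordAlgebra.ι _ (-e) = -1 := by
    rw [map_neg, mul_neg, h1]
  let y : (ModelCl n)ˣ := ⟨CliffordAlgebra.ι _ e, CliffordAlgebra.ι _ e, h1, h1⟩
  let y' : (ModelCl n)ˣ := ⟨CliffordAlgebra.ι _ (-e), CliffordAlgebra.ι _ (-e), by simp [h1],
    by simp [h1]⟩
  refine ⟨⟨⟨y * y', mul_mem (Subgroup.subset_closure ⟨e, rfl⟩)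
    (Subgroup.subset_closure ⟨-e, rfl⟩), h2⟩, ?_⟩, ?_⟩
  · exact Unitary.mem_iff.2 ⟨by simp, by simp⟩
  · exact (CliffordAlgebra.even (euclForm (Model n))).neg_mem (one_mem _)

/-! ### Continuous local lifts to the spin group. -/

/-- The intertwiner obtained from `x` by averaging over the generators in a list. -/
def intertwine (A : Model n ≃ₗᵢ[ℝ] Model n) (x : ModelCl n) : List (Fin (2 * n)) → ModelCl n
  | [] => x
  | i :: l => (2⁻¹ : ℝ) • (intertwine A x l + CliffordAlgebra.ι _
      (A (EuclideanSpace.single i 1)) * intertwine A x l * clGen n i)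

/-- The maps `x ↦ ι(A e_i) x e_i` are involutions. They commute with one another, because exchanging
two of them produces one sign on the left and one on the right. Each averaging step therefore
projects onto the fixed space of its own involution and stays inside those of the earlier ones. -/
theorem intertwine_fixed (A : Model n ≃ₗᵢ[ℝ] Model n) (x : ModelCl n) (l : List (Fin (2 * n))) :
    ∀ j ∈ l, CliffordAlgebra.ι _ (A (EuclideanSpace.single j 1)) * intertwine A x l * clGen n j =
      intertwine A x l := by
  have hA := isCliffordFamily_ι _ ((orthonormal_single n).comp_linearIsometryEquiv A)
  have hg := isCliffordFamily_clGen n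
  induction l with
  | nil => simp
  | cons i l ih =>
    intro j hj
    rw [intertwine, mul_smul_comm, smul_mul_assoc]
    congr 1
    rw [mul_add, add_mul]
    by_cases hji : j = i
    · subst hji
      rw [add_comm]
      congr 1
      rw [← mul_assoc, ← mul_assoc, mul_assoc _ (clGen n j), hg.sq, mul_one]
      exact (congrArg (· * intertwine A x l) (hA.sq j)).trans (one_mul _)
    · have hjl := ih j ((List.mem_cons.1 hj).resolve_left hji)
      rw [hjl]
      congr 1
      conv_rhs => rw [← hjl]
      have h1 := hA.anti j i hji
      have h2 := hg.anti i j (Ne.symm hji)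
      simp only [Function.comp_apply] at h1
      calc _ = (CliffordAlgebra.ι (euclForm (Model n)) (A (EuclideanSpace.single j 1)) *
            CliffordAlgebra.ι _ (A (EuclideanSpace.single i 1))) * intertwine A x l *
              (clGen n i * clGen n j) := by simp only [mul_assoc]
        _ = _ := by rw [h1, h2]; simp only [mul_assoc, neg_mul, mul_neg, neg_neg]

theorem intertwine_mul_ι (A : Model n ≃ₗᵢ[ℝ] Model n) (x : ModelCl n) (v : Model n) :
    intertwine A x (List.finRange _) * CliffordAlgebra.ι _ v =
      CliffordAlgebra.ι _ (A v) * intertwine A x (List.finRange _) := by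
  rw [sum_single v, map_sum, map_sum, map_sum, Finset.mul_sum, Finset.sum_mul]
  refine Finset.sum_congr rfl fun i _ => ?_
  rw [map_smul, map_smul, map_smul, mul_smul_comm, smul_mul_assoc]
  congr 1
  conv_lhs => rw [← intertwine_fixed A x _ i (List.mem_finRange i)]
  change _ * clGen n i * clGen n i = _
  rw [mul_assoc, (isCliffordFamily_clGen n).sq, mul_one]

/-- A genuine lift already intertwines, so averaging leaves it unchanged. At the base point the
averaged element is thus the given lift, in particular invertible. -/
theorem intertwine_self {a : Spin n} {A : Model n ≃ₗᵢ[ℝ] Model n} (h : SpinLifts a A)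
    (l : List (Fin (2 * n))) : intertwine A (a : ModelCl n) l = a := by
  induction l with
  | nil => rfl
  | cons i l ih =>
    rw [intertwine, ih, ← h.mul_ι]
    change _ • (_ + _ * clGen n i * clGen n i) = _
    rw [mul_assoc, (isCliffordFamily_clGen n).sq, mul_one, ← two_smul ℝ, smul_smul]
    norm_num

theorem continuous_ι : Continuous (CliffordAlgebra.ι (euclForm (Model n)) : Model n → ModelCl n) :=
  LinearMap.continuous_of_finiteDimensional _

theorem continuousAt_intertwine {Z : Type*} [TopologicalSpace Z] {z₀ : Z}
    {A : Z → (Model n ≃ₗᵢ[ℝ] Model n)} (hA : ∀ v, ContinuousAt (fun z => A z v) z₀)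
    (x : ModelCl n) (l : List (Fin (2 * n))) :
    ContinuousAt (fun z => intertwine (A z) x l) z₀ := by
  induction l with
  | nil => exact continuousAt_const
  | cons i l ih =>
    exact ((ih.add (((continuous_ι.continuousAt.comp (hA _)).mul ih).mul
      continuousAt_const))).const_smul (2⁻¹ : ℝ)

theorem continuous_star_modelCl : Continuous (star : ModelCl n → ModelCl n) := by
  let f : ModelCl n →ₗ[ℝ] ModelCl n :=
    { toFun := star, map_add' := star_add, map_smul' := fun r x => CliffordAlgebra.star_smul r x }
  exact IsModuleTopology.continuous_of_linearMap f

/-- A continuous family of elements of `SO(2n)` has a local lift to `Spin(2n)`. -/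
theorem Spin.exists_continuousAt_lift {Z : Type*} [TopologicalSpace Z] (z₀ : Z)
    (A : Z → (Model n ≃ₗᵢ[ℝ] Model n)) (hA : ∀ v, ContinuousAt (fun z => A z v) z₀)
    (hl : ∀ z, ∃ a : Spin n, SpinLifts a (A z)) :
    ∃ a : Z → Spin n, ContinuousAt a z₀ ∧ ∀ z, SpinLifts (a z) (A z) := by
  classical
  choose b hb using hl
  rcases Nat.eq_zero_or_pos n with rfl | hn
  -- In rank zero `-1` is not available for correcting signs, but every isometry is the identity and
  -- a constant lift works.
  · refine ⟨fun _ => b z₀, continuousAt_const, fun z v => ?_⟩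
    rw [hb z₀]
    congr 1
    ext i
    exact absurd i.2 (by simp)
  -- The lift at `z₀` is averaged against the moving isometry. The result is continuous at `z₀` and
  -- is a real multiple `r z` of any chosen lift `b z`.
  let x : Z → ModelCl n := fun z => intertwine (A z) (b z₀ : ModelCl n) (List.finRange _)
  have hx : ContinuousAt x z₀ := continuousAt_intertwine hA _ _
  have hx0 : x z₀ = b z₀ := intertwine_self (hb z₀) _
  have hr : ∀ z, ∃ r : ℝ, x z = r • (b z : ModelCl n) := fun z =>
    (hb z).exists_smul _ (intertwine_mul_ι _ _)
  choose r hr using hr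
  -- A functional with `ℓ 1 = 1` reads off the scalar in `star (x z) * x z = r² • 1`, which makes
  -- `r²` continuous at `z₀`.
  obtain ⟨ℓ, hℓ⟩ := Module.Projective.exists_dual_eq_one ℝ (one_ne_zero (α := ModelCl n))
  have hcℓ : Continuous ℓ := IsModuleTopology.continuous_of_linearMap ℓ
  let q : Z → ℝ := fun z => ℓ (star (x z) * x z)
  have hq : ContinuousAt q z₀ := hcℓ.continuousAt.comp
    ((continuous_star_modelCl.continuousAt.comp hx).mul hx)
  have hqr : ∀ z, q z = r z ^ 2 := fun z => by
    simp only [q]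
    rw [hr, CliffordAlgebra.star_smul, smul_mul_smul_comm, ← Spin.coe_inv, Spin.inv_mul_coe,
      map_smul, hℓ, smul_eq_mul, mul_one, sq]
  have hq0 : q z₀ = 1 := by
    simp only [q]
    rw [hx0, ← Spin.coe_inv, Spin.inv_mul_coe, hℓ]
  have hneg : ∀ z, -(b z : ModelCl n) ∈ spinGroup (euclForm (Model n)) := fun z => by
    rw [← neg_one_mul]; exact mul_mem (neg_one_mem_spinGroup hn) (b z).2
  -- The sign of `r z` corrects the arbitrary choice of `b z`. Where `r z ≠ 0`, in particular near
  -- `z₀`, this is the normalization `x z / √(q z)`; elsewhere the value is an arbitrary lift.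
  let a : Z → Spin n := fun z => if 0 ≤ r z then b z else ⟨-(b z : ModelCl n), hneg z⟩
  have ha : ∀ z, r z ≠ 0 → (a z : ModelCl n) = (Real.sqrt (q z))⁻¹ • x z := fun z hz => by
    rw [hqr, Real.sqrt_sq_eq_abs, hr, smul_smul]
    simp only [a]
    split_ifs with h
    · rw [abs_of_nonneg h, inv_mul_cancel₀ hz, one_smul]
    · rw [abs_of_neg (not_le.1 h), inv_neg, neg_mul, inv_mul_cancel₀ hz, neg_smul, one_smul]
  refine ⟨a, ?_, fun z v => ?_⟩
  · rw [Topology.IsInducing.subtypeVal.continuousAt_iff]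
    have h1 : ∀ᶠ z in nhds z₀, q z ≠ 0 := hq.eventually_ne (by rw [hq0]; exact one_ne_zero)
    have h2 : ContinuousAt (fun z => (Real.sqrt (q z))⁻¹ • x z) z₀ :=
      ((hq.sqrt).inv₀ (by simp [hq0])).smul hx
    refine h2.congr ?_
    filter_upwards [h1] with z hz
    exact (ha z fun h => hz (by rw [hqr, h]; simp)).symm
  · simp only [a]
    split_ifs with h
    · exact hb z v
    · rw [Spin.coe_inv]
      change -(b z : ModelCl n) * _ * star (-(b z : ModelCl n)) = _
      rw [star_neg, neg_mul, neg_mul_neg, ← Spin.coe_inv]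
      exact hb z v

end Spin

/-! ### Continuous families of linear maps -/

section LinearFamilies

variable {Z : Type*} [TopologicalSpace Z] {z₀ : Z}

/-- Expanding the argument in the finite standard basis, continuity on each fixed vector already
gives joint continuity. For this reason continuity of families is only ever stated on fixed vectors.
-/
theorem continuousAt_apply_of_pointwise {k : ℕ} {G : Type*} [AddCommGroup G] [Module ℂ G]
    [TopologicalSpace G] [ContinuousAdd G] [ContinuousSMul ℂ G]
    {T : Z → (Fin k → ℂ) →ₗ[ℂ] G} {v : Z → Fin k → ℂ}
    (hT : ∀ v, ContinuousAt (fun z => T z v) z₀) (hv : ContinuousAt v z₀) :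
    ContinuousAt (fun z => T z (v z)) z₀ := by
  have h : ∀ z, T z (v z) = ∑ i, v z i • T z (Pi.single i 1) := fun z => by
    conv_lhs => rw [← Finset.univ_sum_single (v z), map_sum]
    refine Finset.sum_congr rfl fun i _ => ?_
    rw [← map_smul, ← Pi.single_smul, smul_eq_mul, mul_one]
  simp only [h]
  exact tendsto_finsetSum _ fun i _ => (continuousAt_pi.1 hv i).smul (hT _)

/-- The inverse of a continuous family of invertible linear maps is continuous. -/
theorem continuousAt_inverse {k l : ℕ} {T : Z → (Fin k → ℂ) →ₗ[ℂ] (Fin l → ℂ)}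
    {T' : Z → (Fin l → ℂ) →ₗ[ℂ] (Fin k → ℂ)} (hT : ∀ v, ContinuousAt (fun z => T z v) z₀)
    (h : ∀ᶠ z in nhds z₀, T' z ∘ₗ T z = LinearMap.id)
    (h' : ∀ᶠ z in nhds z₀, T z ∘ₗ T' z = LinearMap.id) (v : Fin l → ℂ) :
    ContinuousAt (fun z => T' z v) z₀ := by
  have hkl : k = l := by
    have e : (Fin k → ℂ) ≃ₗ[ℂ] (Fin l → ℂ) :=
      LinearEquiv.ofLinearMap (T z₀) (T' z₀) h'.self_of_nhds h.self_of_nhds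
    simpa using e.finrank_eq
  subst hkl
  let A : Z → Matrix (Fin k) (Fin k) ℂ := fun z => LinearMap.toMatrix' (T z)
  have hA : ContinuousAt A z₀ := continuousAt_pi.2 fun i => continuousAt_pi.2 fun j => by
    simp only [A, LinearMap.toMatrix'_apply]
    exact continuousAt_pi.1 (hT _) i
  have hunit : ∀ᶠ z in nhds z₀, LinearMap.toMatrix' (T' z) = A⁻¹ z := by
    filter_upwards [h] with z hz
    refine (Matrix.inv_eq_left_inv ?_).symm
    rw [← LinearMap.toMatrix'_comp, hz, LinearMap.toMatrix'_id]
  have hdet : (A z₀).det ≠ 0 := by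
    have : LinearMap.toMatrix' (T' z₀) * A z₀ = 1 := by
      rw [← LinearMap.toMatrix'_comp, h.self_of_nhds, LinearMap.toMatrix'_id]
    exact (Matrix.isUnit_det_of_left_inverse this).ne_zero
  -- The inverse matrix is the adjugate divided by the determinant, which is nonzero at `z₀`.
  have hinv : ContinuousAt (fun z => (A z)⁻¹) z₀ := by
    simp only [Matrix.inv_def, Ring.inverse_eq_inv']
    exact ContinuousAt.smul (ContinuousAt.inv₀
      ((Continuous.matrix_det continuous_id).continuousAt.comp hA) hdet)
      ((Continuous.matrix_adjugate continuous_id).continuousAt.comp hA)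
  have h3 : ContinuousAt (fun z => (A z)⁻¹.mulVec v) z₀ :=
    (Continuous.matrix_mulVec continuous_id continuous_const).continuousAt.comp hinv
  refine h3.congr ?_
  filter_upwards [hunit] with z hz
  rw [← LinearMap.toMatrix'_mulVec (T' z), hz]; rfl

end LinearFamilies

/-! ### Charts of complex vector bundles. -/

namespace ComplexBundle

variable {X Y : Type*} [TopologicalSpace X] [TopologicalSpace Y]

/-- A chart of a complex vector bundle, in terms of coordinates of vectors and sections with
given coordinates. -/
structure Chart (E : ComplexBundle.{_, w} X) where
  rank : ℕ
  dom : Set X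
  isOpen_dom : IsOpen dom
  coord : ∀ y, E.Fib y →ₗ[ℂ] (Fin rank → ℂ)
  sec : ∀ y, (Fin rank → ℂ) →ₗ[ℂ] E.Fib y
  coord_sec : ∀ y ∈ dom, ∀ v, coord y (sec y v) = v
  sec_coord : ∀ y ∈ dom, ∀ e, sec y (coord y e) = e
  continuousAt_coord : ∀ p : E.Total, p.proj ∈ dom →
    ContinuousAt (fun q : E.Total => coord q.proj q.2) p
  continuousAt_sec : ∀ p : X × (Fin rank → ℂ), p.1 ∈ dom →
    ContinuousAt (fun q : X × (Fin rank → ℂ) => (⟨q.1, sec q.1 q.2⟩ : E.Total)) p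

/-- The chart of a local trivialization. -/
def Chart.ofTrivialization {E : ComplexBundle.{_, w} X} {k : ℕ}
    (e : Trivialization (Fin k → ℂ) (TotalSpace.proj : E.Total → X))
    (coord : ∀ y, E.Fib y →ₗ[ℂ] (Fin k → ℂ)) (sec : ∀ y, (Fin k → ℂ) →ₗ[ℂ] E.Fib y)
    (hc : ∀ y ∈ e.baseSet, ∀ v, coord y v = (e ⟨y, v⟩).2)
    (coord_sec : ∀ y ∈ e.baseSet, ∀ v, coord y (sec y v) = v) : E.Chart where
  rank := k
  dom := e.baseSet
  isOpen_dom := e.open_baseSet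
  coord := coord
  sec := sec
  coord_sec := coord_sec
  sec_coord y hy v := by
    have hmem : ∀ v : E.Fib y, (⟨y, v⟩ : E.Total) ∈ e.source := fun v => e.mem_source.2 hy
    have h : (⟨y, sec y (coord y v)⟩ : E.Total) = ⟨y, v⟩ := by
      refine e.injOn (hmem _) (hmem _) (Prod.ext ?_ ?_)
      · exact (e.coe_fst (hmem _)).trans (e.coe_fst (hmem v)).symm
      · exact ((hc y hy _).symm.trans (coord_sec y hy _)).trans (hc y hy _)
    exact eq_of_heq (TotalSpace.mk.inj h).2
  continuousAt_coord p hp := by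
    have h := ((e.tendsto_nhds_iff (e.mem_source.2 hp)).1 continuousAt_id).2
    rw [ContinuousAt, hc _ hp]
    refine h.congr' ?_
    filter_upwards [E.continuous_proj.continuousAt.preimage_mem_nhds
      (e.open_baseSet.mem_nhds hp)] with q hq
    exact (hc _ hq q.2).symm
  continuousAt_sec p hp := by
    refine (e.tendsto_nhds_iff (e.mem_source.2 hp)).2 ⟨continuousAt_fst, ?_⟩
    rw [← hc _ hp, coord_sec _ hp]
    refine Filter.Tendsto.congr' ?_ (continuousAt_snd (p := p))
    filter_upwards [continuousAt_fst.preimage_mem_nhds (e.open_baseSet.mem_nhds hp)] with q hq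
    rw [← hc _ hq, coord_sec _ hq]

theorem exists_chart (E : ComplexBundle.{_, w} X) (x : X) : ∃ χ : E.Chart, x ∈ χ.dom := by
  classical
  obtain ⟨k, e, hx, hlin⟩ := E.locally_trivial x
  have hmem : ∀ y ∈ e.baseSet, ∀ v : E.Fib y, (⟨y, v⟩ : E.Total) ∈ e.source := fun y hy v =>
    e.mem_source.2 hy
  have hbij : ∀ y ∈ e.baseSet, Function.Bijective fun v : E.Fib y => (e ⟨y, v⟩).2 := by
    intro y hy
    constructor
    · intro v v' h
      have : (⟨y, v⟩ : E.Total) = ⟨y, v'⟩ := by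
        refine e.injOn (hmem _ hy _) (hmem _ hy _) (Prod.ext ?_ h)
        exact (e.coe_fst (hmem _ hy _)).trans (e.coe_fst (hmem _ hy v')).symm
      exact eq_of_heq (TotalSpace.mk.inj this).2
    · intro v
      have ht : (y, v) ∈ e.target := e.mem_target.2 hy
      obtain ⟨q, hq⟩ : ∃ q : E.Total, q = e.toOpenPartialHomeomorph.symm (y, v) := ⟨_, rfl⟩
      have h1 : e q = (y, v) := by rw [hq]; exact e.apply_symm_apply ht
      have h2 : q.proj = y := by rw [hq]; exact e.proj_symm_apply ht
      obtain ⟨y', b⟩ := q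
      obtain rfl : y' = y := h2
      exact ⟨b, congrArg Prod.snd h1⟩
  let L : ∀ y, y ∈ e.baseSet → (E.Fib y ≃ₗ[ℂ] (Fin k → ℂ)) := fun y hy =>
    LinearEquiv.ofBijective ((hlin y hy).mk' _) (hbij y hy)
  -- Coordinates and sections are extended by zero outside the base set, where the laws of a chart
  -- require nothing.
  refine ⟨Chart.ofTrivialization e
    (fun y => if hy : y ∈ e.baseSet then (L y hy).toLinearMap else 0)
    (fun y => if hy : y ∈ e.baseSet then (L y hy).symm.toLinearMap else 0) ?_ ?_, hx⟩
  · intro y hy v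
    rw [dif_pos hy]; rfl
  · intro y hy v
    rw [dif_pos hy, dif_pos hy]
    exact (L y hy).apply_symm_apply v

/-! ### Construction of bundles from charts -/

/-- The data of a chart for a family of vector spaces without a topology. -/
structure ChartData (Fib : X → Type w) [∀ x, AddCommGroup (Fib x)] [∀ x, Module ℂ (Fib x)] where
  rank : ℕ
  dom : Set X
  isOpen_dom : IsOpen dom
  coord : ∀ y, Fib y →ₗ[ℂ] (Fin rank → ℂ)
  sec : ∀ y, (Fin rank → ℂ) →ₗ[ℂ] Fib y
  coord_sec : ∀ y ∈ dom, ∀ v, coord y (sec y v) = v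
  sec_coord : ∀ y ∈ dom, ∀ e, sec y (coord y e) = e

section OfCharts

variable {Fib : X → Type w} [∀ x, AddCommGroup (Fib x)] [∀ x, Module ℂ (Fib x)]

/-- The parametrization of the total space by a chart. -/
def ChartData.param (D : ChartData Fib) (p : D.dom × (Fin D.rank → ℂ)) : TotalSpace Unit Fib :=
  ⟨p.1, D.sec p.1 p.2⟩

/-- Charts with continuous transition functions. -/
def ChartData.Compatible (D D' : ChartData Fib) : Prop :=
  ∀ y ∈ D.dom, y ∈ D'.dom → ∀ v, ContinuousAt (fun z => D'.coord z (D.sec z v)) y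

/-- The topology of the total space defined by a family of charts. -/
abbrev chartTopology {I : Type*} (D : I → ChartData Fib) : TopologicalSpace (TotalSpace Unit Fib) :=
  ⨆ i, TopologicalSpace.coinduced (D i).param inferInstance

theorem isOpen_chartTopology {I : Type*} (D : I → ChartData Fib) (s : Set (TotalSpace Unit Fib)) :
    @IsOpen _ (chartTopology D) s ↔ ∀ i, IsOpen ((D i).param ⁻¹' s) := by
  simp only [isOpen_iSup_iff, isOpen_coinduced]

theorem isOpen_preimage_proj {I : Type*} (D : I → ChartData Fib) (i : I) :
    @IsOpen _ (chartTopology D)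
      (TotalSpace.proj ⁻¹' (D i).dom : Set (TotalSpace Unit Fib)) := by
  rw [isOpen_chartTopology]
  intro j
  have h : Continuous fun p : (D j).dom × (Fin (D j).rank → ℂ) => (p.1 : X) :=
    continuous_subtype_val.comp continuous_fst
  exact (D i).isOpen_dom.preimage h

/-- The trivialization defined by a chart. -/
def chartTrivialization {I : Type*} (D : I → ChartData Fib)
    (hD : ∀ i j, (D i).Compatible (D j)) (i : I) :
    letI := chartTopology D
    Trivialization (Fin (D i).rank → ℂ) (TotalSpace.proj : TotalSpace Unit Fib → X) :=
  letI := chartTopology D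
  { toFun := fun p => (p.proj, (D i).coord p.proj p.2)
    invFun := fun p => ⟨p.1, (D i).sec p.1 p.2⟩
    source := TotalSpace.proj ⁻¹' (D i).dom
    target := (D i).dom ×ˢ Set.univ
    map_source' := fun p hp => ⟨hp, trivial⟩
    map_target' := fun p hp => hp.1
    left_inv' := fun p hp => by
      obtain ⟨y, e⟩ := p
      simp only [(D i).sec_coord y hp e]
    right_inv' := fun p hp => by
      obtain ⟨y, e⟩ := p
      simp only [(D i).coord_sec y hp.1 e]
    open_source := isOpen_preimage_proj D i
    open_target := (D i).isOpen_dom.prod isOpen_univ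
    continuousOn_toFun := by
      rw [continuousOn_open_iff (isOpen_preimage_proj D i)]
      intro s hs
      -- The total space carries the final topology of the parametrizations, so continuity of a
      -- chart reduces to that of its transition functions from all charts `j`.
      refine (isOpen_chartTopology D _).2 fun j => ?_
      rw [isOpen_iff_mem_nhds]
      rintro ⟨y, v⟩ ⟨h1, h2⟩
      have hc : ContinuousAt (fun q : (D j).dom × (Fin (D j).rank → ℂ) =>
          (((q.1 : X), (D i).coord q.1 ((D j).sec q.1 q.2)) : X × (Fin (D i).rank → ℂ)))
          (y, v) := by
        refine ContinuousAt.prodMk (continuous_subtype_val.comp continuous_fst).continuousAt ?_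
        refine continuousAt_apply_of_pointwise
          (T := fun q : (D j).dom × (Fin (D j).rank → ℂ) =>
            (D i).coord (q.1 : X) ∘ₗ (D j).sec (q.1 : X))
          (v := fun q => q.2) (fun v => ?_)
          continuousAt_snd
        exact ContinuousAt.comp (f := fun q : (D j).dom × (Fin (D j).rank → ℂ) => (q.1 : X))
          (g := fun z => (D i).coord z ((D j).sec z v)) (hD j i y y.2 h1 v)
          (continuous_subtype_val.comp continuous_fst).continuousAt
      have h3 := hc.preimage_mem_nhds (hs.mem_nhds h2)
      have h4 : ContinuousAt (fun q : (D j).dom × (Fin (D j).rank → ℂ) => (q.1 : X)) (y, v) :=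
        (continuous_subtype_val.comp continuous_fst).continuousAt
      filter_upwards [h3, h4.preimage_mem_nhds ((D i).isOpen_dom.mem_nhds h1)] with q hq hq'
      exact ⟨hq', hq⟩
    continuousOn_invFun := by
      rw [continuousOn_iff_continuous_domRestrict]
      have hp : Continuous (D i).param := continuous_iff_coinduced_le.2
        (le_iSup (fun i => TopologicalSpace.coinduced (D i).param inferInstance) i)
      exact hp.comp (Continuous.prodMk
        (Continuous.subtype_mk (continuous_fst.comp continuous_subtype_val) fun p => p.2.1)
        (continuous_snd.comp continuous_subtype_val))
    baseSet := (D i).dom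
    open_baseSet := (D i).isOpen_dom
    source_eq := rfl
    target_eq := rfl
    proj_toFun := fun _ _ => rfl }

/-- The complex vector bundle defined by a family of charts. -/
def ofCharts {I : Type*} (D : I → ChartData Fib) (hD : ∀ i j, (D i).Compatible (D j))
    (hc : ∀ x, ∃ i, x ∈ (D i).dom) : ComplexBundle.{_, w} X :=
  letI := chartTopology D
  { Fib := Fib
    locally_trivial := fun x => by
      obtain ⟨i, hi⟩ := hc x
      exact ⟨(D i).rank, chartTrivialization D hD i, hi, fun y _ =>
        ((D i).coord y).isLinear⟩ }

/-- The charts of a bundle which is defined by charts. -/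
def ofChartsChart {I : Type*} (D : I → ChartData Fib) (hD : ∀ i j, (D i).Compatible (D j))
    (hc : ∀ x, ∃ i, x ∈ (D i).dom) (i : I) : (ofCharts D hD hc).Chart :=
  Chart.ofTrivialization (E := ofCharts D hD hc) (chartTrivialization D hD i) (D i).coord
    (D i).sec (fun _ _ _ => rfl) (D i).coord_sec

end OfCharts

/-! ### Continuous families of linear maps between the fibres -/

section Families

variable {Z Z' : Type*} [TopologicalSpace Z] [TopologicalSpace Z'] {X₁ X₂ X₃ : Type*}
  [TopologicalSpace X₁] [TopologicalSpace X₂] [TopologicalSpace X₃]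
  {E : ComplexBundle.{_, w} X₁} {F : ComplexBundle.{_, w} X₂} {G : ComplexBundle.{_, w} X₃}
  {b : Z → X₁} {b' : Z → X₂} {b'' : Z → X₃} {z₀ : Z}

/-- A family of linear maps between fibres of two bundles is continuous at a point. -/
def FamContAt (E : ComplexBundle.{_, w} X₁) (F : ComplexBundle.{_, w} X₂) (b : Z → X₁)
    (b' : Z → X₂) (f : ∀ z, E.Fib (b z) →ₗ[ℂ] F.Fib (b' z)) (z₀ : Z) : Prop :=
  ∀ (χ : E.Chart) (χ' : F.Chart), b z₀ ∈ χ.dom → b' z₀ ∈ χ'.dom →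
    ∀ v, ContinuousAt (fun z => χ'.coord (b' z) (f z (χ.sec (b z) v))) z₀

theorem Chart.eventually_mem (χ : E.Chart) (hb : ContinuousAt b z₀) (h : b z₀ ∈ χ.dom) :
    ∀ᶠ z in nhds z₀, b z ∈ χ.dom :=
  hb.preimage_mem_nhds (χ.isOpen_dom.mem_nhds h)

theorem Chart.continuousAt_transition (χ χ' : E.Chart) (hb : ContinuousAt b z₀)
    (h : b z₀ ∈ χ.dom) (h' : b z₀ ∈ χ'.dom) (v : Fin χ.rank → ℂ) :
    ContinuousAt (fun z => χ'.coord (b z) (χ.sec (b z) v)) z₀ := by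
  have h1 : ContinuousAt (fun z => (b z, v)) z₀ := hb.prodMk continuousAt_const
  have h2 := ContinuousAt.comp (f := fun z => (b z, v)) (χ.continuousAt_sec (b z₀, v) h) h1
  exact ContinuousAt.comp (f := fun z => (⟨b z, χ.sec (b z) v⟩ : E.Total))
    (χ'.continuousAt_coord ⟨b z₀, χ.sec (b z₀) v⟩ h') h2

/-- Continuity can be checked in one pair of charts. -/
theorem FamContAt.of_chart {f : ∀ z, E.Fib (b z) →ₗ[ℂ] F.Fib (b' z)} (hb : ContinuousAt b z₀)
    (hb' : ContinuousAt b' z₀) (χ : E.Chart) (χ' : F.Chart) (h : b z₀ ∈ χ.dom)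
    (h' : b' z₀ ∈ χ'.dom)
    (hf : ∀ v, ContinuousAt (fun z => χ'.coord (b' z) (f z (χ.sec (b z) v))) z₀) :
    FamContAt E F b b' f z₀ := by
  intro ψ ψ' k k' v
  have h1 : ContinuousAt (fun z => χ'.coord (b' z) (f z (χ.sec (b z)
      (χ.coord (b z) (ψ.sec (b z) v))))) z₀ :=
    continuousAt_apply_of_pointwise (T := fun z => χ'.coord (b' z) ∘ₗ f z ∘ₗ χ.sec (b z)) hf
      (ψ.continuousAt_transition χ hb k h v)
  have h2 := continuousAt_apply_of_pointwise (T := fun z => ψ'.coord (b' z) ∘ₗ χ'.sec (b' z))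
    (χ'.continuousAt_transition ψ' hb' h' k') h1
  refine h2.congr ?_
  filter_upwards [χ.eventually_mem hb h, χ'.eventually_mem hb' h'] with z hz hz'
  simp only [LinearMap.comp_apply]
  rw [χ'.sec_coord _ hz', χ.sec_coord _ hz]

theorem FamContAt.comp {f : ∀ z, E.Fib (b z) →ₗ[ℂ] F.Fib (b' z)}
    {g : ∀ z, F.Fib (b' z) →ₗ[ℂ] G.Fib (b'' z)} (hg : FamContAt F G b' b'' g z₀)
    (hf : FamContAt E F b b' f z₀) (hb' : ContinuousAt b' z₀) :
    FamContAt E G b b'' (fun z => g z ∘ₗ f z) z₀ := by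
  intro χ χ'' h h'' v
  obtain ⟨χ', h'⟩ := F.exists_chart (b' z₀)
  have h1 := continuousAt_apply_of_pointwise
    (T := fun z => χ''.coord (b'' z) ∘ₗ g z ∘ₗ χ'.sec (b' z)) (hg χ' χ'' h' h'')
    (hf χ χ' h h' v)
  refine h1.congr ?_
  filter_upwards [χ'.eventually_mem hb' h'] with z hz'
  simp only [LinearMap.comp_apply]
  rw [χ'.sec_coord _ hz']

theorem FamContAt.congr {f g : ∀ z, E.Fib (b z) →ₗ[ℂ] F.Fib (b' z)}
    (hf : FamContAt E F b b' f z₀) (h : ∀ᶠ z in nhds z₀, f z = g z) :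
    FamContAt E F b b' g z₀ := fun χ χ' hχ hχ' v => (hf χ χ' hχ hχ' v).congr <| by
  filter_upwards [h] with z hz
  rw [hz]

theorem FamContAt.restrict {f : ∀ z, E.Fib (b z) →ₗ[ℂ] F.Fib (b' z)} {h : Z' → Z} {z₁ : Z'}
    (hf : FamContAt E F b b' f (h z₁)) (hh : ContinuousAt h z₁) :
    FamContAt E F (fun z => b (h z)) (fun z => b' (h z)) (fun z => f (h z)) z₁ :=
  fun χ χ' k k' v => ContinuousAt.comp
    (g := fun z => χ'.coord (b' z) (f z (χ.sec (b z) v))) (hf χ χ' k k' v) hh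

theorem FamContAt.smul {f : ∀ z, E.Fib (b z) →ₗ[ℂ] F.Fib (b' z)} {c : Z → ℂ}
    (hc : ContinuousAt c z₀) (hf : FamContAt E F b b' f z₀) :
    FamContAt E F b b' (fun z => c z • f z) z₀ := fun χ χ' k k' v => by
  simp only [LinearMap.smul_apply, map_smul]
  exact hc.smul (hf χ χ' k k' v)

theorem FamContAt.add {f g : ∀ z, E.Fib (b z) →ₗ[ℂ] F.Fib (b' z)}
    (hf : FamContAt E F b b' f z₀) (hg : FamContAt E F b b' g z₀) :
    FamContAt E F b b' (fun z => f z + g z) z₀ := fun χ χ' k k' v => by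
  simp only [LinearMap.add_apply, map_add]
  exact (hf χ χ' k k' v).add (hg χ χ' k k' v)

theorem FamContAt.zero : FamContAt E F b b' (fun _ => 0) z₀ := fun χ χ' k k' v => by
  simpa using continuousAt_const

theorem FamContAt.sum {I : Type*} (s : Finset I) {f : I → ∀ z, E.Fib (b z) →ₗ[ℂ] F.Fib (b' z)}
    (hf : ∀ i ∈ s, FamContAt E F b b' (f i) z₀) :
    FamContAt E F b b' (fun z => ∑ i ∈ s, f i z) z₀ := fun χ χ' k k' v => by
  simp only [LinearMap.sum_apply, map_sum]
  exact tendsto_finsetSum _ fun i hi => hf i hi χ χ' k k' v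

/-- In charts this is `continuousAt_inverse`. It is what makes fibrewise bijective bundle maps
isomorphisms. -/
theorem FamContAt.symm {f : ∀ z, E.Fib (b z) →ₗ[ℂ] F.Fib (b' z)}
    {g : ∀ z, F.Fib (b' z) →ₗ[ℂ] E.Fib (b z)} (hf : FamContAt E F b b' f z₀)
    (hb : ContinuousAt b z₀) (hb' : ContinuousAt b' z₀)
    (hgf : ∀ᶠ z in nhds z₀, g z ∘ₗ f z = LinearMap.id)
    (hfg : ∀ᶠ z in nhds z₀, f z ∘ₗ g z = LinearMap.id) :
    FamContAt F E b' b g z₀ := by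
  intro χ' χ h' h v
  refine continuousAt_inverse (T := fun z => χ'.coord (b' z) ∘ₗ f z ∘ₗ χ.sec (b z))
    (T' := fun z => χ.coord (b z) ∘ₗ g z ∘ₗ χ'.sec (b' z)) (hf χ χ' h h') ?_ ?_ v
  · filter_upwards [hgf, χ.eventually_mem hb h, χ'.eventually_mem hb' h'] with z hz k k'
    refine LinearMap.ext fun v => ?_
    have := LinearMap.congr_fun hz (χ.sec (b z) v)
    simp only [LinearMap.comp_apply, LinearMap.id_apply] at this ⊢
    rw [χ'.sec_coord _ k', this, χ.coord_sec _ k]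
  · filter_upwards [hfg, χ.eventually_mem hb h, χ'.eventually_mem hb' h'] with z hz k k'
    refine LinearMap.ext fun v => ?_
    have := LinearMap.congr_fun hz (χ'.sec (b' z) v)
    simp only [LinearMap.comp_apply, LinearMap.id_apply] at this ⊢
    rw [χ.sec_coord _ k, this, χ'.coord_sec _ k']

/-- A continuous family maps continuous families of vectors to continuous families. -/
theorem FamContAt.apply {f : ∀ z, E.Fib (b z) →ₗ[ℂ] F.Fib (b' z)}
    (hf : FamContAt E F b b' f z₀) (hb : ContinuousAt b z₀) (hb' : ContinuousAt b' z₀)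
    {e : ∀ z, E.Fib (b z)} (he : ContinuousAt (fun z => (⟨b z, e z⟩ : E.Total)) z₀) :
    ContinuousAt (fun z => (⟨b' z, f z (e z)⟩ : F.Total)) z₀ := by
  obtain ⟨χ, h⟩ := E.exists_chart (b z₀)
  obtain ⟨χ', h'⟩ := F.exists_chart (b' z₀)
  have h1 : ContinuousAt (fun z => χ.coord (b z) (e z)) z₀ :=
    ContinuousAt.comp (f := fun z => (⟨b z, e z⟩ : E.Total))
      (χ.continuousAt_coord ⟨b z₀, e z₀⟩ h) he
  have h2 := continuousAt_apply_of_pointwise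
    (T := fun z => χ'.coord (b' z) ∘ₗ f z ∘ₗ χ.sec (b z)) (hf χ χ' h h') h1
  have h3 := ContinuousAt.comp (f := fun z => (b' z, χ'.coord (b' z) (f z (χ.sec (b z)
    (χ.coord (b z) (e z)))))) (χ'.continuousAt_sec (b' z₀, _) h') (hb'.prodMk h2)
  refine h3.congr ?_
  filter_upwards [χ.eventually_mem hb h, χ'.eventually_mem hb' h'] with z hz hz'
  simp only [Function.comp_apply]
  rw [χ'.sec_coord _ hz', χ.sec_coord _ hz]

/-- A family which maps continuous families of vectors to continuous families is continuous. -/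
theorem FamContAt.of_apply {f : ∀ z, E.Fib (b z) →ₗ[ℂ] F.Fib (b' z)} (hb : ContinuousAt b z₀)
    (h : ∀ e : ∀ z, E.Fib (b z), ContinuousAt (fun z => (⟨b z, e z⟩ : E.Total)) z₀ →
      ContinuousAt (fun z => (⟨b' z, f z (e z)⟩ : F.Total)) z₀) :
    FamContAt E F b b' f z₀ := by
  intro χ χ' k k' v
  have h1 : ContinuousAt (fun z => (⟨b z, χ.sec (b z) v⟩ : E.Total)) z₀ :=
    ContinuousAt.comp (f := fun z => (b z, v)) (χ.continuousAt_sec (b z₀, v) k)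
      (hb.prodMk continuousAt_const)
  exact ContinuousAt.comp (f := fun z => (⟨b' z, f z (χ.sec (b z) v)⟩ : F.Total))
    (χ'.continuousAt_coord ⟨b' z₀, _⟩ k') (h _ h1)

/-- Continuous families of linear maps as continuous maps of total spaces. -/
theorem continuous_pullback_iff {f : ∀ z, E.Fib (b z) →ₗ[ℂ] F.Fib (b' z)} (hb : Continuous b)
    (hb' : Continuous b') :
    Continuous (fun p : TotalSpace Unit (b *ᵖ E.Fib) => (⟨b' p.1, f p.1 p.2⟩ : F.Total)) ↔
      ∀ z, FamContAt E F b b' f z := by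
  constructor
  · intro h z
    refine FamContAt.of_apply hb.continuousAt fun e he => ?_
    have h1 : ContinuousAt (fun z => (⟨z, e z⟩ : TotalSpace Unit (b *ᵖ E.Fib))) z := by
      rw [(inducing_pullbackTotalSpaceEmbedding Unit E.Fib b).continuousAt_iff]
      exact continuousAt_id.prodMk he
    exact ContinuousAt.comp (f := fun z => (⟨z, e z⟩ : TotalSpace Unit (b *ᵖ E.Fib)))
      h.continuousAt h1
  · intro h
    rw [continuous_iff_continuousAt]
    intro p
    have hp : Continuous (TotalSpace.proj : TotalSpace Unit (b *ᵖ E.Fib) → Z) :=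
      Pullback.continuous_proj Unit E.Fib b
    exact ((h p.proj).restrict hp.continuousAt).apply (hb.comp hp).continuousAt
      (hb'.comp hp).continuousAt (e := fun q => q.2)
      (Pullback.continuous_lift Unit E.Fib b).continuousAt

theorem continuous_totalMap_iff {E F : ComplexBundle.{_, w} X}
    {f : ∀ x, E.Fib x →ₗ[ℂ] F.Fib x} :
    Continuous (totalMap f) ↔ ∀ x, FamContAt E F id id f x := by
  constructor
  · intro h x
    refine FamContAt.of_apply continuousAt_id fun e he => ?_
    exact ContinuousAt.comp (f := fun z => (⟨z, e z⟩ : E.Total)) h.continuousAt he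
  · intro h
    rw [continuous_iff_continuousAt]
    intro p
    exact ((h p.proj).restrict E.continuous_proj.continuousAt).apply
      E.continuous_proj.continuousAt E.continuous_proj.continuousAt (e := fun q => q.2)
      continuousAt_id

end Families

end ComplexBundle

/-! ### Orthonormal frames -/

section GramSchmidt

open InnerProductSpace

variable {W : Type*} [NormedAddCommGroup W] [InnerProductSpace ℝ W] {m : ℕ}

/-- `β i` differs from its orthogonalization by a combination of earlier orthogonal vectors. These
numbers control the diagonal of the triangular change of basis. -/
theorem inner_gramSchmidt_self (β : Fin m → W) (i : Fin m) :
    inner ℝ (gramSchmidt ℝ β i) (β i) = ‖gramSchmidt ℝ β i‖ ^ 2 := by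
  conv_lhs => rw [gramSchmidt_def'' ℝ β i]
  rw [inner_add_right, inner_sum, Finset.sum_eq_zero, add_zero, real_inner_self_eq_norm_sq]
  intro j hj
  rw [inner_smul_right, gramSchmidt_orthogonal ℝ β (ne_of_gt (Finset.mem_Iio.1 hj)), mul_zero]

/-- The orthonormalization of a basis has the same orientation. -/
theorem gramSchmidt_orientation (β : Module.Basis (Fin m) ℝ W) :
    ∃ b : OrthonormalBasis (Fin m) ℝ W, (∀ i, b i = gramSchmidtNormed ℝ β i) ∧
      b.toBasis.orientation = β.orientation := by
  have : FiniteDimensional ℝ W := β.finiteDimensional_of_finite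
  have h : Module.finrank ℝ W = Fintype.card (Fin m) := Module.finrank_eq_card_basis β
  have hn : ∀ i, ‖gramSchmidt ℝ β i‖ ≠ 0 := fun i =>
    norm_ne_zero_iff.2 (gramSchmidt_ne_zero i β.linearIndependent)
  have hb : ∀ i, gramSchmidtOrthonormalBasis h β i = gramSchmidtNormed ℝ β i := fun i =>
    gramSchmidtOrthonormalBasis_apply h (smul_ne_zero (by simpa using hn i)
      (norm_ne_zero_iff.1 (hn i)))
  refine ⟨gramSchmidtOrthonormalBasis h β, hb, ?_⟩
  -- The determinant of the change of basis is the product of its diagonal entries, and each of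
  -- these is the positive norm of a Gram–Schmidt vector.
  rw [Module.Basis.orientation_eq_iff_det_pos, gramSchmidtOrthonormalBasis_det]
  refine Finset.prod_pos fun i _ => ?_
  rw [hb, gramSchmidtNormed, inner_smul_left, inner_gramSchmidt_self]
  have := hn i
  simp only [RCLike.ofReal_real_eq_id, id_eq, conj_trivial]
  positivity

end GramSchmidt

/-! ### Pairs of frames over one point. -/

section FramePairs

variable {M : Type u} {n : ℕ} {V : M → Type v}
  [∀ x, NormedAddCommGroup (V x)] [∀ x, InnerProductSpace ℝ (V x)]
  {o : ∀ x, Orientation ℝ (V x) (Fin (2 * n))}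

/-- The element `p⁻¹ q` of `SO(2n)` defined by two frames. -/
def FrameAt.diff {x : M} (p q : FrameAt V o x) : Model n ≃ₗᵢ[ℝ] Model n := q.1.trans p.1.symm

theorem FrameAt.cliffordMap_diff {x : M} (p q : FrameAt V o x) (c : ModelCl n) :
    cliffordMap p.1 (cliffordMap (p.diff q) c) = cliffordMap q.1 c := by
  rw [cliffordMap_cliffordMap]
  congr 1
  congr 1
  exact LinearIsometryEquiv.ext fun v => by simp [FrameAt.diff]

theorem FrameAt.cliffordMap_symm {x : M} (p q : FrameAt V o x) (c : ClFib V x) :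
    cliffordMap p.1.symm c = cliffordMap (p.diff q) (cliffordMap q.1.symm c) := by
  rw [cliffordMap_cliffordMap]
  congr 1
  congr 1
  exact LinearIsometryEquiv.ext fun v => by simp [FrameAt.diff]

theorem FrameAt.diff_self {x : M} (p : FrameAt V o x) :
    p.diff p = LinearIsometryEquiv.refl ℝ _ :=
  LinearIsometryEquiv.ext fun v => by simp [FrameAt.diff]

theorem FrameAt.diff_trans {x : M} (p q r : FrameAt V o x) :
    (q.diff r).trans (p.diff q) = p.diff r :=
  LinearIsometryEquiv.ext fun v => by simp [FrameAt.diff]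

/-- Both frames carry the standard orientation to `o x`, so `p⁻¹ q` preserves it and has positive
determinant. -/
theorem FrameAt.exists_lifts {x : M} (p q : FrameAt V o x) :
    ∃ a : Spin n, SpinLifts a (p.diff q) := by
  refine Spin.exists_lifts _ ?_
  rw [← Orientation.map_eq_iff_det_pos (stdOrientation n) _ (by simp)]
  have h : ∀ x : Orientation ℝ (Model n) (Fin (2 * n)),
      Orientation.map (Fin (2 * n)) (p.diff q).toLinearEquiv x =
      (Orientation.map (Fin (2 * n)) p.1.toLinearEquiv).symm
        (Orientation.map (Fin (2 * n)) q.1.toLinearEquiv x) := by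
    intro x
    induction x using Module.Ray.ind with
    | h v hv => rfl
  rw [h, q.2, Equiv.symm_apply_eq, p.2]

end FramePairs

section Frames

variable {M : Type u} [TopologicalSpace M] {n : ℕ} {V : M → Type v}
  [∀ x, NormedAddCommGroup (V x)] [∀ x, InnerProductSpace ℝ (V x)]
  [TopologicalSpace (TotalSpace (Model n) V)]
  {o : ∀ x, Orientation ℝ (V x) (Fin (2 * n))}

theorem FrameBundle.continuous_base : Continuous (FrameBundle.base : FrameBundle V o → M) :=
  continuous_iff_continuousAt.2 fun _ =>
    ((Topology.IsInducing.induced _).continuousAt_iff.1 continuousAt_id).fst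

/-- A continuous map to the frame bundle over a given map to the base. -/
def FrameContAt {Z : Type*} [TopologicalSpace Z] (b : Z → M) (p : ∀ z, FrameAt V o (b z))
    (z₀ : Z) : Prop := ContinuousAt (fun z => (⟨b z, p z⟩ : FrameBundle V o)) z₀

theorem frameContAt_iff {Z : Type*} [TopologicalSpace Z] {b : Z → M}
    {p : ∀ z, FrameAt V o (b z)} {z₀ : Z} : FrameContAt b p z₀ ↔ ContinuousAt b z₀ ∧
      ∀ i, ContinuousAt (fun z => (⟨b z, (p z).1 (EuclideanSpace.single i 1)⟩ :
        TotalSpace (Model n) V)) z₀ := by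
  rw [FrameContAt, (Topology.IsInducing.induced _).continuousAt_iff]
  exact ⟨fun h => ⟨h.fst, continuousAt_pi.1 h.snd⟩, fun h => h.1.prodMk (continuousAt_pi.2 h.2)⟩

theorem FrameContAt.restrict {Z Z' : Type*} [TopologicalSpace Z] [TopologicalSpace Z'] {b : Z → M}
    {p : ∀ z, FrameAt V o (b z)} {h : Z' → Z} {z₁ : Z'} (hp : FrameContAt b p (h z₁))
    (hh : ContinuousAt h z₁) : FrameContAt (fun z => b (h z)) (fun z => p (h z)) z₁ :=
  ContinuousAt.comp (g := fun z => (⟨b z, p z⟩ : FrameBundle V o)) hp hh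

/-- Sections of a vector bundle are continuous if their coordinates are. -/
theorem continuousAt_section_iff
    (e : Trivialization (Model n) (TotalSpace.proj : TotalSpace (Model n) V → M))
    [e.IsLinear ℝ] {x : M} (hx : x ∈ e.baseSet) {s : ∀ x, V x} :
    ContinuousAt (fun y => (⟨y, s y⟩ : TotalSpace (Model n) V)) x ↔
      ContinuousAt (fun y => e.linearMapAt ℝ y (s y)) x := by
  have h : (fun y => e.linearMapAt ℝ y (s y)) =ᶠ[nhds x] fun y => (e ⟨y, s y⟩).2 := by
    filter_upwards [e.open_baseSet.mem_nhds hx] with y hy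
    rw [e.coe_linearMapAt_of_mem hy]
  rw [continuousAt_congr h]
  constructor
  · intro hs
    exact ((e.tendsto_nhds_iff (e.mem_source.2 hx)).1 hs).2
  · intro hs
    exact (e.tendsto_nhds_iff (e.mem_source.2 hx)).2 ⟨continuousAt_id, hs⟩

variable [FiberBundle (Model n) V] [VectorBundle ℝ (Model n) V]

variable [IsContinuousRiemannianBundle (Model n) V]

-- Induction along the Gram–Schmidt recursion: the coefficients are quotients of inner products,
-- continuous because the metric is, with denominators nonzero at `x` by linear independence.
open InnerProductSpace in
theorem continuousAt_gramSchmidt {m : ℕ}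
    (e : Trivialization (Model n) (TotalSpace.proj : TotalSpace (Model n) V → M))
    [e.IsLinear ℝ] {x : M} (hx : x ∈ e.baseSet) (β : ∀ x, Fin m → V x)
    (hβ : ∀ i, ContinuousAt (fun y => (⟨y, β y i⟩ : TotalSpace (Model n) V)) x)
    (hli : LinearIndependent ℝ (β x)) (i : Fin m) :
    ContinuousAt (fun y => (⟨y, gramSchmidt ℝ (β y) i⟩ : TotalSpace (Model n) V)) x := by
  induction i using WellFoundedLT.induction with
  | ind i ih =>
    rw [continuousAt_section_iff e hx]
    have h : ∀ y, e.linearMapAt ℝ y (gramSchmidt ℝ (β y) i) = e.linearMapAt ℝ y (β y i) -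
        ∑ j ∈ Finset.Iio i, (inner ℝ (gramSchmidt ℝ (β y) j) (β y i) /
          inner ℝ (gramSchmidt ℝ (β y) j) (gramSchmidt ℝ (β y) j)) •
            e.linearMapAt ℝ y (gramSchmidt ℝ (β y) j) := fun y => by
      rw [eq_sub_iff_add_eq]
      conv_rhs => rw [gramSchmidt_def'' ℝ (β y) i]
      simp only [map_add, map_sum, map_smul, real_inner_self_eq_norm_sq]
      rfl
    simp only [h]
    refine ((continuousAt_section_iff e hx).1 (hβ i)).sub (tendsto_finsetSum _ fun j hj => ?_)
    have hj' := ih j (Finset.mem_Iio.1 hj)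
    refine ContinuousAt.smul (ContinuousAt.div (hj'.inner_bundle (hβ i))
      (hj'.inner_bundle hj') ?_) ((continuousAt_section_iff e hx).1 hj')
    rw [real_inner_self_eq_norm_sq]
    exact pow_ne_zero _ (norm_ne_zero_iff.2 (gramSchmidt_ne_zero j hli))

/-- Local positively oriented orthonormal frames exist. -/
theorem exists_local_frame (ho : IsBundleOrientation V o) (x₀ : M) :
    ∃ U : Set M, IsOpen U ∧ x₀ ∈ U ∧ ∃ f : ∀ x, FrameAt V o x,
      ∀ x ∈ U, FrameContAt (fun x => x) f x := by
  classical
  have key : ∀ x₀, ∃ e : Trivialization (Model n) (TotalSpace.proj : TotalSpace (Model n) V → M),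
      ∃ β : ∀ x, Fin (2 * n) → V x, x₀ ∈ e.baseSet ∧ e.IsLinear ℝ ∧
      (∀ x ∈ e.baseSet, ∀ i,
        ContinuousAt (fun y => (⟨y, β y i⟩ : TotalSpace (Model n) V)) x) ∧
      (∀ x ∈ e.baseSet, LinearIndependent ℝ (β x)) ∧
      ∀ x ∈ e.baseSet, ∃ p : FrameAt V o x, ∀ i, p.1 (EuclideanSpace.single i 1) =
        InnerProductSpace.gramSchmidtNormed ℝ (β x) i := by
    intro x₀
    obtain ⟨e, he, hx₀, hor⟩ := ho x₀
    have hβ : ∀ (x : M) (hx : x ∈ e.baseSet), (fun i => e.symm x (EuclideanSpace.single i 1)) =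
        ((EuclideanSpace.basisFun (Fin (2 * n)) ℝ).toBasis.map
          (e.linearEquivAt ℝ x hx).symm) := fun x hx => by
      ext i
      rw [Module.Basis.map_apply, e.linearEquivAt_symm_apply]
      simp
    refine ⟨e, fun x i => e.symm x (EuclideanSpace.single i 1), hx₀, he, fun x hx i => ?_,
      fun x hx => ?_, fun x hx => ?_⟩
    · rw [continuousAt_section_iff e hx]
      refine continuousAt_const (y := EuclideanSpace.single i (1 : ℝ)) |>.congr ?_
      filter_upwards [e.open_baseSet.mem_nhds hx] with y hy
      rw [← e.symmₗ_apply (R := ℝ) hy, e.linearMapAt_symmₗ hy]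
    · have := ((EuclideanSpace.basisFun (Fin (2 * n)) ℝ).toBasis.map
        (e.linearEquivAt ℝ x hx).symm).linearIndependent
      rwa [← hβ x hx] at this
    · obtain ⟨b, hb, hbo⟩ := gramSchmidt_orientation
        ((EuclideanSpace.basisFun (Fin (2 * n)) ℝ).toBasis.map (e.linearEquivAt ℝ x hx).symm)
      refine ⟨⟨b.repr.symm, ?_⟩, fun i => ?_⟩
      · have h1 : (EuclideanSpace.basisFun (Fin (2 * n)) ℝ).toBasis.map
            b.repr.symm.toLinearEquiv = b.toBasis :=
          Module.Basis.eq_of_apply_eq fun i => by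
            rw [Module.Basis.map_apply, b.coe_toBasis, OrthonormalBasis.coe_toBasis,
              EuclideanSpace.basisFun_apply]
            exact b.repr_symm_single i
        rw [stdOrientation, ← Module.Basis.orientation_map, h1, hbo,
          Module.Basis.orientation_map, ← Orientation.map_symm, Equiv.symm_apply_eq]
        exact (hor x hx).symm
      · exact (b.repr_symm_single i).trans ((hb i).trans (by rw [← hβ x hx]))
  -- The family of frames is total, but it has to be continuous only over the base set. Pointwise
  -- existence provides the values outside it.
  have hne : ∀ x, Nonempty (FrameAt V o x) := fun x => by
    obtain ⟨e, β, hx, -, -, -, h⟩ := key x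
    exact ⟨(h x hx).choose⟩
  obtain ⟨e, β, hx₀, he, hβ, hli, hp⟩ := key x₀
  choose! p hp using hp
  refine ⟨e.baseSet, e.open_baseSet, hx₀, p, fun x hx => ?_⟩
  rw [frameContAt_iff]
  refine ⟨continuousAt_id, fun i => ?_⟩
  have hgs := continuousAt_gramSchmidt e hx β (hβ x hx) (hli x hx) i
  have h2 : ContinuousAt (fun y => (⟨y, InnerProductSpace.gramSchmidtNormed ℝ (β y) i⟩ :
      TotalSpace (Model n) V)) x := by
    rw [continuousAt_section_iff e hx]
    simp only [InnerProductSpace.gramSchmidtNormed, map_smul, RCLike.ofReal_real_eq_id, id_eq]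
    refine Filter.Tendsto.smul (Filter.Tendsto.inv₀ ?_ ?_) ((continuousAt_section_iff e hx).1 hgs)
    · simp only [norm_eq_sqrt_real_inner]
      exact (hgs.inner_bundle hgs).sqrt
    exact norm_ne_zero_iff.2 (InnerProductSpace.gramSchmidt_ne_zero i (hli x hx))
  refine h2.congr ?_
  filter_upwards [e.open_baseSet.mem_nhds hx] with y hy
  rw [hp y hy]

theorem nonempty_frameAt (ho : IsBundleOrientation V o) (x : M) : Nonempty (FrameAt V o x) :=
  let ⟨_, _, _, f, _⟩ := exists_local_frame ho x
  ⟨f x⟩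

/-- The element `p⁻¹ q` of `SO(2n)` depends continuously on the frames. -/
theorem continuousAt_diff {Z : Type*} [TopologicalSpace Z] {b : Z → M}
    {p q : ∀ z, FrameAt V o (b z)} {z₀ : Z} (hp : FrameContAt b p z₀) (hq : FrameContAt b q z₀)
    (v : Model n) : ContinuousAt (fun z => (p z).diff (q z) v) z₀ := by
  -- The matrix entries of `p⁻¹ q` are the inner products of the vectors of `p` with those of `q`.
  have h : ∀ z, (p z).diff (q z) v = ∑ i, (∑ j, v j * inner ℝ
      ((p z).1 (EuclideanSpace.single i 1)) ((q z).1 (EuclideanSpace.single j 1))) •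
        (EuclideanSpace.single i (1 : ℝ) : Model n) := fun z => by
    rw [sum_single ((p z).diff (q z) v)]
    refine Finset.sum_congr rfl fun i _ => ?_
    congr 1
    have h1 : ((p z).diff (q z) v) i = inner ℝ ((p z).1 (EuclideanSpace.single i 1))
        ((q z).1 v) := by
      have h2 : ((p z).diff (q z) v) i =
          inner ℝ (EuclideanSpace.single i (1 : ℝ) : Model n) ((p z).diff (q z) v) := by
        simp [EuclideanSpace.inner_single_left]
      rw [h2, ← LinearIsometryEquiv.inner_map_map (p z).1]
      simp [FrameAt.diff]
    rw [h1]
    conv_lhs => rw [sum_single v]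
    simp only [map_sum, map_smul, inner_sum, inner_smul_right]
  simp only [h]
  refine tendsto_finsetSum _ fun i _ => Filter.Tendsto.smul
    (tendsto_finsetSum _ fun j _ => tendsto_const_nhds.mul ?_) tendsto_const_nhds
  exact ((frameContAt_iff.1 hp).2 i).inner_bundle ((frameContAt_iff.1 hq).2 j)

/-- Continuous pairs of frames have continuous local lifts to `Spin(2n)`. -/
theorem exists_continuousAt_lift_diff {Z : Type*} [TopologicalSpace Z] {b : Z → M}
    {p q : ∀ z, FrameAt V o (b z)} {z₀ : Z} (hp : FrameContAt b p z₀) (hq : FrameContAt b q z₀) :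
    ∃ a : Z → Spin n, ContinuousAt a z₀ ∧ ∀ z, SpinLifts (a z) ((p z).diff (q z)) :=
  Spin.exists_continuousAt_lift z₀ _ (continuousAt_diff hp hq) fun z => (p z).exists_lifts (q z)

end Frames

namespace ComplexBundle

/-! ### The image of a continuous family of idempotents -/

section Image

variable {X Y : Type*} [TopologicalSpace X] [TopologicalSpace Y] (G : ComplexBundle.{_, w} X)
  (b : Y → X) (P : ∀ y, G.Fib (b y) →ₗ[ℂ] G.Fib (b y))

/-- The family `P` in a chart. -/
def Chart.conj (χ : G.Chart) (y : Y) : Module.End ℂ (Fin χ.rank → ℂ) :=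
  χ.coord (b y) ∘ₗ P y ∘ₗ χ.sec (b y)

/-- A conjugation from the idempotent `P y` to the idempotent `Q`, if invertible. -/
def Chart.conjugator (χ : G.Chart) (Q : Module.End ℂ (Fin χ.rank → ℂ)) (y : Y) :
    Module.End ℂ (Fin χ.rank → ℂ) :=
  Q * χ.conj G b P y + (1 - Q) * (1 - χ.conj G b P y)

variable {G b P}

theorem Chart.conj_mul_conj (hP : ∀ y, P y ∘ₗ P y = P y) (χ : G.Chart) {y : Y}
    (hy : b y ∈ χ.dom) : χ.conj G b P y * χ.conj G b P y = χ.conj G b P y := by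
  refine LinearMap.ext fun v => ?_
  have := LinearMap.congr_fun (hP y) (χ.sec (b y) v)
  simp only [Module.End.mul_apply, conj, LinearMap.comp_apply] at this ⊢
  rw [χ.sec_coord _ hy, this]

/-- For `u = QP + (1 - Q)(1 - P)` both `uP` and `Qu` equal `QP`. Where `u` is invertible it thus
maps the image of `P` onto the fixed image of `Q`, which trivializes the image bundle. -/
theorem Chart.conjugator_mul (hP : ∀ y, P y ∘ₗ P y = P y) (χ : G.Chart)
    {Q : Module.End ℂ (Fin χ.rank → ℂ)} (hQ : Q * Q = Q) {y : Y} (hy : b y ∈ χ.dom) :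
    χ.conjugator G b P Q y * χ.conj G b P y = Q * χ.conjugator G b P Q y := by
  have h := χ.conj_mul_conj hP hy
  simp only [conjugator, add_mul, mul_add, mul_assoc, sub_mul, mul_sub, one_mul, mul_one, h]
  simp only [← mul_assoc, hQ]
  abel

theorem Chart.continuousAt_conj (χ : G.Chart) {y : Y} (hy : b y ∈ χ.dom)
    (hc : FamContAt G G b b P y) (v : Fin χ.rank → ℂ) :
    ContinuousAt (fun z => χ.conj G b P z v) y := hc χ χ hy hy v

theorem Chart.continuousAt_conjugator (χ : G.Chart) (Q : Module.End ℂ (Fin χ.rank → ℂ)) {y : Y}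
    (hy : b y ∈ χ.dom) (hc : FamContAt G G b b P y) (v : Fin χ.rank → ℂ) :
    ContinuousAt (fun z => χ.conjugator G b P Q z v) y := by
  have h := χ.continuousAt_conj hy hc v
  have hQ : ∀ T : Module.End ℂ (Fin χ.rank → ℂ), Continuous T := fun T =>
    LinearMap.continuous_of_finiteDimensional T
  exact ((hQ Q).continuousAt.comp h).add
    ((hQ (1 - Q)).continuousAt.comp (continuousAt_const.sub h))

theorem Chart.continuousAt_conjugator_inverse (χ : G.Chart) (Q : Module.End ℂ (Fin χ.rank → ℂ))
    {y : Y} (hy : b y ∈ χ.dom) (hc : FamContAt G G b b P y)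
    (hu : ∀ᶠ z in nhds y, IsUnit (χ.conjugator G b P Q z)) (v : Fin χ.rank → ℂ) :
    ContinuousAt (fun z => Ring.inverse (χ.conjugator G b P Q z) v) y := by
  refine continuousAt_inverse (χ.continuousAt_conjugator Q hy hc) ?_ ?_ v
  · filter_upwards [hu] with z hz using Ring.inverse_mul_cancel _ hz
  · filter_upwards [hu] with z hz using Ring.mul_inverse_cancel _ hz

/-- The determinant is continuous at `y`, so invertibility persists nearby. -/
theorem Chart.eventually_isUnit (χ : G.Chart) (Q : Module.End ℂ (Fin χ.rank → ℂ)) {y : Y}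
    (hy : b y ∈ χ.dom) (hc : FamContAt G G b b P y) (hu : IsUnit (χ.conjugator G b P Q y)) :
    ∀ᶠ z in nhds y, IsUnit (χ.conjugator G b P Q z) := by
  have hA : ContinuousAt (fun z => LinearMap.toMatrix' (χ.conjugator G b P Q z)) y :=
    continuousAt_pi.2 fun i => continuousAt_pi.2 fun j => by
      simp only [LinearMap.toMatrix'_apply]
      exact continuousAt_pi.1 (χ.continuousAt_conjugator Q hy hc _) i
  have hdet : ContinuousAt (fun z => LinearMap.det (χ.conjugator G b P Q z)) y := by
    simp only [← LinearMap.det_toMatrix']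
    exact (Continuous.matrix_det continuous_id).continuousAt.comp hA
  filter_upwards [hdet.eventually_ne (LinearMap.isUnit_iff_isUnit_det _ |>.1 hu).ne_zero] with z hz
  exact (LinearMap.isUnit_iff_isUnit_det _).2 (isUnit_iff_ne_zero.2 hz)

/-- Coordinates on the range of an idempotent. -/
def rangeEquiv {k : ℕ} (Q : Module.End ℂ (Fin k → ℂ)) :
    LinearMap.range Q ≃ₗ[ℂ] (Fin (Module.finrank ℂ (LinearMap.range Q)) → ℂ) :=
  (Module.finBasis ℂ (LinearMap.range Q)).equivFun

/-- The projection to the range of an idempotent in coordinates. -/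
def rangeProj {k : ℕ} (Q : Module.End ℂ (Fin k → ℂ)) :
    (Fin k → ℂ) →ₗ[ℂ] (Fin (Module.finrank ℂ (LinearMap.range Q)) → ℂ) :=
  (rangeEquiv Q).toLinearMap ∘ₗ Q.rangeRestrict

/-- The inclusion of the range of an idempotent in coordinates. -/
def rangeIncl {k : ℕ} (Q : Module.End ℂ (Fin k → ℂ)) :
    (Fin (Module.finrank ℂ (LinearMap.range Q)) → ℂ) →ₗ[ℂ] (Fin k → ℂ) :=
  (LinearMap.range Q).subtype ∘ₗ (rangeEquiv Q).symm.toLinearMap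

theorem rangeIncl_rangeProj {k : ℕ} (Q : Module.End ℂ (Fin k → ℂ)) (v : Fin k → ℂ) :
    rangeIncl Q (rangeProj Q v) = Q v := by
  simp [rangeIncl, rangeProj]

theorem rangeProj_rangeIncl {k : ℕ} {Q : Module.End ℂ (Fin k → ℂ)} (hQ : Q * Q = Q)
    (v : Fin (Module.finrank ℂ (LinearMap.range Q)) → ℂ) :
    rangeProj Q (rangeIncl Q v) = v := by
  obtain ⟨t, ht⟩ := ((rangeEquiv Q).symm v).2
  have : Q.rangeRestrict ((rangeEquiv Q).symm v) = (rangeEquiv Q).symm v := by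
    refine Subtype.ext ?_
    change Q _ = _
    rw [← ht, ← Module.End.mul_apply, hQ]
  simp only [rangeIncl, rangeProj, LinearMap.comp_apply, Submodule.subtype_apply,
    LinearEquiv.coe_coe, this, LinearEquiv.apply_symm_apply]

/-- The chart of the image of `P` defined by a chart of `G` and an idempotent near `P`. -/
def imageChartData (hb : Continuous b) (hP : ∀ y, P y ∘ₗ P y = P y)
    (hc : ∀ y, FamContAt G G b b P y)
    (i : Σ χ : G.Chart, {Q : Module.End ℂ (Fin χ.rank → ℂ) // Q * Q = Q}) :
    ChartData fun y => LinearMap.range (P y) where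
  rank := Module.finrank ℂ (LinearMap.range i.2.1)
  dom := {y | b y ∈ i.1.dom ∧ IsUnit (i.1.conjugator G b P i.2.1 y)}
  isOpen_dom := isOpen_iff_mem_nhds.2 fun y hy => by
    filter_upwards [i.1.eventually_mem hb.continuousAt hy.1,
      i.1.eventually_isUnit i.2.1 hy.1 (hc y) hy.2] with z h1 h2 using ⟨h1, h2⟩
  coord y := rangeProj i.2.1 ∘ₗ i.1.conjugator G b P i.2.1 y ∘ₗ i.1.coord (b y) ∘ₗ
    (LinearMap.range (P y)).subtype
  sec y := (P y).rangeRestrict ∘ₗ i.1.sec (b y) ∘ₗ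
    Ring.inverse (i.1.conjugator G b P i.2.1 y) ∘ₗ rangeIncl i.2.1
  coord_sec y hy v := by
    obtain ⟨χ, Q, hQ⟩ := i
    have h1 := χ.conjugator_mul hP hQ hy.1
    have h2 := Ring.mul_inverse_cancel _ hy.2
    -- With `u` the conjugator, `u P u⁻¹ = Q`, and `Q` is the identity on its own range.
    change rangeProj Q ((χ.conjugator G b P Q y * χ.conj G b P y)
      (Ring.inverse (χ.conjugator G b P Q y) (rangeIncl Q v))) = v
    rw [h1, ← Module.End.mul_apply, mul_assoc, h2, mul_one, ← rangeIncl_rangeProj,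
      rangeProj_rangeIncl hQ, rangeProj_rangeIncl hQ]
  sec_coord y hy e := by
    obtain ⟨χ, Q, hQ⟩ := i
    have h1 := χ.conjugator_mul hP hQ hy.1
    have h2 := Ring.inverse_mul_cancel _ hy.2
    obtain ⟨_, t, rfl⟩ := e
    refine Subtype.ext ?_
    change P y (χ.sec (b y) (Ring.inverse (χ.conjugator G b P Q y) (rangeIncl Q (rangeProj Q
      (χ.conjugator G b P Q y (χ.coord (b y) (P y t))))))) = P y t
    have h3 := LinearMap.congr_fun h2 (χ.conj G b P y (χ.coord (b y) (P y t)))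
    rw [rangeIncl_rangeProj, ← Module.End.mul_apply Q, ← h1, Module.End.mul_apply]
    rw [Module.End.mul_apply] at h3
    rw [h3]
    have h4 : ∀ t, P y (P y t) = P y t := LinearMap.congr_fun (hP y)
    simp only [Chart.conj, Module.End.one_apply, LinearMap.comp_apply]
    rw [χ.sec_coord _ hy.1, χ.sec_coord _ hy.1, h4, h4]

theorem continuousAt_imageChartData_sec (hb : Continuous b) (hP : ∀ y, P y ∘ₗ P y = P y)
    (hc : ∀ y, FamContAt G G b b P y)
    (i : Σ χ : G.Chart, {Q : Module.End ℂ (Fin χ.rank → ℂ) // Q * Q = Q})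
    {y : Y} (hy : y ∈ (imageChartData hb hP hc i).dom) (χ : G.Chart) (hχ : b y ∈ χ.dom)
    (v : Fin (imageChartData hb hP hc i).rank → ℂ) :
    ContinuousAt (fun z => χ.coord (b z) ((imageChartData hb hP hc i).sec z v : G.Fib (b z))) y :=
  continuousAt_apply_of_pointwise (T := fun z => χ.coord (b z) ∘ₗ P z ∘ₗ i.1.sec (b z))
    (hc y i.1 χ hy.1 hχ) (i.1.continuousAt_conjugator_inverse i.2.1 hy.1 (hc y)
      (i.1.eventually_isUnit i.2.1 hy.1 (hc y) hy.2) _)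

theorem continuousAt_imageChartData_coord (hb : Continuous b) (hP : ∀ y, P y ∘ₗ P y = P y)
    (hc : ∀ y, FamContAt G G b b P y)
    (i : Σ χ : G.Chart, {Q : Module.End ℂ (Fin χ.rank → ℂ) // Q * Q = Q})
    {y : Y} (hy : y ∈ (imageChartData hb hP hc i).dom)
    {e : ∀ z, LinearMap.range (P z)}
    (he : ContinuousAt (fun z => i.1.coord (b z) (e z : G.Fib (b z))) y) :
    ContinuousAt (fun z => (imageChartData hb hP hc i).coord z (e z)) y :=
  (LinearMap.continuous_of_finiteDimensional (rangeProj i.2.1)).continuousAt.comp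
    (continuousAt_apply_of_pointwise (i.1.continuousAt_conjugator i.2.1 hy.1 (hc y)) he)

theorem imageChartData_compatible (hb : Continuous b) (hP : ∀ y, P y ∘ₗ P y = P y)
    (hc : ∀ y, FamContAt G G b b P y)
    (i j : Σ χ : G.Chart, {Q : Module.End ℂ (Fin χ.rank → ℂ) // Q * Q = Q}) :
    (imageChartData hb hP hc i).Compatible (imageChartData hb hP hc j) := fun _ hy hy' v =>
  continuousAt_imageChartData_coord hb hP hc j hy'
    (continuousAt_imageChartData_sec hb hP hc i hy j.1 hy'.1 v)

/-- Take `Q` to be the value of `P` at the point itself; there the conjugator is `P² + (1 - P)² =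
1`. -/
theorem exists_mem_imageChartData (hb : Continuous b) (hP : ∀ y, P y ∘ₗ P y = P y)
    (hc : ∀ y, FamContAt G G b b P y) (y : Y) : ∃ i, y ∈ (imageChartData hb hP hc i).dom := by
  obtain ⟨χ, hχ⟩ := G.exists_chart (b y)
  have h := χ.conj_mul_conj hP hχ
  refine ⟨⟨χ, χ.conj G b P y, h⟩, hχ, ?_⟩
  change IsUnit (χ.conjugator G b P (χ.conj G b P y) y)
  have : χ.conjugator G b P (χ.conj G b P y) y = 1 := by
    simp only [Chart.conjugator, mul_sub, sub_mul, mul_one, one_mul, h]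
    abel
  rw [this]
  exact isUnit_one

/-- The bundle of the images of a continuous family of idempotents. -/
def imageBundle (hb : Continuous b) (hP : ∀ y, P y ∘ₗ P y = P y)
    (hc : ∀ y, FamContAt G G b b P y) : ComplexBundle.{_, w} Y :=
  ofCharts (imageChartData hb hP hc) (imageChartData_compatible hb hP hc)
    (exists_mem_imageChartData hb hP hc)

/-- Continuity of the inclusion and of the projection onto the image is all that is used later about
the topology of the image bundle. -/
theorem famContAt_subtype (hb : Continuous b) (hP : ∀ y, P y ∘ₗ P y = P y)
    (hc : ∀ y, FamContAt G G b b P y) (y : Y) :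
    FamContAt (imageBundle hb hP hc) G (fun y => y) b
      (fun y => (LinearMap.range (P y)).subtype) y := by
  obtain ⟨i, hi⟩ := exists_mem_imageChartData hb hP hc y
  exact FamContAt.of_chart continuousAt_id hb.continuousAt
    (ofChartsChart _ (imageChartData_compatible hb hP hc)
      (exists_mem_imageChartData hb hP hc) i) i.1 hi hi.1
    (continuousAt_imageChartData_sec hb hP hc i hi i.1 hi.1)

theorem famContAt_rangeRestrict (hb : Continuous b) (hP : ∀ y, P y ∘ₗ P y = P y)
    (hc : ∀ y, FamContAt G G b b P y) (y : Y) :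
    FamContAt G (imageBundle hb hP hc) b (fun y => y) (fun y => (P y).rangeRestrict) y := by
  obtain ⟨i, hi⟩ := exists_mem_imageChartData hb hP hc y
  exact FamContAt.of_chart hb.continuousAt continuousAt_id i.1
    (ofChartsChart _ (imageChartData_compatible hb hP hc)
      (exists_mem_imageChartData hb hP hc) i) hi.1 hi
    fun v => continuousAt_imageChartData_coord hb hP hc i hi
      (i.1.continuousAt_conj hi.1 (hc y) v)

end Image

end ComplexBundle

open ComplexBundle

/-! ### The action of `End S` on Clifford modules. -/

section CliffordAction

variable {M : Type u} [TopologicalSpace M] {n : ℕ} {V : M → Type v}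
  [∀ x, NormedAddCommGroup (V x)] [∀ x, InnerProductSpace ℝ (V x)]
  [TopologicalSpace (TotalSpace (Model n) V)]
  {o : ∀ x, Orientation ℝ (V x) (Fin (2 * n))}

theorem ClTotal.continuous_base : Continuous (ClTotal.base : ClTotal V o → M) :=
  continuous_coinduced_dom.2 (FrameBundle.continuous_base.comp continuous_fst)

namespace CliffordModule

variable (S : SpinorRep.{w} n) (E : CliffordModule.{u, v, w} V o)

/-- The action of `End S ≅ Cl(ℝ²ⁿ) ⊗ ℂ` on the fibre `E_x` defined by a frame of `V_x`. -/
def op {x : M} (p : FrameAt V o x) : Module.End ℂ S.S →ₐ[ℂ] Module.End ℂ (E.Fib x) :=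
  S.lift ((E.cl x).comp (cliffordMap p.1))

theorem op_ρ {x : M} (p : FrameAt V o x) (c : ModelCl n) :
    E.op S p (S.ρ c) = E.cl x (cliffordMap p.1 c) := S.lift_ρ _ _

theorem cl_eq_op {x : M} (p : FrameAt V o x) (c : ClFib V x) :
    E.cl x c = E.op S p (S.ρ (cliffordMap p.1.symm c)) := by
  rw [op_ρ, cliffordMap_apply_symm]

theorem ρ_inv_mul (a : Spin n) : S.ρ ((a⁻¹ : Spin n) : ModelCl n) * S.ρ a = 1 := by
  rw [← map_mul, Spin.inv_mul_coe, map_one]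

/-- The actions defined by two frames. -/
theorem op_change {x : M} {p q : FrameAt V o x} {a : Spin n} (h : SpinLifts a (p.diff q))
    (T : Module.End ℂ S.S) :
    E.op S q T = E.op S p (S.ρ a * T * S.ρ ((a⁻¹ : Spin n) : ModelCl n)) := by
  induction T using S.end_induction with
  | hρ c =>
    rw [op_ρ, ← map_mul S.ρ, ← map_mul S.ρ, h.conj, op_ρ, FrameAt.cliffordMap_diff]
  | h0 => simp
  | hadd T T' h h' => rw [map_add, h, h', ← map_add, mul_add, add_mul]
  | hsmul z T h => rw [map_smul, h, ← map_smul, mul_smul_comm, smul_mul_assoc]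

variable {E} in
theorem hom_op {F : CliffordModule.{u, v, w} V o} {x : M} (f : E.Fib x →ₗ[ℂ] F.Fib x)
    (hf : ∀ c e, f (E.cl x c e) = F.cl x c (f e)) (p : FrameAt V o x) (T : Module.End ℂ S.S)
    (e : E.Fib x) : f (E.op S p T e) = F.op S p T (f e) := by
  induction T using S.end_induction with
  | hρ c => rw [op_ρ, op_ρ, hf]
  | h0 => simp
  | hadd T T' h h' => simp only [map_add, LinearMap.add_apply, h, h']
  | hsmul z T h => simp only [map_smul, LinearMap.smul_apply, h]

variable {Z : Type*} [TopologicalSpace Z] {b : Z → M} {z₀ : Z}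

theorem famContAt_cl {c : ∀ z, ClFib V (b z)}
    (hc : ContinuousAt (fun z => (⟨b z, c z⟩ : ClTotal V o)) z₀) :
    FamContAt E.toComplexBundle E.toComplexBundle b b (fun z => E.cl (b z) (c z)) z₀ := by
  have h := (continuous_pullback_iff (E := E.toComplexBundle) (F := E.toComplexBundle)
    (f := fun c : ClTotal V o => E.cl c.base c.val)
    ClTotal.continuous_base ClTotal.continuous_base).1 E.continuous_cl
  exact FamContAt.restrict (h := fun z => (⟨b z, c z⟩ : ClTotal V o)) (h ⟨b z₀, c z₀⟩) hc

/-- For a fixed Clifford element `c`, a continuous family of frames gives a continuous family in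
`Cl(V)`, by definition of the quotient topology. General endomorphisms are complex combinations of
these. -/
theorem famContAt_op {p : ∀ z, FrameAt V o (b z)} (hp : FrameContAt b p z₀)
    (T : Module.End ℂ S.S) :
    FamContAt E.toComplexBundle E.toComplexBundle b b (fun z => E.op S (p z) T) z₀ := by
  induction T using S.end_induction with
  | hρ c =>
    simp only [op_ρ]
    refine E.famContAt_cl ?_
    have h : Continuous (clQuot V o) := continuous_coinduced_rng
    exact ContinuousAt.comp (f := fun z => ((⟨b z, p z⟩ : FrameBundle V o), c))
      h.continuousAt (hp.prodMk continuousAt_const)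
  | h0 => simp only [map_zero]; exact FamContAt.zero
  | hadd T T' h h' => simp only [map_add]; exact h.add h'
  | hsmul z T h => simp only [map_smul]; exact h.smul continuousAt_const

/-- The action of endomorphisms which depend continuously on the parameter. -/
theorem famContAt_op_family {p : ∀ z, FrameAt V o (b z)} (hp : FrameContAt b p z₀)
    {T : Z → Module.End ℂ S.S}
    (hT : ∀ ℓ : Module.Dual ℂ (Module.End ℂ S.S), ContinuousAt (fun z => ℓ (T z)) z₀) :
    FamContAt E.toComplexBundle E.toComplexBundle b b (fun z => E.op S (p z) (T z)) z₀ := by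
  let B := Module.finBasis ℂ (Module.End ℂ S.S)
  have h : ∀ z, E.op S (p z) (T z) = ∑ i, B.coord i (T z) • E.op S (p z) (B i) := fun z => by
    conv_lhs => rw [← B.sum_repr (T z), map_sum]
    simp
  simp only [h]
  exact FamContAt.sum _ fun i _ => (E.famContAt_op S hp (B i)).smul (hT _)

end CliffordModule

/-! ### The spinor functor -/

namespace SpinorRep

variable (S : SpinorRep.{w} n)

/-- A nonzero spinor. -/
def vec : S.S := S.exists_pairing.choose.1

/-- A functional with value `1` on `S.vec`. -/
def covec : Module.Dual ℂ S.S := S.exists_pairing.choose.2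

theorem covec_vec : S.covec S.vec = 1 := S.exists_pairing.choose_spec

/-- A rank one idempotent. -/
def idem : Module.End ℂ S.S := S.rankOne S.vec S.covec

/-- The linear map `σ ↦ s ⊗ σ`. -/
def rankOneₗ : Module.Dual ℂ S.S →ₗ[ℂ] Module.End ℂ S.S where
  toFun := S.rankOne S.vec
  map_add' σ τ := LinearMap.ext fun t => add_smul (σ t) (τ t) S.vec
  map_smul' z σ := LinearMap.ext fun t => mul_smul z (σ t) S.vec

theorem idem_mul_rankOne (σ : Module.Dual ℂ S.S) :
    S.idem * S.rankOne S.vec σ = S.rankOne S.vec σ := by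
  rw [idem, rankOne_mul, covec_vec, one_smul]

theorem idem_mul_idem : S.idem * S.idem = S.idem := S.idem_mul_rankOne _

/-- The contragredient of the spin representation of `Spinᶜ(2n)`. -/
def spinInv (c : SpinC n) : Module.End ℂ S.S :=
  Quotient.liftOn' c (fun p => (p.2 : ℂ) • S.ρ ((p.1⁻¹ : Spin n) : ModelCl n)) <| by
    rintro ⟨a, z⟩ ⟨b, y⟩ h
    rw [QuotientGroup.leftRel_apply] at h
    -- The two elements of the sign subgroup are treated together as `(ε, ε)` with `ε² = 1`; the
    -- signs on the two factors cancel.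
    have key : ∀ ε : ℝ, ((a⁻¹ * b : Spin n) : ModelCl n) = ε • 1 → ((z⁻¹ * y : Circle) : ℂ) = ε →
        ε * ε = 1 → (z : ℂ) • S.ρ ((a⁻¹ : Spin n) : ModelCl n) =
          (y : ℂ) • S.ρ ((b⁻¹ : Spin n) : ModelCl n) := by
      intro ε h1 h2 hε
      have hb : (b : ModelCl n) = ε • (a : ModelCl n) := by
        rw [← mul_one (a : ModelCl n), ← mul_smul_comm, ← h1, ← Submonoid.coe_mul,
          mul_inv_cancel_left]
      have hy : (y : ℂ) = z * ε := by rw [← h2, ← Circle.coe_mul, mul_inv_cancel_left]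
      rw [Spin.coe_inv b, hb, CliffordAlgebra.star_smul, map_smul, hy, Spin.coe_inv a,
        ← Complex.coe_smul ε, smul_smul, mul_assoc, ← Complex.ofReal_mul, hε, Complex.ofReal_one,
        mul_one]
    rcases h with ⟨h1, h2⟩ | ⟨h1, h2⟩
    · exact key 1 (by rw [one_smul]; exact h1) (by rw [Complex.ofReal_one]; exact h2) (one_mul 1)
    · exact key (-1) (by rw [neg_smul, one_smul]; exact h1)
        (by rw [Complex.ofReal_neg, Complex.ofReal_one]; exact h2) (by norm_num)

theorem spinInv_mk (a : Spin n) (z : Circle) :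
    S.spinInv (SpinC.mk a z) = (z : ℂ) • S.ρ ((a⁻¹ : Spin n) : ModelCl n) := rfl

theorem SpinC_induction {P : SpinC n → Prop} (h : ∀ a z, P (SpinC.mk a z)) (c : SpinC n) : P c :=
  QuotientGroup.induction_on c fun p => h p.1 p.2

/-- The order is reversed because the group acts on `S*` by precomposition with `a⁻¹`. -/
theorem spinInv_mul (c d : SpinC n) : S.spinInv (c * d) = S.spinInv d * S.spinInv c := by
  induction c using SpinC_induction with
  | h a z =>
    induction d using SpinC_induction with
    | h b y =>
      change S.spinInv (SpinC.mk (a * b) (z * y)) = _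
      rw [spinInv_mk, spinInv_mk, spinInv_mk, mul_inv_rev, Submonoid.coe_mul, map_mul,
        smul_mul_smul_comm, Circle.coe_mul, mul_comm (y : ℂ)]

theorem spinInv_one : S.spinInv 1 = 1 := by
  change S.spinInv (SpinC.mk 1 1) = 1
  rw [spinInv_mk]
  simp

theorem spinInv_phase (z : Circle) (c : SpinC n) :
    S.spinInv (SpinC.mk 1 z * c) = (z : ℂ) • S.spinInv c := by
  rw [spinInv_mul, spinInv_mk, inv_one, Submonoid.coe_one, map_one, mul_smul_comm, mul_one]

theorem continuous_spinInv (ℓ : Module.Dual ℂ (Module.End ℂ S.S)) :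
    Continuous fun c => ℓ (S.spinInv c) := by
  let f : ModelCl n →ₗ[ℝ] ℂ := ℓ.restrictScalars ℝ ∘ₗ S.ρ.toLinearMap
  have hf : Continuous f := IsModuleTopology.continuous_of_linearMap f
  have h : Continuous fun p : Spin n × Circle =>
      (p.2 : ℂ) * f (star (p.1 : ModelCl n)) :=
    ((continuous_subtype_val : Continuous fun z : Circle => (z : ℂ)).comp continuous_snd).mul
      (hf.comp (continuous_star_modelCl.comp (continuous_subtype_val.comp continuous_fst)))
  refine continuous_coinduced_dom.2 ?_
  convert h using 2 with p
  change ℓ (S.spinInv (SpinC.mk p.1 p.2)) = _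
  rw [spinInv_mk, map_smul, Spin.coe_inv]
  rfl

end SpinorRep

namespace LiftingGerbe

theorem continuous_tgt : Continuous (LiftingGerbe.tgt : LiftingGerbe V o → FrameBundle V o) :=
  continuous_iff_continuousAt.2 fun _ =>
    ((Topology.IsInducing.induced _).continuousAt_iff.1 continuousAt_id).fst

theorem continuous_src : Continuous (LiftingGerbe.src : LiftingGerbe V o → FrameBundle V o) :=
  continuous_iff_continuousAt.2 fun _ =>
    ((Topology.IsInducing.induced _).continuousAt_iff.1 continuousAt_id).snd.fst

theorem continuous_arrow : Continuous fun γ : LiftingGerbe V o => γ.arrow.1 :=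
  continuous_iff_continuousAt.2 fun _ =>
    ((Topology.IsInducing.induced _).continuousAt_iff.1 continuousAt_id).snd.snd

end LiftingGerbe

namespace CliffordModule

variable (S : SpinorRep.{w} n) (E : CliffordModule.{u, v, w} V o)

theorem op_idem {x : M} (p : FrameAt V o x) :
    E.op S p S.idem ∘ₗ E.op S p S.idem = E.op S p S.idem := by
  rw [← Module.End.mul_eq_comp, ← map_mul, S.idem_mul_idem]

/-- The vector bundle underlying the gerbe module of a Clifford module: its fibre over a frame
is the image of a rank one idempotent, which is isomorphic to `S* ⊗_{Cl(V_x)} E_x`. -/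
def spinorBundle : ComplexBundle.{max u v, w} (FrameBundle V o) :=
  imageBundle (G := E.toComplexBundle) (b := FrameBundle.base)
    (P := fun y => E.op S y.frame S.idem) FrameBundle.continuous_base
    (fun y => E.op_idem S y.frame) fun _ => E.famContAt_op S continuousAt_id S.idem

/-- The inclusion of the spinor bundle. -/
def spinorIncl (y : FrameBundle V o) : (E.spinorBundle S).Fib y →ₗ[ℂ] E.Fib y.base :=
  (LinearMap.range (E.op S y.frame S.idem)).subtype

theorem spinorIncl_injective (y : FrameBundle V o) : Function.Injective (E.spinorIncl S y) :=
  Subtype.val_injective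

theorem mem_range_idem {x : M} (p : FrameAt V o x) {e : E.Fib x} :
    e ∈ LinearMap.range (E.op S p S.idem) ↔ E.op S p S.idem e = e := by
  refine ⟨?_, fun h => ⟨e, h⟩⟩
  rintro ⟨t, rfl⟩
  exact LinearMap.congr_fun (E.op_idem S p) t

theorem op_op {x : M} (p : FrameAt V o x) (T T' : Module.End ℂ S.S) (e : E.Fib x) :
    E.op S p T (E.op S p T' e) = E.op S p (T * T') e := by
  rw [map_mul]; rfl

/-- For `c = [a, z]`, rewriting `T` from the frame `q` to the frame `p` gives `a T a⁻¹`, and `z a⁻¹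
(a T a⁻¹) = T (z a⁻¹)`. With `T = idem` this shows that the arrow carries the spinor fibre over `q`
to the one over `p`. -/
theorem op_spinInv_op {x : M} {p q : FrameAt V o x} {c : SpinC n} (hc : c.Covers (p.diff q))
    (T : Module.End ℂ S.S) (e : E.Fib x) :
    E.op S p (S.spinInv c) (E.op S q T e) = E.op S p (T * S.spinInv c) e := by
  obtain ⟨a, z, rfl, ha⟩ := hc
  rw [E.op_change S ha, op_op, S.spinInv_mk, mul_smul_comm, smul_mul_assoc, ← mul_assoc,
    ← mul_assoc, ρ_inv_mul, one_mul]

/-- The same computation for the inverse arrow, `(a T a⁻¹)(z⁻¹ a) = (z⁻¹ a) T`, still in the target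
frame `p`. -/
theorem op_op_spinInv_inv {x : M} {p q : FrameAt V o x} {c : SpinC n} (hc : c.Covers (p.diff q))
    (T : Module.End ℂ S.S) (e : E.Fib x) :
    E.op S q T (E.op S p (S.spinInv c⁻¹) e) = E.op S p (S.spinInv c⁻¹ * T) e := by
  obtain ⟨a, z, rfl, ha⟩ := hc
  change E.op S q T (E.op S p (S.spinInv (SpinC.mk a⁻¹ z⁻¹)) e) =
    E.op S p (S.spinInv (SpinC.mk a⁻¹ z⁻¹) * T) e
  rw [E.op_change S ha, op_op, S.spinInv_mk, inv_inv, mul_smul_comm, smul_mul_assoc, mul_assoc,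
    ρ_inv_mul, mul_one]

theorem op_spinInv_cancel {x : M} (p : FrameAt V o x) {c d : SpinC n} (h : d * c = 1)
    (e : E.Fib x) : E.op S p (S.spinInv c) (E.op S p (S.spinInv d) e) = e := by
  rw [op_op, ← S.spinInv_mul, h, S.spinInv_one, map_one]; rfl

/-- The action of an arrow of the bundle gerbe on the fibres of the spinor bundle. -/
def spinorAct (γ : LiftingGerbe V o) : (E.spinorBundle S).Fib γ.src ≃ₗ[ℂ]
    (E.spinorBundle S).Fib γ.tgt :=
  LinearEquiv.ofLinearMap
    ((E.op S γ.left (S.spinInv γ.arrow.1)).restrict (p := LinearMap.range (E.op S γ.right S.idem))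
      (q := LinearMap.range (E.op S γ.left S.idem)) (by
        rintro _ ⟨t, rfl⟩
        rw [E.op_spinInv_op S γ.arrow.2, ← op_op]
        exact ⟨_, rfl⟩))
    ((E.op S γ.left (S.spinInv γ.arrow.1⁻¹)).restrict
      (p := LinearMap.range (E.op S γ.left S.idem))
      (q := LinearMap.range (E.op S γ.right S.idem)) (by
        rintro _ ⟨t, rfl⟩
        rw [op_op, ← E.op_op_spinInv_inv S γ.arrow.2]
        exact ⟨_, rfl⟩))
    (LinearMap.ext fun e => Subtype.ext (by
      exact E.op_spinInv_cancel S γ.left (inv_mul_cancel _) (E.spinorIncl S γ.tgt e)))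
    (LinearMap.ext fun e => Subtype.ext (by
      exact E.op_spinInv_cancel S γ.left (mul_inv_cancel _) (E.spinorIncl S γ.src e)))

/-- A map into the spinor bundle is continuous if its composition with the inclusion is. -/
theorem famContAt_spinorBundle {X Z : Type*} [TopologicalSpace X] [TopologicalSpace Z]
    {G : ComplexBundle.{_, w} X} {b : Z → X} {y : Z → FrameBundle V o} {z₀ : Z}
    (hy : ContinuousAt y z₀)
    {f : ∀ z, G.Fib (b z) →ₗ[ℂ] (E.spinorBundle S).Fib (y z)}
    (hf : FamContAt G E.toComplexBundle b (fun z => (y z).base)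
      (fun z => E.spinorIncl S (y z) ∘ₗ f z) z₀) :
    FamContAt G (E.spinorBundle S) b y f z₀ := by
  have h1 := (famContAt_rangeRestrict (G := E.toComplexBundle) (b := FrameBundle.base)
    (P := fun y => E.op S y.frame S.idem) FrameBundle.continuous_base
    (fun y => E.op_idem S y.frame) (fun _ => E.famContAt_op S continuousAt_id S.idem)
    (y z₀)).restrict hy
  -- Projecting after including changes nothing, because the idempotent is the identity on its
  -- image.
  refine (h1.comp hf (FrameBundle.continuous_base.continuousAt.comp hy)).congr ?_
  refine Filter.Eventually.of_forall fun z => LinearMap.ext fun e => Subtype.ext ?_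
  exact (E.mem_range_idem S (y z).frame).1 (f z e).2

/-- The inclusion of the spinor bundle is continuous. -/
theorem famContAt_spinorIncl {Z : Type*} [TopologicalSpace Z]
    {y : Z → FrameBundle V o} {z₀ : Z} (hy : ContinuousAt y z₀) :
    FamContAt (E.spinorBundle S) E.toComplexBundle y (fun z => (y z).base)
      (fun z => E.spinorIncl S (y z)) z₀ :=
  (famContAt_subtype (G := E.toComplexBundle) (b := FrameBundle.base)
    (P := fun y => E.op S y.frame S.idem) FrameBundle.continuous_base
    (fun y => E.op_idem S y.frame) (fun _ => E.famContAt_op S continuousAt_id S.idem)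
    (y z₀)).restrict hy

/-- The gerbe module of a Clifford module. -/
def spinorModule : GerbeModule.{u, v, w} V o where
  toComplexBundle := E.spinorBundle S
  act := E.spinorAct S
  continuous_act := by
    refine (continuous_pullback_iff (f := fun γ => (E.spinorAct S γ).toLinearMap)
      LiftingGerbe.continuous_src LiftingGerbe.continuous_tgt).2 fun γ => ?_
    refine E.famContAt_spinorBundle S LiftingGerbe.continuous_tgt.continuousAt ?_
    exact (E.famContAt_op_family S (p := fun γ : LiftingGerbe V o => γ.left)
      LiftingGerbe.continuous_tgt.continuousAt fun ℓ =>
        (S.continuous_spinInv ℓ).continuousAt.comp LiftingGerbe.continuous_arrow.continuousAt).comp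
      (E.famContAt_spinorIncl S LiftingGerbe.continuous_src.continuousAt)
      (FrameBundle.continuous_base.comp LiftingGerbe.continuous_src).continuousAt
  act_mul x p q r g h e := Subtype.ext (by
    change E.op S p (S.spinInv g.1) (E.op S q (S.spinInv h.1) (E.spinorIncl S ⟨x, r⟩ e)) =
      E.op S p (S.spinInv (g.1 * h.1)) (E.spinorIncl S ⟨x, r⟩ e)
    rw [E.op_spinInv_op S g.2, S.spinInv_mul])
  act_phase x p q g z e := Subtype.ext (by
    change E.op S p (S.spinInv (SpinC.mk 1 z * g.1)) (E.spinorIncl S ⟨x, q⟩ e) =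
      (z : ℂ) • E.op S p (S.spinInv g.1) (E.spinorIncl S ⟨x, q⟩ e)
    rw [S.spinInv_phase, map_smul]; rfl)

variable {E} in
/-- The map of spinor bundles induced by a morphism of Clifford modules. -/
def spinorMap {F : CliffordModule.{u, v, w} V o} (f : E ⟶ F) :
    E.spinorModule S ⟶ F.spinorModule S :=
  ⟨fun y => (f.1 y.base).restrict (p := LinearMap.range (E.op S y.frame S.idem))
      (q := LinearMap.range (F.op S y.frame S.idem)) (by
        rintro _ ⟨t, rfl⟩
        rw [hom_op S _ (f.2.2 _)]
        exact ⟨_, rfl⟩), by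
    refine continuous_totalMap_iff.2 fun y => ?_
    refine F.famContAt_spinorBundle S continuousAt_id ?_
    exact ((continuous_totalMap_iff.1 f.2.1 y.base).restrict
      FrameBundle.continuous_base.continuousAt).comp
      (E.famContAt_spinorIncl S continuousAt_id)
      FrameBundle.continuous_base.continuousAt, fun γ e => Subtype.ext (by
    exact hom_op S _ (f.2.2 _) _ _ _)⟩

/-- The functor from Clifford modules to gerbe modules. -/
def spinorFunctor : CliffordModule.{u, v, w} V o ⥤ GerbeModule.{u, v, w} V o where
  obj E := E.spinorModule S
  map f := spinorMap S f
  map_id _ := rfl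
  map_comp _ _ := rfl

instance : (spinorFunctor (V := V) (o := o) S).Additive where
  map_add := rfl

/-- The map `σ ⊗ e ↦ (s ⊗ σ) e` to the fibre of the spinor bundle. -/
def tensorToFib (y : FrameBundle V o) : SpinorTensor S E y →ₗ[ℂ] (E.spinorBundle S).Fib y :=
  (balanced S E y).liftQ
    ((E.op S y.frame S.idem).rangeRestrict ∘ₗ
      TensorProduct.lift ((E.op S y.frame).toLinearMap ∘ₗ S.rankOneₗ)) <| by
    refine Submodule.span_le.2 ?_
    rintro _ ⟨σ, c, e, rfl⟩
    rw [SetLike.mem_coe, LinearMap.mem_ker, map_sub, sub_eq_zero]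
    refine congrArg (E.op S y.frame S.idem).rangeRestrict ?_
    change E.op S y.frame (S.rankOne S.vec (dualMul S y.frame c σ)) e =
      E.op S y.frame (S.rankOne S.vec σ) (E.cl y.base c e)
    rw [E.cl_eq_op S y.frame, op_op, S.rankOne_mul_end]; rfl

theorem spinorIncl_tensorToFib (y : FrameBundle V o) (σ : Module.Dual ℂ S.S) (e : E.Fib y.base) :
    E.spinorIncl S y (E.tensorToFib S y (.mk S E y σ e)) =
      E.op S y.frame (S.rankOne S.vec σ) e := by
  change E.op S y.frame S.idem (E.op S y.frame (S.rankOne S.vec σ) e) = _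
  rw [op_op, S.idem_mul_rankOne]

theorem mk_add_left (y : FrameBundle V o) (σ τ : Module.Dual ℂ S.S) (e : E.Fib y.base) :
    SpinorTensor.mk S E y (σ + τ) e = .mk S E y σ e + .mk S E y τ e := by
  simp only [SpinorTensor.mk, TensorProduct.add_tmul, map_add]

/-- The tensor product is balanced over `Cl(V_x)`, and by linearity over its complex span `End S`.
-/
theorem mk_op (y : FrameBundle V o) (σ : Module.Dual ℂ S.S) (T : Module.End ℂ S.S)
    (e : E.Fib y.base) :
    SpinorTensor.mk S E y σ (E.op S y.frame T e) = .mk S E y (σ ∘ₗ T) e := by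
  induction T using S.end_induction with
  | hρ c =>
    have h : dualMul S y.frame (cliffordMap y.frame.1 c) σ ⊗ₜ[ℂ] e -
        σ ⊗ₜ[ℂ] E.cl y.base (cliffordMap y.frame.1 c) e ∈ balanced S E y :=
      Submodule.subset_span ⟨σ, _, e, rfl⟩
    have h' := (Submodule.Quotient.eq _).2 h
    rw [dualMul, cliffordMap_symm_apply] at h'
    rw [op_ρ]
    exact h'.symm
  | h0 => simp [SpinorTensor.mk]
  | hadd T T' h h' =>
    rw [LinearMap.comp_add, mk_add_left, ← h, ← h']
    simp only [SpinorTensor.mk, map_add, LinearMap.add_apply, TensorProduct.tmul_add]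
  | hsmul z T h =>
    simp only [SpinorTensor.mk, map_smul, LinearMap.smul_apply, TensorProduct.tmul_smul,
      LinearMap.comp_smul, ← TensorProduct.smul_tmul'] at h ⊢
    rw [h]

/-- The map `e ↦ σ ⊗ e` to the spinor bundle. -/
def spinorProj (y : FrameBundle V o) (σ : Module.Dual ℂ S.S) :
    E.Fib y.base →ₗ[ℂ] (E.spinorBundle S).Fib y :=
  E.tensorToFib S y ∘ₗ (balanced S E y).mkQ ∘ₗ TensorProduct.mk ℂ _ _ σ

theorem spinorIncl_proj (y : FrameBundle V o) (σ : Module.Dual ℂ S.S) (e : E.Fib y.base) :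
    E.spinorIncl S y (E.spinorProj S y σ e) = E.op S y.frame (S.rankOne S.vec σ) e :=
  E.spinorIncl_tensorToFib S y σ e

theorem famContAt_spinorProj {Z : Type*} [TopologicalSpace Z] {y : Z → FrameBundle V o} {z₀ : Z}
    (hy : ContinuousAt y z₀) (σ : Module.Dual ℂ S.S) :
    FamContAt E.toComplexBundle (E.spinorBundle S) (fun z => (y z).base) y
      (fun z => E.spinorProj S (y z) σ) z₀ := by
  refine E.famContAt_spinorBundle S hy ?_
  refine (E.famContAt_op S (p := fun z => (y z).frame) hy
    (S.rankOne S.vec σ)).congr (Filter.Eventually.of_forall fun y => LinearMap.ext fun e => ?_)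
  exact (E.spinorIncl_tensorToFib S _ σ e).symm

/-- The fibre of the spinor bundle is `S* ⊗_{Cl(V_x)} E_x`. -/
def tensorEquiv (y : FrameBundle V o) : SpinorTensor S E y ≃ₗ[ℂ] (E.spinorBundle S).Fib y :=
  LinearEquiv.ofLinearMap (E.tensorToFib S y)
    -- The inverse is `e ↦ covec ⊗ e`: moving `vec ⊗ σ` across the tensor sign gives `covec ⊗ (vec ⊗
    -- σ) e = covec(vec) σ ⊗ e = σ ⊗ e`.
    ((balanced S E y).mkQ ∘ₗ TensorProduct.mk ℂ _ _ S.covec ∘ₗ E.spinorIncl S y)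
    (LinearMap.ext fun e => E.spinorIncl_injective S y <|
      (E.spinorIncl_tensorToFib S y _ _).trans ((E.mem_range_idem S y.frame).1 e.2))
    (Submodule.linearMap_qext _ (TensorProduct.ext' fun σ e => by
      change SpinorTensor.mk S E y S.covec
        (E.spinorIncl S y (E.tensorToFib S y (.mk S E y σ e))) = .mk S E y σ e
      rw [spinorIncl_tensorToFib, mk_op]
      congr 1
      refine LinearMap.ext fun t => ?_
      simp [SpinorRep.rankOne_apply, S.covec_vec]))

theorem isSpinorTensorFunctor : IsSpinorTensorFunctor (V := V) (o := o) S (spinorFunctor S) := by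
  refine ⟨fun E y => E.tensorEquiv S y, fun E F f y σ e => ?_, fun E γ a z h σ e => ?_,
    fun E σ => ?_⟩
  · refine F.spinorIncl_injective S y ?_
    exact (congrArg (f.1 y.base) (E.spinorIncl_tensorToFib S y σ e)).trans
      ((hom_op S _ (f.2.2 _) _ _ _).trans (F.spinorIncl_tensorToFib S y σ _).symm)
  · refine E.spinorIncl_injective S γ.tgt ?_
    refine (congrArg (E.op S γ.left (S.spinInv γ.arrow.1))
      (E.spinorIncl_tensorToFib S γ.src σ e)).trans
      (Eq.trans ?_ (E.spinorIncl_tensorToFib S γ.tgt _ e).symm)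
    refine (E.op_spinInv_op S γ.arrow.2 _ _).trans ?_
    rw [h, S.spinInv_mk, S.rankOne_mul_end, dualSpin, LinearMap.comp_smul]; rfl
  · exact (continuous_pullback_iff (F := E.spinorBundle S) (f := fun y => E.spinorProj S y σ)
      FrameBundle.continuous_base continuous_id).2
      fun y => E.famContAt_spinorProj S continuousAt_id σ

end CliffordModule

end CliffordAction

/-! ### The spinor functor is fully faithful -/

theorem SpinorRep.coord_comp {n : ℕ} (S : SpinorRep.{w} n) (σ : Module.Dual ℂ S.S) :
    ∑ k, σ (S.basis k) • S.basis.coord k = σ :=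
  LinearMap.ext fun t => by
    conv_rhs => rw [← S.basis.sum_repr t, map_sum]
    rw [LinearMap.sum_apply]
    exact Finset.sum_congr rfl fun i _ =>
      (mul_comm _ _).trans (map_smul σ (S.basis.repr t i) (S.basis i)).symm

/-- Both sides come from the element of `S ⊗ S*` that corresponds to `T`. Thus `T` can be moved from
the dual basis to the basis, which makes `extendMap` linear over `End S`. -/
theorem SpinorRep.sum_basis_comp {n : ℕ} (S : SpinorRep.{w} n) {G : Type*} [AddCommGroup G]
    [Module ℂ G] (B : S.S →ₗ[ℂ] Module.Dual ℂ S.S →ₗ[ℂ] G) (T : Module.End ℂ S.S) :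
    ∑ j, B (S.basis j) (S.basis.coord j ∘ₗ T) = ∑ j, B (T (S.basis j)) (S.basis.coord j) := by
  have h1 : ∀ j, B (S.basis j) (S.basis.coord j ∘ₗ T) =
      ∑ k, S.basis.coord j (T (S.basis k)) • B (S.basis j) (S.basis.coord k) := fun j => by
    conv_lhs => rw [← S.coord_comp (S.basis.coord j ∘ₗ T), map_sum]
    simp
  have h2 : ∀ k, B (T (S.basis k)) (S.basis.coord k) =
      ∑ j, S.basis.coord j (T (S.basis k)) • B (S.basis j) (S.basis.coord k) := fun k => by
    conv_lhs => rw [← S.basis.sum_repr (T (S.basis k)), map_sum]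
    simp [LinearMap.sum_apply]
  simp only [h1, h2]
  exact Finset.sum_comm

namespace CliffordModule

section FullyFaithful

variable {M : Type u} [TopologicalSpace M] {n : ℕ} {V : M → Type v}
  [∀ x, NormedAddCommGroup (V x)] [∀ x, InnerProductSpace ℝ (V x)]
  [TopologicalSpace (TotalSpace (Model n) V)]
  {o : ∀ x, Orientation ℝ (V x) (Fin (2 * n))}
  (S : SpinorRep.{w} n) {E F : CliffordModule.{u, v, w} V o}

theorem spinorProj_op (y : FrameBundle V o) (σ : Module.Dual ℂ S.S) (T : Module.End ℂ S.S)
    (e : E.Fib y.base) :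
    E.spinorProj S y σ (E.op S y.frame T e) = E.spinorProj S y (σ ∘ₗ T) e :=
  congrArg (E.tensorToFib S y) (E.mk_op S y σ T e)

theorem spinorProj_incl (y : FrameBundle V o) (σ : Module.Dual ℂ S.S)
    (t : (E.spinorBundle S).Fib y) : E.spinorProj S y σ (E.spinorIncl S y t) = σ S.vec • t := by
  refine E.spinorIncl_injective S y ?_
  have h : E.op S y.frame S.idem (E.spinorIncl S y t) = E.spinorIncl S y t :=
    (E.mem_range_idem S y.frame).1 t.2
  rw [spinorIncl_proj, map_smul, ← h, op_op, SpinorRep.idem, S.rankOne_mul]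
  simp

/-- Since `covec vec = 1`, the identity of `S` is `∑ (b_j ⊗ covec)(vec ⊗ b^j)`. Applied to `E_x`,
this rebuilds every vector from its spinor components. -/
theorem sum_op_proj (y : FrameBundle V o) (e : E.Fib y.base) :
    ∑ j, E.op S y.frame (S.rankOne (S.basis j) S.covec)
      (E.spinorIncl S y (E.spinorProj S y (S.basis.coord j) e)) = e := by
  simp only [spinorIncl_proj, op_op, S.rankOne_mul, S.covec_vec, one_smul]
  rw [← LinearMap.sum_apply, ← map_sum, S.sum_rankOne_basis, map_one]; rfl

/-- A map which commutes with the Clifford action is determined by its restriction to the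
spinor bundle. -/
theorem eq_of_comp_incl (y : FrameBundle V o) {f f' : E.Fib y.base →ₗ[ℂ] F.Fib y.base}
    (hf : ∀ T e, f (E.op S y.frame T e) = F.op S y.frame T (f e))
    (hf' : ∀ T e, f' (E.op S y.frame T e) = F.op S y.frame T (f' e))
    (h : ∀ t, f (E.spinorIncl S y t) = f' (E.spinorIncl S y t)) : f = f' :=
  LinearMap.ext fun e => by
    rw [← sum_op_proj S y e, map_sum, map_sum]
    simp only [hf, hf', h]

/-- The extension of a map of spinor bundles to the Clifford modules. -/
def extendMap (y : FrameBundle V o) (g : (E.spinorBundle S).Fib y →ₗ[ℂ] (F.spinorBundle S).Fib y) :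
    E.Fib y.base →ₗ[ℂ] F.Fib y.base :=
  ∑ j, F.op S y.frame (S.rankOne (S.basis j) S.covec) ∘ₗ F.spinorIncl S y ∘ₗ g ∘ₗ
    E.spinorProj S y (S.basis.coord j)

/-- `T` acting before `extendMap` replaces `b^j` by `b^j ∘ T`, and acting after it replaces `b_j` by
`T b_j`. The bilinear map `B` brings both into the form of `sum_basis_comp`. -/
theorem extendMap_op (y : FrameBundle V o)
    (g : (E.spinorBundle S).Fib y →ₗ[ℂ] (F.spinorBundle S).Fib y) (T : Module.End ℂ S.S)
    (e : E.Fib y.base) :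
    extendMap S y g (E.op S y.frame T e) = F.op S y.frame T (extendMap S y g e) := by
  let B : S.S →ₗ[ℂ] Module.Dual ℂ S.S →ₗ[ℂ] F.Fib y.base :=
    LinearMap.mk₂ ℂ (fun s σ => F.op S y.frame (S.rankOne s S.covec)
      (F.spinorIncl S y (g (E.spinorProj S y σ e))))
      (fun s t σ => by
        rw [← LinearMap.add_apply, ← map_add]
        congr 2
        exact LinearMap.ext fun x => smul_add _ _ _)
      (fun z s σ => by
        rw [← LinearMap.smul_apply, ← map_smul]
        congr 2
        exact LinearMap.ext fun x => smul_comm _ _ _)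
      (fun s σ τ => by
        rw [← map_add, ← map_add, ← map_add]
        congr 3
        exact (congrArg (E.tensorToFib S y) (E.mk_add_left S y σ τ e)).trans (map_add _ _ _))
      (fun z s σ => by
        rw [← map_smul, ← map_smul, ← map_smul]
        congr 3
        exact map_smul (E.tensorToFib S y ∘ₗ (balanced S E y).mkQ) z (σ ⊗ₜ[ℂ] e))
  have h := S.sum_basis_comp B T
  simp only [extendMap, LinearMap.sum_apply, LinearMap.comp_apply, map_sum, spinorProj_op, op_op,
    S.mul_rankOne]
  exact h

theorem extendMap_incl (y : FrameBundle V o)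
    (g : (E.spinorBundle S).Fib y →ₗ[ℂ] (F.spinorBundle S).Fib y) (t : (E.spinorBundle S).Fib y) :
    extendMap S y g (E.spinorIncl S y t) = F.spinorIncl S y (g t) := by
  have h : F.spinorIncl S y (g t) = F.op S y.frame S.idem (F.spinorIncl S y (g t)) :=
    ((F.mem_range_idem S y.frame).1 (g t).2).symm
  simp only [extendMap, LinearMap.sum_apply, LinearMap.comp_apply, spinorProj_incl, map_smul]
  conv_rhs => rw [h]
  -- Expanding `vec` in the basis of `S` writes `idem` through the rank one maps that occur in
  -- `extendMap`.
  have h1 : S.idem = ∑ j, S.basis.coord j S.vec • S.rankOne (S.basis j) S.covec := by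
    refine LinearMap.ext fun t => ?_
    simp only [LinearMap.sum_apply, LinearMap.smul_apply, S.rankOne_apply, SpinorRep.idem]
    conv_lhs => rw [← S.basis.sum_repr S.vec, Finset.smul_sum]
    exact Finset.sum_congr rfl fun i _ => smul_comm _ _ _
  rw [h1, map_sum, LinearMap.sum_apply]
  simp only [map_smul, LinearMap.smul_apply]

theorem extendMap_cl (y : FrameBundle V o)
    (g : (E.spinorBundle S).Fib y →ₗ[ℂ] (F.spinorBundle S).Fib y) (c : ClFib V y.base)
    (e : E.Fib y.base) :
    extendMap S y g (E.cl y.base c e) = F.cl y.base c (extendMap S y g e) := by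
  rw [E.cl_eq_op S y.frame, F.cl_eq_op S y.frame, extendMap_op]

/-- The extension of a morphism of gerbe modules does not depend on the frame. -/
theorem extendMap_frame (g : E.spinorModule S ⟶ F.spinorModule S) {x : M} (p q : FrameAt V o x) :
    extendMap S ⟨x, q⟩ (g.1 ⟨x, q⟩) = extendMap S ⟨x, p⟩ (g.1 ⟨x, p⟩) := by
  refine eq_of_comp_incl S ⟨x, p⟩ (hom_op S _ (extendMap_cl S ⟨x, q⟩ _) p)
    (extendMap_op S ⟨x, p⟩ _) fun t => ?_
  -- An arrow from `q` to `p` reaches every spinor over `p`. It acts by an element of `End S`, with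
  -- which the extension from `q` commutes, while `g` commutes with the arrow itself.
  obtain ⟨a, ha⟩ := p.exists_lifts q
  let γ : LiftingGerbe V o := ⟨x, p, q, SpinC.mk a 1, a, 1, rfl, ha⟩
  obtain ⟨t', rfl⟩ := (E.spinorAct S γ).surjective t
  refine Eq.trans ?_ (extendMap_incl S ⟨x, p⟩ _ _).symm
  refine (hom_op S _ (extendMap_cl S ⟨x, q⟩ (g.1 ⟨x, q⟩)) p _ (E.spinorIncl S ⟨x, q⟩ t')).trans ?_
  refine (congrArg (F.op S p (S.spinInv γ.arrow.1))
    (extendMap_incl S ⟨x, q⟩ (g.1 ⟨x, q⟩) t')).trans ?_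
  exact congrArg (F.spinorIncl S ⟨x, p⟩) (g.2.2 γ t').symm

instance [∀ x, Nonempty (FrameAt V o x)] : (spinorFunctor (V := V) (o := o) S).Faithful where
  map_injective {E F f f'} h := by
    refine Subtype.ext (funext fun x => ?_)
    obtain ⟨p⟩ := ‹∀ x, Nonempty (FrameAt V o x)› x
    refine eq_of_comp_incl S ⟨x, p⟩ (hom_op S _ (f.2.2 _) p) (hom_op S _ (f'.2.2 _) p) fun t => ?_
    exact congrArg (fun k : E.spinorModule S ⟶ F.spinorModule S =>
      F.spinorIncl S ⟨x, p⟩ (k.1 ⟨x, p⟩ t)) h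

theorem famContAt_extendMap (g : E.spinorModule S ⟶ F.spinorModule S) {Z : Type*}
    [TopologicalSpace Z] {y : Z → FrameBundle V o} {z₀ : Z} (hy : ContinuousAt y z₀) :
    FamContAt E.toComplexBundle F.toComplexBundle (fun z => (y z).base) (fun z => (y z).base)
      (fun z => extendMap S (y z) (g.1 (y z))) z₀ := by
  have hb : ContinuousAt (fun z => (y z).base) z₀ :=
    FrameBundle.continuous_base.continuousAt.comp hy
  refine FamContAt.sum _ fun j _ => ?_
  exact (F.famContAt_op S (p := fun z => (y z).frame) hy _).comp
    ((F.famContAt_spinorIncl S hy).comp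
      (((continuous_totalMap_iff.1 g.2.1 (y z₀)).restrict hy).comp
        (E.famContAt_spinorProj S hy _) hy) hy) hb

/-- The extension is taken in an arbitrary, possibly discontinuous, choice of frames. As it does not
depend on the frame, near each point it may be computed in a frame continuous there. -/
theorem full_spinorFunctor (hf : ∀ x₀ : M, ∃ f : ∀ x, FrameAt V o x,
      FrameContAt (fun x => x) f x₀) : (spinorFunctor (V := V) (o := o) S).Full where
  map_surjective {E F} g := by
    let p : ∀ x, FrameAt V o x := fun x => (hf x).choose x
    refine ⟨⟨fun x => extendMap S ⟨x, p x⟩ (g.1 ⟨x, p x⟩), continuous_totalMap_iff.2 fun x₀ => ?_,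
      fun x => extendMap_cl S ⟨x, p x⟩ _⟩, ?_⟩
    · obtain ⟨f, hf⟩ := hf x₀
      exact (famContAt_extendMap S g (y := fun x => ⟨x, f x⟩) hf).congr
        (Filter.Eventually.of_forall fun x => extendMap_frame S g _ _)
    · refine Subtype.ext (funext fun y => LinearMap.ext fun t => F.spinorIncl_injective S y ?_)
      refine Eq.trans ?_ (extendMap_incl S y (g.1 y) t)
      exact LinearMap.congr_fun (extendMap_frame S g y.frame (p y.base)) (E.spinorIncl S y t)

end FullyFaithful

end CliffordModule

namespace GerbeModule

section Descent

variable {M : Type u} [TopologicalSpace M] {n : ℕ} {V : M → Type v}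
  [∀ x, NormedAddCommGroup (V x)] [∀ x, InnerProductSpace ℝ (V x)]
  [TopologicalSpace (TotalSpace (Model n) V)]
  {o : ∀ x, Orientation ℝ (V x) (Fin (2 * n))}

/-! ### Descent of the spinor multiplicity spaces of a gerbe module -/

section

variable (W : GerbeModule.{u, v, w} V o)

/-- The action of an element of the spin group over `p⁻¹ q`. -/
def spinAct {x : M} {p q : FrameAt V o x} {a : Spin n} (h : SpinLifts a (p.diff q)) :
    W.Fib ⟨x, q⟩ →ₗ[ℂ] W.Fib ⟨x, p⟩ :=
  (W.act ⟨x, p, q, SpinC.mk a 1, a, 1, rfl, h⟩).toLinearMap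

/-- Every arrow is a phase times an arrow coming from the spin group, so the whole action is
determined by `spinAct`. -/
theorem act_eq (γ : LiftingGerbe V o) {a : Spin n} {z : Circle} (hγ : γ.arrow.1 = SpinC.mk a z)
    (h : SpinLifts a (γ.left.diff γ.right)) (e : W.Fib γ.src) :
    W.act γ e = (z : ℂ) • W.spinAct h e := by
  obtain ⟨x, p, q, c, hc⟩ := γ
  obtain rfl : c = SpinC.mk a z := hγ
  refine Eq.trans ?_ (W.act_phase x p q ⟨SpinC.mk a 1, a, 1, rfl, h⟩ z e)
  have : GerbeFib.phase z (⟨SpinC.mk a 1, a, 1, rfl, h⟩ : GerbeFib p q) = ⟨SpinC.mk a z, hc⟩ :=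
    Subtype.ext (by
      change SpinC.mk (1 * a) (z * 1) = SpinC.mk a z
      rw [one_mul, mul_one])
  rw [this]

theorem spinAct_mul {x : M} {p q r : FrameAt V o x} {a b c : Spin n} (ha : SpinLifts a (p.diff q))
    (hb : SpinLifts b (q.diff r)) (hc : SpinLifts c (p.diff r)) (h : c = a * b)
    (e : W.Fib ⟨x, r⟩) : W.spinAct ha (W.spinAct hb e) = W.spinAct hc e := by
  subst h
  refine (W.act_mul x p q r ⟨SpinC.mk a 1, a, 1, rfl, ha⟩ ⟨SpinC.mk b 1, b, 1, rfl, hb⟩ e).trans ?_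
  have : GerbeFib.mul (⟨SpinC.mk a 1, a, 1, rfl, ha⟩ : GerbeFib p q) ⟨SpinC.mk b 1, b, 1, rfl, hb⟩ =
      ⟨SpinC.mk (a * b) 1, a * b, 1, rfl, hc⟩ :=
    Subtype.ext (by
      change SpinC.mk (a * b) (1 * 1) = SpinC.mk (a * b) 1
      rw [one_mul])
  rw [this]; rfl

/-- The unit law is not among the axioms. The unit arrow acts idempotently and injectively, hence as
the identity. -/
theorem spinAct_one {x : M} {p : FrameAt V o x} (h : SpinLifts (1 : Spin n) (p.diff p))
    (e : W.Fib ⟨x, p⟩) : W.spinAct h e = e :=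
  (W.act ⟨x, p, p, SpinC.mk 1 1, 1, 1, rfl, h⟩).injective
    (W.spinAct_mul h h h (mul_one 1).symm e)

theorem spinAct_neg {x : M} {p q : FrameAt V o x} {a b : Spin n} (ha : SpinLifts a (p.diff q))
    (hb : SpinLifts b (p.diff q)) (h : (a : ModelCl n) = -(b : ModelCl n)) (e : W.Fib ⟨x, q⟩) :
    W.spinAct ha e = -W.spinAct hb e := by
  refine (W.act_eq ⟨x, p, q, SpinC.mk a 1, a, 1, rfl, ha⟩ (SpinC.mk_eq_of_neg h 1) hb e).trans ?_
  simp
  rfl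

variable (S : SpinorRep.{w} n)

/-- The fibre over a frame of the Clifford module which is defined by a gerbe module. -/
abbrev Spread {x : M} (p : FrameAt V o x) : Type w := Module.Dual ℂ S.S →ₗ[ℂ] W.Fib ⟨x, p⟩

variable {W} in
/-- The change of the frame defined by an element of the spin group. -/
def twistBy {x : M} {p q : FrameAt V o x} {a : Spin n} (h : SpinLifts a (p.diff q)) :
    W.Spread S q →ₗ[ℂ] W.Spread S p where
  toFun e := W.spinAct h ∘ₗ e ∘ₗ (S.ρ a).dualMap
  map_add' _ _ := LinearMap.ext fun _ => map_add (W.spinAct h) _ _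
  map_smul' z _ := LinearMap.ext fun _ => map_smul (W.spinAct h) z _

/-- Two lifts differ by a sign. The sign appears once in the gerbe action on `W` and once in the
representation on `S`, so it cancels. -/
theorem twistBy_eq {x : M} {p q : FrameAt V o x} {a b : Spin n} (ha : SpinLifts a (p.diff q))
    (hb : SpinLifts b (p.diff q)) : twistBy (W := W) S ha = twistBy S hb := by
  rcases ha.eq_or_eq_neg hb with rfl | h
  · rfl
  · refine LinearMap.ext fun e => LinearMap.ext fun σ => ?_
    refine (W.spinAct_neg ha hb h _).trans ?_
    rw [← map_neg]
    refine congrArg (W.spinAct hb) ?_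
    change -e (σ ∘ₗ S.ρ a) = e (σ ∘ₗ S.ρ b)
    rw [h, map_neg, LinearMap.comp_neg, map_neg, neg_neg]

/-- The change of the frame. -/
def twist {x : M} (p q : FrameAt V o x) : W.Spread S q →ₗ[ℂ] W.Spread S p :=
  twistBy S (p.exists_lifts q).choose_spec

theorem twist_apply {x : M} {p q : FrameAt V o x} {a : Spin n} (h : SpinLifts a (p.diff q))
    (e : W.Spread S q) (σ : Module.Dual ℂ S.S) :
    W.twist S p q e σ = W.spinAct h (e (σ ∘ₗ S.ρ a)) := by
  rw [twist, W.twistBy_eq S _ h]; rfl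

theorem twist_self {x : M} (p : FrameAt V o x) (e : W.Spread S p) : W.twist S p p e = e :=
  LinearMap.ext fun σ => by
    have h : SpinLifts (1 : Spin n) (p.diff p) := by
      rw [FrameAt.diff_self]; exact SpinLifts.one
    rw [W.twist_apply S h, W.spinAct_one]
    refine congrArg e (LinearMap.ext fun t => ?_)
    simp

/-- The strict cocycle condition: since any lifts may be used, a product of lifts can serve as the
lift of the composite. The gerbe twisting is gone and descent to `M` is possible. -/
theorem twist_twist {x : M} (p q r : FrameAt V o x) (e : W.Spread S r) :
    W.twist S p q (W.twist S q r e) = W.twist S p r e :=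
  LinearMap.ext fun σ => by
    obtain ⟨a, ha⟩ := p.exists_lifts q
    obtain ⟨b, hb⟩ := q.exists_lifts r
    have hc : SpinLifts (a * b) (p.diff r) := by
      rw [← FrameAt.diff_trans p q r]; exact ha.mul hb
    rw [W.twist_apply S ha, W.twist_apply S hb, W.twist_apply S hc, W.spinAct_mul ha hb hc rfl,
      Submonoid.coe_mul, map_mul]
    rfl

/-- The action of `End S`. -/
def spreadEnd {x : M} (p : FrameAt V o x) : Module.End ℂ S.S →ₐ[ℂ] Module.End ℂ (W.Spread S p) :=
  AlgHom.ofLinearMap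
    { toFun T :=
        { toFun e := e ∘ₗ T.dualMap
          map_add' _ _ := rfl
          map_smul' _ _ := rfl }
      map_add' T T' := LinearMap.ext fun e => LinearMap.ext fun σ => by
        change e (σ ∘ₗ (T + T')) = e (σ ∘ₗ T) + e (σ ∘ₗ T')
        rw [LinearMap.comp_add, map_add]
      map_smul' z T := LinearMap.ext fun e => LinearMap.ext fun σ => by
        change e (σ ∘ₗ (z • T)) = z • e (σ ∘ₗ T)
        rw [LinearMap.comp_smul, map_smul] }
    rfl fun _ _ => rfl

/-- The Clifford action. -/
def spreadCl {x : M} (p : FrameAt V o x) : ClFib V x →ₐ[ℝ] Module.End ℂ (W.Spread S p) :=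
  ((W.spreadEnd S p).restrictScalars ℝ).comp (S.ρ.comp (cliffordMap p.1.symm))

theorem spreadCl_apply {x : M} (p : FrameAt V o x) (c : ClFib V x) (e : W.Spread S p)
    (σ : Module.Dual ℂ S.S) :
    W.spreadCl S p c e σ = e (σ ∘ₗ S.ρ (cliffordMap p.1.symm c)) := rfl

theorem twist_spreadCl {x : M} (p q : FrameAt V o x) (c : ClFib V x) (e : W.Spread S q) :
    W.twist S p q (W.spreadCl S q c e) = W.spreadCl S p c (W.twist S p q e) :=
  LinearMap.ext fun σ => by
    obtain ⟨a, ha⟩ := p.exists_lifts q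
    rw [spreadCl_apply, W.twist_apply S ha, W.twist_apply S ha, spreadCl_apply,
      FrameAt.cliffordMap_symm p q, ← ha.conj]
    refine congrArg _ (congrArg e ?_)
    simp only [LinearMap.comp_assoc, ← Module.End.mul_eq_comp, ← map_mul]
    rw [mul_assoc, Spin.inv_mul_coe, mul_one]

/-- The coefficient of `σ ∈ S*` in a frame `q`, of a vector given in a frame `p`. -/
def coeff {x : M} (p q : FrameAt V o x) (σ : Module.Dual ℂ S.S) :
    W.Spread S p →ₗ[ℂ] W.Fib ⟨x, q⟩ := LinearMap.applyₗ σ ∘ₗ W.twist S q p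

theorem coeff_apply {x : M} (p q : FrameAt V o x) (σ : Module.Dual ℂ S.S) (e : W.Spread S p) :
    W.coeff S p q σ e = W.twist S q p e σ := rfl

/-- The vector `s ⊗ w`, given in a frame `q`, in a frame `p`. -/
def insert {x : M} (p q : FrameAt V o x) (s : S.S) : W.Fib ⟨x, q⟩ →ₗ[ℂ] W.Spread S p :=
  W.twist S p q ∘ₗ
    { toFun w := LinearMap.toSpanSingleton ℂ _ w ∘ₗ Module.Dual.eval ℂ S.S s
      map_add' _ _ := LinearMap.ext fun _ => smul_add _ _ _
      map_smul' _ _ := LinearMap.ext fun _ => smul_comm _ _ _ }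

theorem twist_insert {x : M} (p q r : FrameAt V o x) (s : S.S) (w : W.Fib ⟨x, q⟩) :
    W.twist S r p (W.insert S p q s w) = W.insert S r q s w := W.twist_twist S _ _ _ _

theorem insert_self {x : M} (q : FrameAt V o x) (s : S.S) (w : W.Fib ⟨x, q⟩)
    (σ : Module.Dual ℂ S.S) : W.insert S q q s w σ = σ s • w := by
  rw [insert, LinearMap.comp_apply, twist_self]; rfl

theorem coeff_insert_self {x : M} (p q : FrameAt V o x) (s : S.S) (σ : Module.Dual ℂ S.S)
    (w : W.Fib ⟨x, q⟩) : W.coeff S p q σ (W.insert S p q s w) = σ s • w := by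
  rw [coeff_apply, twist_insert, insert_self]

theorem coeff_insert {x : M} (p : FrameAt V o x) {q r : FrameAt V o x} {a : Spin n}
    (h : SpinLifts a (q.diff r)) (s : S.S) (σ : Module.Dual ℂ S.S) (w : W.Fib ⟨x, r⟩) :
    W.coeff S p q σ (W.insert S p r s w) = σ (S.ρ a s) • W.spinAct h w := by
  rw [coeff_apply, twist_insert, insert, LinearMap.comp_apply, W.twist_apply S h]
  exact map_smul (W.spinAct h) _ w

theorem coeff_cl {x : M} (p q : FrameAt V o x) (σ : Module.Dual ℂ S.S) (c : ClFib V x)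
    (e : W.Spread S p) : W.coeff S p q σ (W.spreadCl S p c e) =
      W.coeff S p q (σ ∘ₗ S.ρ (cliffordMap q.1.symm c)) e := by
  rw [coeff_apply, twist_spreadCl]; rfl

theorem coeff_frame {x : M} (p : FrameAt V o x) {q r : FrameAt V o x} {a : Spin n}
    (h : SpinLifts a (q.diff r)) (σ : Module.Dual ℂ S.S) (e : W.Spread S p) :
    W.coeff S p q σ e = W.spinAct h (W.coeff S p r (σ ∘ₗ S.ρ a) e) := by
  rw [coeff_apply, ← W.twist_twist S q r p, W.twist_apply S h]; rfl

theorem coeff_injective {x : M} (p q : FrameAt V o x) {e e' : W.Spread S p}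
    (h : ∀ σ, W.coeff S p q σ e = W.coeff S p q σ e') : e = e' := by
  have : W.twist S q p e = W.twist S q p e' := LinearMap.ext h
  rw [← W.twist_self S p e, ← W.twist_twist S p q p, this, W.twist_twist, W.twist_self]

theorem coeff_sum {x : M} (p q : FrameAt V o x) (σ : Module.Dual ℂ S.S) (e : W.Spread S p) :
    W.coeff S p q σ e = ∑ i, σ (S.basis i) • W.coeff S p q (S.basis.coord i) e := by
  rw [coeff_apply]
  conv_lhs => rw [← S.coord_comp σ, map_sum]
  exact Finset.sum_congr rfl fun i _ => map_smul _ _ _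

theorem sum_insert_coeff {x : M} (p q : FrameAt V o x) (e : W.Spread S p) :
    ∑ i, W.insert S p q (S.basis i) (W.coeff S p q (S.basis.coord i) e) = e :=
  W.coeff_injective S p q fun σ => by
    rw [map_sum, W.coeff_sum S p q σ e]
    simp only [coeff_insert_self]

/-- The fibre is modelled on the arbitrary frame `p`, whereas here the action is written in any
other frame `q`. With `q` a continuous local frame, every ingredient becomes continuous. -/
theorem spreadCl_sum {x : M} (p q : FrameAt V o x) (c : ClFib V x) :
    W.spreadCl S p c = ∑ i, ∑ j,
      S.basis.coord i (S.ρ (cliffordMap q.1.symm c) (S.basis j)) •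
        (W.insert S p q (S.basis i) ∘ₗ W.coeff S p q (S.basis.coord j)) :=
  LinearMap.ext fun e => by
    rw [← W.sum_insert_coeff S p q (W.spreadCl S p c e)]
    simp only [coeff_cl, LinearMap.sum_apply, LinearMap.smul_apply, LinearMap.comp_apply]
    refine Finset.sum_congr rfl fun i _ => ?_
    rw [W.coeff_sum S p q (_ ∘ₗ _), map_sum]
    exact Finset.sum_congr rfl fun j _ => map_smul _ _ _

end

variable (W : GerbeModule.{u, v, w} V o) (S : SpinorRep.{w} n)

/-- A continuous local frame and a chart of the gerbe module. -/
structure SpreadChart where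
  frame : ∀ x, FrameAt V o x
  dom : Set M
  isOpen_dom : IsOpen dom
  continuousAt_frame : ∀ x ∈ dom, FrameContAt (fun x => x) frame x
  chart : W.Chart

variable {W}

/-- The chart of the Clifford module. -/
def SpreadChart.chartData (p : ∀ x, FrameAt V o x) (i : W.SpreadChart) :
    ChartData fun x => W.Spread S (p x) where
  rank := Module.finrank ℂ S.S * i.chart.rank
  dom := {x | x ∈ i.dom ∧ ⟨x, i.frame x⟩ ∈ i.chart.dom}
  isOpen_dom := isOpen_iff_mem_nhds.2 fun x hx => by
    filter_upwards [i.isOpen_dom.mem_nhds hx.1,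
      i.chart.eventually_mem (i.continuousAt_frame x hx.1) hx.2] with z h1 h2 using ⟨h1, h2⟩
  coord x := LinearMap.pi fun k => LinearMap.proj (finProdFinEquiv.symm k).2 ∘ₗ
    i.chart.coord ⟨x, i.frame x⟩ ∘ₗ
      W.coeff S (p x) (i.frame x) (S.basis.coord (finProdFinEquiv.symm k).1)
  sec x := ∑ j, W.insert S (p x) (i.frame x) (S.basis j) ∘ₗ i.chart.sec ⟨x, i.frame x⟩ ∘ₗ
    LinearMap.funLeft ℂ ℂ fun l => finProdFinEquiv (j, l)
  coord_sec x hx v := by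
    refine funext fun k => ?_
    obtain ⟨⟨k, l⟩, rfl⟩ := finProdFinEquiv.surjective k
    simp only [LinearMap.pi_apply, LinearMap.comp_apply, Equiv.symm_apply_apply,
      LinearMap.sum_apply, map_sum, coeff_insert_self, map_smul, i.chart.coord_sec _ hx.2]
    simp [Finsupp.single_apply, LinearMap.funLeft_apply]
  sec_coord x hx e := by
    refine Eq.trans ?_ (W.sum_insert_coeff S (p x) (i.frame x) e)
    rw [LinearMap.sum_apply]
    refine Finset.sum_congr rfl fun j _ => ?_
    simp only [LinearMap.comp_apply]
    refine congrArg _ ?_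
    refine Eq.trans ?_ (i.chart.sec_coord _ hx.2 _)
    refine congrArg _ (funext fun l => ?_)
    change i.chart.coord ⟨x, i.frame x⟩ (W.coeff S (p x) (i.frame x) (S.basis.coord
      (finProdFinEquiv.symm (finProdFinEquiv (j, l))).1) e)
        (finProdFinEquiv.symm (finProdFinEquiv (j, l))).2 = _
    rw [Equiv.symm_apply_apply]

/-- A vector given by chart coordinates is a finite sum of inserted vectors `b_l ⊗ w`, so families
of linear maps need testing only on those. -/
theorem SpreadChart.continuousAt_sec (p : ∀ x, FrameAt V o x) (i : W.SpreadChart) {Z G : Type*}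
    [TopologicalSpace Z] [TopologicalSpace G] [AddCommMonoid G] [ContinuousAdd G] [Module ℂ G]
    {b : Z → M} {z₀ : Z} {T : ∀ z, W.Spread S (p (b z)) →ₗ[ℂ] G}
    (h : ∀ l v, ContinuousAt (fun z => T z (W.insert S (p (b z)) (i.frame (b z)) (S.basis l)
      (i.chart.sec ⟨b z, i.frame (b z)⟩ v))) z₀)
    (v : Fin (Module.finrank ℂ S.S * i.chart.rank) → ℂ) :
    ContinuousAt (fun z => T z ((i.chartData S p).sec (b z) v)) z₀ := by
  have key : ∀ z, T z ((i.chartData S p).sec (b z) v) =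
      ∑ l, T z (W.insert S (p (b z)) (i.frame (b z)) (S.basis l)
        (i.chart.sec ⟨b z, i.frame (b z)⟩ fun m => v (finProdFinEquiv (l, m)))) := fun z => by
    refine (congrArg (T z) ?_).trans (map_sum (T z) (fun l =>
      W.insert S (p (b z)) (i.frame (b z)) (S.basis l)
        (i.chart.sec ⟨b z, i.frame (b z)⟩ fun m => v (finProdFinEquiv (l, m)))) Finset.univ)
    exact LinearMap.sum_apply Finset.univ (fun l =>
      W.insert S (p (b z)) (i.frame (b z)) (S.basis l) ∘ₗ i.chart.sec ⟨b z, i.frame (b z)⟩ ∘ₗ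
        LinearMap.funLeft ℂ ℂ fun m => finProdFinEquiv (l, m)) v
  simp only [key]
  exact tendsto_finsetSum _ fun l _ => h l _

variable (W)

theorem famContAt_act {Z : Type*} [TopologicalSpace Z] {γ : Z → LiftingGerbe V o} {z₀ : Z}
    (hγ : ContinuousAt γ z₀) :
    FamContAt W.toComplexBundle W.toComplexBundle (fun z => (γ z).src) (fun z => (γ z).tgt)
      (fun z => (W.act (γ z)).toLinearMap) z₀ :=
  ((continuous_pullback_iff (f := fun γ => (W.act γ).toLinearMap)
    LiftingGerbe.continuous_src LiftingGerbe.continuous_tgt).1 W.continuous_act (γ z₀)).restrict hγ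

/-! ### The topology of the descended Clifford module. -/

section Continuity

variable [FiberBundle (Model n) V] [VectorBundle ℝ (Model n) V]
  [IsContinuousRiemannianBundle (Model n) V]

/-- The arbitrary frames `p` cancel, since the composite is the frame change from `r` to `q`, namely
`σ(ρ(a) s)` times the action of `a`. With a continuous local lift `a` both factors are continuous.
Compatibility of charts and continuity of `coeff` and `insert` all reduce to this. -/
theorem famContAt_coeff_insert {Z : Type*} [TopologicalSpace Z] {b : Z → M}
    (p : ∀ x, FrameAt V o x) {q r : ∀ z, FrameAt V o (b z)} {z₀ : Z} (hq : FrameContAt b q z₀)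
    (hr : FrameContAt b r z₀) (s : S.S) (σ : Module.Dual ℂ S.S) :
    FamContAt W.toComplexBundle W.toComplexBundle (fun z => ⟨b z, r z⟩) (fun z => ⟨b z, q z⟩)
      (fun z => W.coeff S (p (b z)) (q z) σ ∘ₗ W.insert S (p (b z)) (r z) s) z₀ := by
  obtain ⟨a, ha, h⟩ := exists_continuousAt_lift_diff hq hr
  have h1 : ContinuousAt (fun z => (⟨b z, q z, r z, SpinC.mk (a z) 1, a z, 1, rfl, h z⟩ :
      LiftingGerbe V o)) z₀ := by
    rw [(Topology.IsInducing.induced _).continuousAt_iff]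
    refine hq.prodMk (hr.prodMk ?_)
    exact (continuous_quotient_mk'.continuousAt (x := (a z₀, (1 : Circle)))).comp
      (f := fun z => (a z, (1 : Circle))) (ha.prodMk continuousAt_const)
  let f : ModelCl n →ₗ[ℝ] ℂ :=
    (σ ∘ₗ LinearMap.applyₗ s).restrictScalars ℝ ∘ₗ S.ρ.toLinearMap
  have hf : Continuous f := IsModuleTopology.continuous_of_linearMap f
  have h2 : ContinuousAt (fun z => σ (S.ρ (a z) s)) z₀ :=
    hf.continuousAt.comp (continuous_subtype_val.continuousAt.comp ha)
  exact (FamContAt.smul h2 (W.famContAt_act h1)).congr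
    (Filter.Eventually.of_forall fun z => LinearMap.ext fun w =>
      (W.coeff_insert S _ (h z) s σ w).symm)

theorem SpreadChart.compatible (p : ∀ x, FrameAt V o x) (i j : W.SpreadChart) :
    (i.chartData S p).Compatible (j.chartData S p) := fun x hi hj v =>
  continuousAt_pi.2 fun k => by
    refine SpreadChart.continuousAt_sec S p i (b := fun z => z)
      (T := fun z => LinearMap.proj (finProdFinEquiv.symm k).2 ∘ₗ j.chart.coord ⟨z, j.frame z⟩ ∘ₗ
        W.coeff S (p z) (j.frame z) (S.basis.coord (finProdFinEquiv.symm k).1)) (fun l v => ?_) v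
    exact continuousAt_pi.1 (W.famContAt_coeff_insert S p (j.continuousAt_frame x hj.1)
      (i.continuousAt_frame x hi.1) (S.basis l) (S.basis.coord (finProdFinEquiv.symm k).1)
        i.chart j.chart hi.2 hj.2 v) _

variable {W} in
theorem SpreadChart.exists_mem (ho : IsBundleOrientation V o) (p : ∀ x, FrameAt V o x) (x : M) :
    ∃ i : W.SpreadChart, x ∈ (i.chartData S p).dom := by
  obtain ⟨U, hU, hx, f, hf⟩ := exists_local_frame ho x
  obtain ⟨χ, hχ⟩ := W.exists_chart ⟨x, f x⟩
  exact ⟨⟨f, U, hU, hf, χ⟩, hx, hχ⟩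

variable (ho : IsBundleOrientation V o) (p : ∀ x, FrameAt V o x)

/-- The vector bundle of the Clifford module which is defined by a gerbe module. -/
def spreadBundle : ComplexBundle.{u, w} M :=
  ofCharts (fun i : W.SpreadChart => i.chartData S p) (SpreadChart.compatible W S p)
    (SpreadChart.exists_mem S ho p)

/-- The charts of the Clifford module. -/
def spreadBundleChart (i : W.SpreadChart) : (W.spreadBundle S ho p).Chart :=
  ofChartsChart (fun i : W.SpreadChart => i.chartData S p) (SpreadChart.compatible W S p)
    (SpreadChart.exists_mem S ho p) i

theorem famContAt_coeff {Z : Type*} [TopologicalSpace Z] {y : Z → FrameBundle V o} {z₀ : Z}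
    (hy : ContinuousAt y z₀) (σ : Module.Dual ℂ S.S) :
    FamContAt (W.spreadBundle S ho p) W.toComplexBundle (fun z => (y z).base) y
      (fun z => W.coeff S (p (y z).base) (y z).frame σ) z₀ := by
  have hb : ContinuousAt (fun z => (y z).base) z₀ :=
    FrameBundle.continuous_base.continuousAt.comp hy
  obtain ⟨i, hi⟩ := SpreadChart.exists_mem (W := W) S ho p (y z₀).base
  obtain ⟨χ, hχ⟩ := W.exists_chart (y z₀)
  refine FamContAt.of_chart hb hy (W.spreadBundleChart S ho p i) χ hi hχ fun v => ?_
  refine SpreadChart.continuousAt_sec S p i (b := fun z => (y z).base)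
    (T := fun z => χ.coord (y z) ∘ₗ W.coeff S (p (y z).base) (y z).frame σ) (fun l v => ?_) v
  exact W.famContAt_coeff_insert S p (b := fun z => (y z).base) (q := fun z => (y z).frame) hy
    (FrameContAt.restrict (h := fun z => (y z).base) (i.continuousAt_frame _ hi.1) hb)
    (S.basis l) σ i.chart χ hi.2 hχ v

theorem famContAt_insert {Z : Type*} [TopologicalSpace Z] {y : Z → FrameBundle V o} {z₀ : Z}
    (hy : ContinuousAt y z₀) (s : S.S) :
    FamContAt W.toComplexBundle (W.spreadBundle S ho p) y (fun z => (y z).base)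
      (fun z => W.insert S (p (y z).base) (y z).frame s) z₀ := by
  have hb : ContinuousAt (fun z => (y z).base) z₀ :=
    FrameBundle.continuous_base.continuousAt.comp hy
  obtain ⟨i, hi⟩ := SpreadChart.exists_mem (W := W) S ho p (y z₀).base
  obtain ⟨χ, hχ⟩ := W.exists_chart (y z₀)
  refine FamContAt.of_chart hy hb χ (W.spreadBundleChart S ho p i) hχ hi fun v =>
    continuousAt_pi.2 fun k => ?_
  exact continuousAt_pi.1 (W.famContAt_coeff_insert S p (b := fun z => (y z).base)
    (FrameContAt.restrict (h := fun z => (y z).base) (i.continuousAt_frame _ hi.1) hb)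
    (r := fun z => (y z).frame) hy s
      (S.basis.coord (finProdFinEquiv.symm k).1) χ i.chart hχ hi.2 v) _

/-- By the quotient topology of `Cl(V)` it suffices to test on pairs `(q, c)` over `U`. There the
map is `c ↦ Cl(f⁻¹ q) c = a c a⁻¹` for a local continuous spin lift `a`. -/
theorem continuousAt_clFrame {f : ∀ x, FrameAt V o x} {U : Set M} (hU : IsOpen U)
    (hf : ∀ x ∈ U, FrameContAt (fun x => x) f x) (c₀ : ClTotal V o) (h₀ : c₀.base ∈ U) :
    ContinuousAt (fun c : ClTotal V o => cliffordMap (f c.base).1.symm c.val) c₀ := by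
  have hq : Topology.IsQuotientMap (clQuot V o) :=
    ⟨⟨rfl⟩, fun c => ⟨(⟨c.base, f c.base⟩, cliffordMap (f c.base).1.symm c.val), by
      rw [clQuot, cliffordMap_apply_symm]⟩⟩
  have hU' : IsOpen (ClTotal.base ⁻¹' U : Set (ClTotal V o)) :=
    hU.preimage ClTotal.continuous_base
  refine ((hq.continuousOn_isOpen_iff hU').2 fun y hy => ContinuousAt.continuousWithinAt ?_)
    |>.continuousAt (hU'.mem_nhds h₀)
  have hb : ContinuousAt (fun y : FrameBundle V o × ModelCl n => y.1.base) y :=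
    (FrameBundle.continuous_base.comp continuous_fst).continuousAt
  obtain ⟨a, ha, h⟩ := exists_continuousAt_lift_diff
    (FrameContAt.restrict (h := fun y : FrameBundle V o × ModelCl n => y.1.base)
      (hf y.1.base hy) hb)
    (q := fun y : FrameBundle V o × ModelCl n => y.1.frame) (continuousAt_fst (p := y))
  have ha' : ContinuousAt (fun z => (a z : ModelCl n)) y :=
    continuous_subtype_val.continuousAt.comp ha
  refine ((ha'.mul continuousAt_snd).mul
    (continuous_star_modelCl.continuousAt.comp ha')).congr (Filter.Eventually.of_forall fun z => ?_)
  change (a z : ModelCl n) * z.2 * star (a z : ModelCl n) =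
    cliffordMap (f z.1.base).1.symm (cliffordMap z.1.frame.1 z.2)
  rw [← Spin.coe_inv, (h z).conj, cliffordMap_cliffordMap]; rfl

/-- The Clifford module which is defined by a gerbe module. -/
def spreadModule : CliffordModule.{u, v, w} V o where
  toComplexBundle := W.spreadBundle S ho p
  cl x := W.spreadCl S (p x)
  continuous_cl := by
    refine (continuous_pullback_iff (E := W.spreadBundle S ho p) (F := W.spreadBundle S ho p)
      (f := fun c : ClTotal V o => W.spreadCl S (p c.base) c.val)
      ClTotal.continuous_base ClTotal.continuous_base).2 fun c₀ => ?_
    obtain ⟨U, hU, hx, f, hf⟩ := exists_local_frame ho c₀.base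
    have hc := continuousAt_clFrame hU hf c₀ hx
    have hy : ContinuousAt (fun c : ClTotal V o => (⟨c.base, f c.base⟩ : FrameBundle V o)) c₀ :=
      FrameContAt.restrict (h := ClTotal.base) (hf c₀.base hx)
        ClTotal.continuous_base.continuousAt
    -- The action is expanded in the local frame `f`, whose matrix coefficients are continuous by
    -- `hc`.
    refine FamContAt.congr ?_ (Filter.Eventually.of_forall fun c : ClTotal V o =>
      (W.spreadCl_sum S (p c.base) (f c.base) c.val).symm)
    refine FamContAt.sum _ fun i _ => FamContAt.sum _ fun j _ => FamContAt.smul ?_ ?_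
    · let ℓ : ModelCl n →ₗ[ℝ] ℂ :=
        (S.basis.coord i ∘ₗ LinearMap.applyₗ (S.basis j)).restrictScalars ℝ ∘ₗ S.ρ.toLinearMap
      have hℓ : Continuous ℓ := IsModuleTopology.continuous_of_linearMap ℓ
      exact hℓ.continuousAt.comp hc
    · exact (W.famContAt_insert S ho p hy _).comp (W.famContAt_coeff S ho p hy _) hy

/-- The coefficient of `σ` in a frame. -/
def spreadCoeff (y : FrameBundle V o) (σ : Module.Dual ℂ S.S) :
    (W.spreadModule S ho p).Fib y.base →ₗ[ℂ] W.Fib y := W.coeff S (p y.base) y.frame σ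

theorem spreadCoeff_add (y : FrameBundle V o) (σ τ : Module.Dual ℂ S.S)
    (e : (W.spreadModule S ho p).Fib y.base) : W.spreadCoeff S ho p y (σ + τ) e =
      W.spreadCoeff S ho p y σ e + W.spreadCoeff S ho p y τ e :=
  map_add (W.twist S y.frame (p y.base) e) σ τ

theorem spreadCoeff_smul (y : FrameBundle V o) (z : ℂ) (σ : Module.Dual ℂ S.S)
    (e : (W.spreadModule S ho p).Fib y.base) : W.spreadCoeff S ho p y (z • σ) e =
      z • W.spreadCoeff S ho p y σ e :=
  map_smul (W.twist S y.frame (p y.base) e) z σ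

theorem spreadCoeff_op (y : FrameBundle V o) (σ : Module.Dual ℂ S.S) (T : Module.End ℂ S.S)
    (e : (W.spreadModule S ho p).Fib y.base) :
    W.spreadCoeff S ho p y σ ((W.spreadModule S ho p).op S y.frame T e) =
      W.spreadCoeff S ho p y (σ ∘ₗ T) e := by
  induction T using S.end_induction with
  | hρ c =>
    rw [CliffordModule.op_ρ]
    refine (W.coeff_cl S _ _ _ _ _).trans ?_
    rw [cliffordMap_symm_apply]; rfl
  | h0 =>
    rw [map_zero, LinearMap.zero_apply, map_zero, LinearMap.comp_zero]
    exact (map_zero (W.twist S y.frame (p y.base) e)).symm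
  | hadd T T' h h' =>
    rw [map_add, LinearMap.add_apply, map_add, h, h', LinearMap.comp_add, spreadCoeff_add]
  | hsmul z T h =>
    rw [map_smul, LinearMap.smul_apply, map_smul, h, LinearMap.comp_smul, spreadCoeff_smul]

/-- The evaluation of the spinor bundle of the Clifford module which is defined by `W`. -/
def spreadEval (y : FrameBundle V o) :
    ((W.spreadModule S ho p).spinorBundle S).Fib y →ₗ[ℂ] W.Fib y :=
  W.spreadCoeff S ho p y S.covec ∘ₗ (W.spreadModule S ho p).spinorIncl S y

/-- On the image of `idem` the coefficient of every `σ` is `σ(vec)` times that of `covec`, so the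
latter determines the vector. Conversely `vec ⊗ w` lies in this image and evaluates to `w`. -/
theorem spreadEval_bijective (y : FrameBundle V o) :
    Function.Bijective (W.spreadEval S ho p y) := by
  constructor
  · refine fun e e' h => (W.spreadModule S ho p).spinorIncl_injective S y ?_
    refine W.coeff_injective S (p y.base) y.frame fun σ => ?_
    have key : ∀ e : ((W.spreadModule S ho p).spinorBundle S).Fib y,
        W.spreadCoeff S ho p y σ ((W.spreadModule S ho p).spinorIncl S y e) =
          σ S.vec • W.spreadEval S ho p y e := fun e => by
      have he : (W.spreadModule S ho p).op S y.frame S.idem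
          ((W.spreadModule S ho p).spinorIncl S y e) = (W.spreadModule S ho p).spinorIncl S y e :=
        ((W.spreadModule S ho p).mem_range_idem S y.frame).1 e.2
      have h1 : σ ∘ₗ S.idem = σ S.vec • S.covec := LinearMap.ext fun t => by
        simp [SpinorRep.idem, S.rankOne_apply, mul_comm]
      rw [← he, spreadCoeff_op, h1, spreadCoeff_smul]; rfl
    exact (key e).trans ((congrArg (σ S.vec • ·) h).trans (key e').symm)
  · intro w
    let e : (W.spreadModule S ho p).Fib y.base := W.insert S (p y.base) y.frame S.vec w
    have h (σ : Module.Dual ℂ S.S) : W.spreadCoeff S ho p y σ e = σ S.vec • w :=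
      W.coeff_insert_self S (p y.base) y.frame S.vec σ w
    have he : (W.spreadModule S ho p).op S y.frame S.idem e = e :=
      W.coeff_injective S (p y.base) y.frame fun σ =>
        (W.spreadCoeff_op S ho p y σ S.idem e).trans <| by
          refine (h _).trans (Eq.trans ?_ (h σ).symm)
          simp [SpinorRep.idem, S.rankOne_apply, S.covec_vec]
    refine ⟨⟨e, e, he⟩, ?_⟩
    refine (h _).trans ?_
    rw [S.covec_vec, one_smul]

/-- The evaluation is a morphism of gerbe modules. -/
def spreadHom : (W.spreadModule S ho p).spinorModule S ⟶ W :=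
  ⟨W.spreadEval S ho p, continuous_totalMap_iff.2 fun y =>
    (W.famContAt_coeff S ho p (y := fun y => y) continuousAt_id S.covec).comp
      ((W.spreadModule S ho p).famContAt_spinorIncl S (y := fun y => y) continuousAt_id)
      FrameBundle.continuous_base.continuousAt, fun γ e => by
    obtain ⟨a, z, h, hl⟩ := γ.arrow.2
    rw [W.act_eq γ h hl]
    refine (W.spreadCoeff_op S ho p γ.tgt S.covec (S.spinInv γ.arrow.1)
      ((W.spreadModule S ho p).spinorIncl S γ.src e)).trans ?_
    rw [h, S.spinInv_mk, LinearMap.comp_smul]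
    refine (W.spreadCoeff_smul S ho p γ.tgt _ _ _).trans ?_
    refine congrArg ((z : ℂ) • ·) ?_
    -- Passing to the source frame precomposes the functional with `ρ(a)`, which cancels the
    -- `ρ(a⁻¹)` of the spinor action.
    refine (W.coeff_frame S (p γ.base) hl _ _).trans ?_
    rw [LinearMap.comp_assoc, ← Module.End.mul_eq_comp, CliffordModule.ρ_inv_mul]
    rfl⟩

end Continuity

/-- A bijective morphism of gerbe modules is an isomorphism. -/
theorem isIso_of_bijective {W W' : GerbeModule.{u, v, w} V o} (f : W ⟶ W')
    (hf : ∀ y, Function.Bijective (f.1 y)) : IsIso f := by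
  let e : ∀ y, W.Fib y ≃ₗ[ℂ] W'.Fib y := fun y => LinearEquiv.ofBijective (f.1 y) (hf y)
  refine ⟨⟨fun y => (e y).symm.toLinearMap, continuous_totalMap_iff.2 fun y =>
    (continuous_totalMap_iff.1 f.2.1 y).symm continuousAt_id continuousAt_id
      (Filter.Eventually.of_forall fun y => LinearMap.ext (e y).symm_apply_apply)
      (Filter.Eventually.of_forall fun y => LinearMap.ext (e y).apply_symm_apply),
    fun γ t => ?_⟩, ?_, ?_⟩
  · obtain ⟨t, rfl⟩ := (e γ.src).surjective t
    refine (LinearEquiv.symm_apply_eq _).2 ?_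
    refine (f.2.2 γ t).symm.trans (congrArg (f.1 γ.tgt) (congrArg (W.act γ) ?_))
    exact ((e γ.src).symm_apply_apply t).symm
  · exact Subtype.ext (funext fun y => LinearMap.ext (e y).symm_apply_apply)
  · exact Subtype.ext (funext fun y => LinearMap.ext (e y).apply_symm_apply)

end Descent

end GerbeModule

/-- The spinor functor is an equivalence. -/
theorem isEquivalence_spinorFunctor {M : Type u} [TopologicalSpace M] {n : ℕ} {V : M → Type v}
    [∀ x, NormedAddCommGroup (V x)] [∀ x, InnerProductSpace ℝ (V x)]
    [TopologicalSpace (TotalSpace (Model n) V)] [FiberBundle (Model n) V]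
    [VectorBundle ℝ (Model n) V] [IsContinuousRiemannianBundle (Model n) V]
    {o : ∀ x, Orientation ℝ (V x) (Fin (2 * n))} (ho : IsBundleOrientation V o)
    (S : SpinorRep.{w} n) :
    (CliffordModule.spinorFunctor.{u, v, w} (V := V) (o := o) S).IsEquivalence := by
  have := nonempty_frameAt ho
  have : (CliffordModule.spinorFunctor.{u, v, w} (V := V) (o := o) S).Full :=
    CliffordModule.full_spinorFunctor S fun x₀ => by
      obtain ⟨U, -, hx, f, hf⟩ := exists_local_frame ho x₀
      exact ⟨f, hf x₀ hx⟩
  have : (CliffordModule.spinorFunctor.{u, v, w} (V := V) (o := o) S).EssSurj := ⟨fun W => by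
    -- The frames that model the fibres need not vary continuously; the topology comes from local
    -- frames.
    let p : ∀ x, FrameAt V o x := fun x => (nonempty_frameAt ho x).some
    have : IsIso (W.spreadHom S ho p) :=
      GerbeModule.isIso_of_bijective (W.spreadHom S ho p) (W.spreadEval_bijective S ho p)
    exact ⟨W.spreadModule S ho p,
      ⟨(asIso (W.spreadHom S ho p) : (W.spreadModule S ho p).spinorModule S ≅ W)⟩⟩⟩
  exact {}

/-! ### Grothendieck groups of equivalent categories -/

namespace K0

section

variable {C D : Type*} [Category C] [Category D] [Preadditive C] [Preadditive D]

theorem of_pt {Y Z : C} {b : Limits.BinaryBicone Y Z} (hb : b.IsBilimit) :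
    K0.of b.pt = K0.of Y + K0.of Z := by
  refine (QuotientAddGroup.eq_iff_sub_mem).2 ?_
  exact AddSubgroup.subset_closure ⟨Y, Z, b, ⟨hb⟩, rfl⟩

/-- Isomorphic objects have the same class. -/
theorem of_eq_of_iso {Z : C} (hZ : Limits.IsZero Z) {X Y : C} (e : X ≅ Y) :
    K0.of X = K0.of Y := by
  -- No relation for isomorphisms is imposed on the generators. Instead, an object isomorphic to `X`
  -- is a biproduct of `X` with a zero object `Z`, and all of these have the class `[X] + [Z]`.
  have key : ∀ {X Y : C}, (X ≅ Y) → K0.of Y = K0.of X + K0.of Z := fun {X Y} e => by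
    let b : Limits.BinaryBicone X Z :=
      { pt := Y, fst := e.inv, snd := 0, inl := e.hom, inr := 0
        inr_snd := hZ.eq_of_src _ _ }
    exact of_pt (b := b) (Limits.isBinaryBilimitOfTotal b (by simp [b]))
  exact (key (Iso.refl X)).trans (key e).symm

/-- The homomorphism of Grothendieck groups defined by an additive functor. -/
def map (F : C ⥤ D) [F.Additive] : K0 C →+ K0 D :=
  QuotientAddGroup.lift _ (FreeAbelianGroup.lift fun X => K0.of (F.obj X)) <| by
    refine (AddSubgroup.closure_le _).2 ?_
    rintro _ ⟨Y, Z, b, ⟨hb⟩, rfl⟩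
    have := Limits.preservesBinaryBiproducts_of_preservesBiproducts F
    have h := of_pt (Limits.isBinaryBilimitOfPreserves F hb)
    rw [SetLike.mem_coe, AddMonoidHom.mem_ker, map_sub, map_add, FreeAbelianGroup.lift_apply_of,
      FreeAbelianGroup.lift_apply_of, FreeAbelianGroup.lift_apply_of, sub_eq_zero]
    exact h

theorem map_of (F : C ⥤ D) [F.Additive] (X : C) : map F (K0.of X) = K0.of (F.obj X) :=
  FreeAbelianGroup.lift_apply_of _ _

theorem hom_ext {G : Type*} [AddCommGroup G] {f g : K0 C →+ G}
    (h : ∀ X, f (K0.of X) = g (K0.of X)) : f = g :=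
  QuotientAddGroup.addMonoidHom_ext _ (FreeAbelianGroup.lift_ext _ _ h)

/-- The isomorphism of Grothendieck groups defined by an additive equivalence. -/
theorem exists_addEquiv {Z : C} (hZ : Limits.IsZero Z) (F : C ⥤ D) [F.Additive]
    [F.IsEquivalence] : ∃ φ : K0 C ≃+ K0 D, ∀ X, φ (K0.of X) = K0.of (F.obj X) := by
  have : F.asEquivalence.functor.Additive := ‹F.Additive›
  have : F.inv.Additive := F.asEquivalence.inverse_additive
  have hFZ : Limits.IsZero (F.obj Z) := F.map_isZero hZ
  refine ⟨AddMonoidHom.toAddEquiv (map F) (map F.inv) (hom_ext fun X => ?_) (hom_ext fun X => ?_),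
    map_of F⟩
  · rw [AddMonoidHom.comp_apply, map_of, map_of]
    exact of_eq_of_iso hZ (F.asEquivalence.unitIso.app X).symm
  · rw [AddMonoidHom.comp_apply, map_of, map_of]
    exact of_eq_of_iso hFZ (F.asEquivalence.counitIso.app X)

end

end K0

/-! ### The zero object of the category of Clifford modules. -/

section ZeroModule

variable {M : Type u} [TopologicalSpace M] {n : ℕ} {V : M → Type v}
  [∀ x, NormedAddCommGroup (V x)] [∀ x, InnerProductSpace ℝ (V x)]
  [TopologicalSpace (TotalSpace (Model n) V)]
  {o : ∀ x, Orientation ℝ (V x) (Fin (2 * n))}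

/-- The zero vector bundle. -/
def zeroBundle (X : Type u) [TopologicalSpace X] : ComplexBundle.{u, w} X :=
  ofCharts (Fib := fun _ : X => PUnit.{w + 1}) (I := Unit)
    (fun _ => { rank := 0, dom := Set.univ, isOpen_dom := isOpen_univ, coord := 0, sec := 0
                coord_sec := fun _ _ _ => Subsingleton.elim _ _
                sec_coord := fun _ _ _ => rfl })
    (fun _ _ _ _ _ _ => continuousAt_const) fun _ => ⟨(), trivial⟩

variable (V o) in
/-- The zero Clifford module. -/
def zeroModule : CliffordModule.{u, v, w} V o where
  toComplexBundle := zeroBundle M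
  cl _ :=
    { toFun := fun _ => 0
      map_one' := rfl
      map_mul' := fun _ _ => rfl
      map_zero' := rfl
      map_add' := fun _ _ => rfl
      commutes' := fun _ => rfl }
  continuous_cl :=
    (continuous_pullback_iff (E := zeroBundle M) (F := zeroBundle M)
      (f := fun _ : ClTotal V o => 0) ClTotal.continuous_base ClTotal.continuous_base).2
      fun _ => FamContAt.zero

/-- This supplies the zero object required by `K0.exists_addEquiv`, whose image under the functor is
then a zero gerbe module. -/
theorem isZero_zeroModule : Limits.IsZero (zeroModule.{u, v, w} V o) :=
  (Limits.IsZero.iff_id_eq_zero _).2 rfl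

end ZeroModule

end CliffordGerbe

theorem mainTheorem9 {M : Type u} [TopologicalSpace M] {n : ℕ} (V : M → Type v)
    [∀ x, NormedAddCommGroup (V x)] [∀ x, InnerProductSpace ℝ (V x)]
    [TopologicalSpace (TotalSpace (EuclideanSpace ℝ (Fin (2 * n))) V)]
    [FiberBundle (EuclideanSpace ℝ (Fin (2 * n))) V]
    [VectorBundle ℝ (EuclideanSpace ℝ (Fin (2 * n))) V]
    [IsContinuousRiemannianBundle (EuclideanSpace ℝ (Fin (2 * n))) V]
    (o : ∀ x, Orientation ℝ (V x) (Fin (2 * n)))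
    (ho : CliffordGerbe.IsBundleOrientation V o)
    (S : CliffordGerbe.SpinorRep.{w} n) :
    ∃ Ψ : CliffordGerbe.CliffordModule.{u, v, w} V o ⥤ CliffordGerbe.GerbeModule.{u, v, w} V o,
      CliffordGerbe.IsSpinorTensorFunctor S Ψ ∧ Ψ.IsEquivalence ∧
      ∃ φ : CliffordGerbe.K0 (CliffordGerbe.CliffordModule.{u, v, w} V o) ≃+
          CliffordGerbe.K0 (CliffordGerbe.GerbeModule.{u, v, w} V o),
        ∀ E, φ (CliffordGerbe.K0.of E) = CliffordGerbe.K0.of (Ψ.obj E) := by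
  have := CliffordGerbe.isEquivalence_spinorFunctor ho S
  exact ⟨CliffordGerbe.CliffordModule.spinorFunctor S,
    CliffordGerbe.CliffordModule.isSpinorTensorFunctor S, this,
    CliffordGerbe.K0.exists_addEquiv CliffordGerbe.isZero_zeroModule _⟩

end
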